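/- Let $M$ be a smooth manifold (finite-dimensional, Hausdorff, second countable), let $(A\to M,\rho,[\cdot,\cdot])$ be a Lie algebroid over $M$, and let $(F_M,J,\nabla)$ be an infinitesimal ideal system in $A$. That is, $F_M\subseteq TM$ is an involutive smooth subbundle, $J\subseteq A$ is a smooth subbundle with $\rho(J)\subseteq F_M$, and $\nabla$ is a flat partial $F_M$-connection on $A/J$ such that, calling $a\in\Gamma(A)$ $\nabla$-parallel if $\nabla_X\bar a=0$ for all $X\in\Gamma(F_M)$, where $\bar a\in\Gamma(A/J)$ is the class of $a$: 1. if $a\in\Gamma(A)$ is $\nabla$-parallel, then $[a,j]\in\Gamma(J)$ for all $j\in\Gamma(J)$; 2. if $a,b\in\Gamma(A)$ are $\nabla$-parallel, then $[a,b]$ is $\nabla$-parallel; 3. if $a\in\Gamma(A)$ is $\nabla$-parallel, then the class of $\rho(a)$ in $\Gamma(TM/F_M)$ is parallel for the Bott connection $\nabla^{F_M}_X\bar Y=\overline{[X,Y]}$. Let $q$ be the (constant) codimension of $F_M$ in $TM$ and let $s$ be the codimension of $J$ in $A$. For a Lie algebroid $B\to M$ and a smooth vector bundle $E\to M$, let $\mathrm{Pont}^\bullet_B(E)\subseteq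 H^\bullet(B)$ be the $\mathbb R$-subalgebra of the Lie algebroid cohomology of $B$ generated by the $B$-Pontryagin characters $[\mathrm{tr}(R_D^i)]\in H^{2i}(B)$, $i\ge 1$, where $D$ is a linear $B$-connection on $E$ with curvature $R_D$ (the forms $\mathrm{tr}(R_D^i)$ are closed), let $\mathrm{Pont}^r_B(E)\subseteq H^r(B)$ be its part of degree $r$, and write $\mathrm{Pont}^r(E):=\mathrm{Pont}^r_{TM}(E)\subseteq H^r(M)$. Then (i) $\mathrm{Pont}^r(A/J)=0$ and $\mathrm{Pont}^r(TM/F_M)=0$ in $H^r(M)$ for all $r>2q$; (ii) $\mathrm{Pont}^r_A(A/J)=0$ and $\mathrm{Pont}^r_A(TM/F_M)=0$ in $H^r(A)$ for all $r>2\min\{s,q\}$. -/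

import Mathlib

open Bundle Set Filter Topology
open scoped Manifold ContDiff

noncomputable section

section Sections

variable (n : ℕ) {M : Type*} [TopologicalSpace M] [ChartedSpace (EuclideanSpace ℝ (Fin n)) M]

/-- The ring `C^∞(M)`. -/
abbrev SmoothFun (M : Type*) [TopologicalSpace M] [ChartedSpace (EuclideanSpace ℝ (Fin n)) M] :
    Type _ := C^∞⟮𝓡 n, M; ℝ⟯

variable (F : Type*) [NormedAddCommGroup F] [NormedSpace ℝ F]
  (V : M → Type*) [TopologicalSpace (TotalSpace F V)] [∀ x, AddCommGroup (V x)]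
  [∀ x, Module ℝ (V x)] [∀ x, TopologicalSpace (V x)] [FiberBundle F V] [VectorBundle ℝ F V]

/-- `Γ(V)`: the smooth sections of the vector bundle `V → M` with typical fibre `F`. -/
abbrev Sec : Type _ := Cₛ^∞⟮𝓡 n; F, V⟯

/-- `Γ(V)` is a `C^∞(M)`-module by pointwise multiplication. -/
instance Sec.instSMulFun : SMul (SmoothFun n M) (Sec n F V) :=
  ⟨fun f a => ⟨fun x => f x • a x, f.contMDiff.smul_section a.contMDiff⟩⟩

variable {n F V}
@[simp] theorem Sec.smulFun_apply (f : SmoothFun n M) (a : Sec n F V) (x : M) :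
    (f • a) x = f x • a x := rfl

theorem Sec.sub_apply (a b : Sec n F V) (x : M) : (a - b) x = a x - b x := rfl

theorem Sec.sum_apply {ι : Type} (s : Finset ι) (a : ι → Sec n F V) (x : M) :
    (∑ i ∈ s, a i) x = ∑ i ∈ s, a i x := by
  rw [← ContMDiffSection.coeAddHom_apply, map_sum, Finset.sum_apply]
  rfl

variable (n F V)
instance Sec.instModuleFun : Module (SmoothFun n M) (Sec n F V) where
  one_smul a := by ext x; simp
  mul_smul f g a := by ext x; simp [mul_smul]
  smul_zero f := by ext x; simp
  smul_add f a b := by ext x; simp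
  add_smul f g a := by ext x; simp [add_smul]
  zero_smul a := by ext x; simp

instance Sec.instTower : IsScalarTower ℝ (SmoothFun n M) (Sec n F V) where
  smul_assoc c f a := by ext x; simp [mul_smul]

end Sections

section VectorFields
variable (n : ℕ) (M : Type*) [TopologicalSpace M] [ChartedSpace (EuclideanSpace ℝ (Fin n)) M]
  [IsManifold (𝓡 n) ∞ M]

/-- `𝔛(M) = Γ(TM)`: the smooth vector fields. -/
abbrev VF : Type _ := Sec n (EuclideanSpace ℝ (Fin n)) (fun x : M => TangentSpace (𝓡 n) x)

variable {n M}


/-- The derivative `X f = df(X)` of the smooth function `f` along the vector field `X`. -/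
def VF.act (X : VF n M) (f : SmoothFun n M) : SmoothFun n M :=
  ⟨fun x => mvfderiv (𝓡 n) f x (X x),
    (contMDiff_snd_tangentBundle_modelSpace ℝ 𝓘(ℝ, ℝ)).comp
      ((f.contMDiff.contMDiff_tangentMap (by simp)).comp X.contMDiff)⟩

@[simp] theorem VF.act_apply (X : VF n M) (f : SmoothFun n M) (x : M) :
    X.act f x = mvfderiv (𝓡 n) f x (X x) := rfl

/-- The Lie bracket of vector fields. -/
def VF.bracket (X Y : VF n M) : VF n M :=
  ⟨fun x => VectorField.mlieBracket (𝓡 n) (fun y => X y) (fun y => Y y) x, by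
    have : IsManifold (𝓡 n) (((⊤ : ℕ∞) : WithTop ℕ∞) + 1) M := by
      simpa using (inferInstance : IsManifold (𝓡 n) ∞ M)
    have : IsManifold (𝓡 n) (minSmoothness ℝ 2) M := by
      rw [minSmoothness_of_isRCLikeNormedField]
      exact IsManifold.of_le (n := ∞) (WithTop.coe_le_coe.2 le_top)
    have : IsManifold (𝓡 n) (minSmoothness ℝ 3) M := by
      rw [minSmoothness_of_isRCLikeNormedField]
      exact IsManifold.of_le (n := ∞) (WithTop.coe_le_coe.2 le_top)
    exact ContDiff.mlieBracket_vectorField (m := ⊤) (n := ⊤) X.contMDiff Y.contMDiff (by simp)⟩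

@[simp] theorem VF.bracket_apply (X Y : VF n M) (x : M) : X.bracket Y x =
    VectorField.mlieBracket (𝓡 n) (fun y => X y) (fun y => Y y) x := rfl

variable (F : Type*) [NormedAddCommGroup F] [NormedSpace ℝ F]
  (A : M → Type*) [TopologicalSpace (TotalSpace F A)] [∀ x, AddCommGroup (A x)]
  [∀ x, Module ℝ (A x)] [∀ x, TopologicalSpace (A x)] [FiberBundle F A] [VectorBundle ℝ F A]

variable (n) in
/-- A Lie algebroid structure on the vector bundle `A → M`: a smooth bundle map
`ρ : A → TM` over the identity and an `ℝ`-Lie bracket on `Γ(A)` with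
`[a, f b] = f [a, b] + (ρ(a) f) b`. -/
structure LieAlgebroid where
  rho : ∀ x, A x →ₗ[ℝ] TangentSpace (𝓡 n) x
  contMDiff_rho : ContMDiff ((𝓡 n).prod 𝓘(ℝ, F)) ((𝓡 n).prod 𝓘(ℝ, EuclideanSpace ℝ (Fin n))) ∞
    (fun p : TotalSpace F A => (⟨p.1, rho p.1 p.2⟩ : TangentBundle (𝓡 n) M))
  bracket : Sec n F A → Sec n F A → Sec n F A
  bracket_add : ∀ a b c, bracket a (b + c) = bracket a b + bracket a c
  bracket_smul : ∀ (r : ℝ) a b, bracket a (r • b) = r • bracket a b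
  bracket_swap : ∀ a b, bracket a b = - bracket b a
  jacobi : ∀ a b c, bracket a (bracket b c) = bracket (bracket a b) c + bracket b (bracket a c)
  leibniz : ∀ (a b) (f : SmoothFun n M), bracket a (f • b) = f • bracket a b +
    VF.act ⟨fun x => rho x (a x), contMDiff_rho.comp a.contMDiff⟩ f • b

variable {F A}

/-- The anchor on sections, `ρ : Γ(A) → 𝔛(M)`. -/
def LieAlgebroid.anchor (L : LieAlgebroid n F A) : Sec n F A →ₗ[SmoothFun n M] VF n M where
  toFun a := ⟨fun x => L.rho x (a x), L.contMDiff_rho.comp a.contMDiff⟩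
  map_add' a b := by ext x; simp
  map_smul' f a := by ext x; simp

@[simp] theorem LieAlgebroid.anchor_apply (L : LieAlgebroid n F A) (a : Sec n F A) (x : M) :
    L.anchor a x = L.rho x (a x) := rfl

variable (n M)
/-- The standard Lie algebroid `TM → M`: identity anchor and Lie bracket of vector fields. -/
def tangentLieAlgebroid : LieAlgebroid n (EuclideanSpace ℝ (Fin n))
    (fun x : M => TangentSpace (𝓡 n) x) where
  rho _ := LinearMap.id
  contMDiff_rho := contMDiff_id
  bracket := VF.bracket
  bracket_add a b c := by
    ext1 x
    exact VectorField.mlieBracket_add_right b.mdifferentiableAt c.mdifferentiableAt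
  bracket_smul r a b := by
    ext1 x
    exact VectorField.mlieBracket_const_smul_right b.mdifferentiableAt
  bracket_swap a b := by
    ext1 x
    exact VectorField.mlieBracket_swap_apply
  jacobi a b c := by
    ext1 x
    have : IsManifold (𝓡 n) (minSmoothness ℝ 3) M := by
      rw [minSmoothness_of_isRCLikeNormedField]
      exact IsManifold.of_le (n := ∞) (WithTop.coe_le_coe.2 le_top)
    have h : ∀ a : VF n M, ContMDiffAt (𝓡 n) (𝓡 n).tangent (minSmoothness ℝ 2)
        (fun x => (⟨x, a x⟩ : TangentBundle (𝓡 n) M)) x := fun a => by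
      rw [minSmoothness_of_isRCLikeNormedField]
      exact a.contMDiff.contMDiffAt.of_le (WithTop.coe_le_coe.2 le_top)
    exact VectorField.leibniz_identity_mlieBracket_apply (h a) (h b) (h c)
  leibniz a b f := by
    ext1 x
    refine (VectorField.mlieBracket_smul_right (f.mdifferentiableAt) b.mdifferentiableAt).trans ?_
    rw [add_comm]; rfl
end VectorFields

section Quot
variable {n : ℕ} {M : Type*} [TopologicalSpace M] [ChartedSpace (EuclideanSpace ℝ (Fin n)) M]
variable {F : Type*} [NormedAddCommGroup F] [NormedSpace ℝ F]
  {V : M → Type*} [TopologicalSpace (TotalSpace F V)] [∀ x, AddCommGroup (V x)]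
  [∀ x, Module ℝ (V x)] [∀ x, TopologicalSpace (V x)] [FiberBundle F V] [VectorBundle ℝ F V]

variable (n F V) in
/-- A smooth vector subbundle `W ⊆ V` of codimension `c` (constant rank `k` with
`k + c = rank V`): a family of subspaces `W_x ⊆ V_x` admitting local smooth frames. -/
structure Subbundle (c : ℕ) where
  fiber : ∀ x, Submodule ℝ (V x)
  rank : ℕ
  rank_add : rank + c = Module.finrank ℝ F
  exists_frame : ∀ x₀ : M, ∃ U : Set M, IsOpen U ∧ x₀ ∈ U ∧ ∃ s : Fin rank → ∀ x, V x,
    (∀ i, ContMDiffOn (𝓡 n) ((𝓡 n).prod 𝓘(ℝ, F)) ∞ (fun x => TotalSpace.mk' F x (s i x)) U) ∧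
    ∀ x ∈ U, LinearIndependent ℝ (fun i => s i x) ∧
      Submodule.span ℝ (Set.range fun i => s i x) = fiber x

variable {c : ℕ} (W : Subbundle n F V c)

/-- `Γ(W) ⊆ Γ(V)`. -/
def Subbundle.sec : Submodule (SmoothFun n M) (Sec n F V) where
  carrier := {a | ∀ x, a x ∈ W.fiber x}
  add_mem' ha hb x := (W.fiber x).add_mem (ha x) (hb x)
  zero_mem' x := (W.fiber x).zero_mem
  smul_mem' f _ ha x := (W.fiber x).smul_mem (f x) (ha x)

/-- The sections of the quotient bundle, `Γ(V/W) = Γ(V)/Γ(W)`; its fibres are `V_x/W_x`. -/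
abbrev Subbundle.QuotSec : Type _ := Sec n F V ⧸ W.sec

/-- Evaluation `Γ(V/W) → V_x/W_x` at `x`, linear along `f ↦ f x`. -/
def Subbundle.ev (x : M) :
    W.QuotSec →ₛₗ[(ContMDiffMap.evalRingHom x : SmoothFun n M →+* ℝ)] (V x ⧸ W.fiber x) :=
  W.sec.liftQ
    { toFun := fun a => (W.fiber x).mkQ (a x)
      map_add' := fun a b => by simp
      map_smul' := fun f a => by simp; rfl }
    fun a ha => by simpa using ha x

theorem Subbundle.ev_mk (x : M) (a : Sec n F V) :
    W.ev x (Submodule.Quotient.mk a) = Submodule.Quotient.mk (a x) := rfl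

theorem Subbundle.ev_smul (x : M) (f : SmoothFun n M) (a : W.QuotSec) :
    W.ev x (f • a) = f x • W.ev x a := (W.ev x).map_smulₛₗ f a

variable [ContMDiffVectorBundle ∞ F V (𝓡 n)]

/-- Sections forming a basis at `x₀` form a smooth frame near `x₀`. -/
theorem exists_local_coeff {ι : Type} [Fintype ι] {x₀ : M} {U : Set M} (hU : U ∈ 𝓝 x₀)
    (t : ι → ∀ x, V x)
    (ht : ∀ i, ContMDiffOn (𝓡 n) ((𝓡 n).prod 𝓘(ℝ, F)) ∞ (fun x => TotalSpace.mk' F x (t i x)) U)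
    (b : Module.Basis ι ℝ (V x₀)) (hb : ∀ i, b i = t i x₀) :
    ∃ U' : Set M, IsOpen U' ∧ x₀ ∈ U' ∧ U' ⊆ U ∧ (∀ x ∈ U', LinearIndependent ℝ (fun i => t i x)) ∧
      ∀ v : Sec n F V, ∃ f : ι → M → ℝ, (∀ i, ContMDiffOn (𝓡 n) 𝓘(ℝ, ℝ) ∞ (f i) U') ∧
        ∀ x ∈ U', v x = ∑ i, f i x • t i x := by
  classical
  let e := trivializationAt F V x₀
  have he : x₀ ∈ e.baseSet := FiberBundle.mem_baseSet_trivializationAt' x₀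
  let Φ : M → ((ι → ℝ) →L[ℝ] F) := fun x => ∑ i,
    ContinuousLinearMap.smulRightL ℝ (ι → ℝ) F (ContinuousLinearMap.proj i) (e ⟨x, t i x⟩).2
  have hΦ_apply : ∀ x a, Φ x a = ∑ i, a i • (e ⟨x, t i x⟩).2 := by
    intro x a; simp [Φ]
  have hlin : ∀ x ∈ e.baseSet, ∀ a : ι → ℝ, (e ⟨x, ∑ i, a i • t i x⟩).2 = Φ x a := by
    intro x hx a
    have h := fun w : V x => e.linearEquivAt_apply (R := ℝ) x hx w
    rw [hΦ_apply, ← h, map_sum]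
    exact Finset.sum_congr rfl fun i _ => by rw [map_smul, h]
  have hcont : ∀ i, ∀ x ∈ interior U ∩ e.baseSet,
      ContMDiffAt (𝓡 n) 𝓘(ℝ, F) ∞ (fun y => (e ⟨y, t i y⟩).2) x := fun i x hx =>
    (e.contMDiffAt_section_iff hx.2).1
      ((ht i).contMDiffAt (mem_interior_iff_mem_nhds.1 hx.1))
  have hΦ : ∀ x ∈ interior U ∩ e.baseSet,
      ContMDiffAt (𝓡 n) 𝓘(ℝ, (ι → ℝ) →L[ℝ] F) ∞ Φ x := by
    intro x hx
    let G : (ι → F) →L[ℝ] ((ι → ℝ) →L[ℝ] F) := ∑ i,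
      (ContinuousLinearMap.smulRightL ℝ (ι → ℝ) F (ContinuousLinearMap.proj i)).comp
        (ContinuousLinearMap.proj i)
    have h1 : Φ = fun y => G (fun i => (e ⟨y, t i y⟩).2) := by
      funext y; simp [Φ, G]
    rw [h1]
    exact G.contMDiff.contMDiffAt.comp x (contMDiffAt_pi_space.2 fun i => hcont i x hx)
  let E₀ : (ι → ℝ) ≃L[ℝ] F :=
    (b.equivFun.symm.trans (e.linearEquivAt ℝ x₀ he)).toContinuousLinearEquiv
  have hE₀ : (E₀ : (ι → ℝ) →L[ℝ] F) = Φ x₀ := by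
    ext a
    rw [← hlin x₀ he, ← e.linearEquivAt_apply (R := ℝ) x₀ he]
    change e.linearEquivAt ℝ x₀ he (b.equivFun.symm a) = _
    rw [Module.Basis.equivFun_symm_apply]
    simp only [hb]
  have hx₀ : x₀ ∈ interior U ∩ e.baseSet := ⟨mem_interior_iff_mem_nhds.2 hU, he⟩
  have hnhds : (interior U ∩ e.baseSet) ∩
      Φ ⁻¹' (Set.range ((↑) : ((ι → ℝ) ≃L[ℝ] F) → ((ι → ℝ) →L[ℝ] F))) ∈ 𝓝 x₀ := by
    refine inter_mem ((isOpen_interior.inter e.open_baseSet).mem_nhds hx₀) ?_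
    refine (hΦ x₀ hx₀).continuousAt.preimage_mem_nhds ?_
    rw [← hE₀]
    exact E₀.nhds
  obtain ⟨U', hU', hU'o, hxU'⟩ := mem_nhds_iff.1 hnhds
  refine ⟨U', hU'o, hxU', fun x hx => interior_subset (hU' hx).1.1, ?_, ?_⟩
  · intro x hx
    obtain ⟨E, hE⟩ := (hU' hx).2
    rw [Fintype.linearIndependent_iff]
    intro g hg
    have h1 : Φ x g = 0 := by
      rw [← hlin x (hU' hx).1.2, hg, ← e.linearEquivAt_apply (R := ℝ) x (hU' hx).1.2, map_zero]
    rw [← hE] at h1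
    have : g = 0 := by simpa using h1
    simp [this]
  · intro v
    refine ⟨fun i x => (Φ x).inverse (e ⟨x, v x⟩).2 i, ?_, ?_⟩
    · intro i x hx
      obtain ⟨E, hE⟩ := (hU' hx).2
      have h1 : ContMDiffAt (𝓡 n) 𝓘(ℝ, F →L[ℝ] (ι → ℝ)) ∞ (fun y => (Φ y).inverse) x := by
        have h := contDiffAt_map_inverse (n := ∞) E
        rw [hE] at h
        exact h.contMDiffAt.comp x (hΦ x (hU' hx).1)
      have h2 : ContMDiffAt (𝓡 n) 𝓘(ℝ, F) ∞ (fun y => (e ⟨y, v y⟩).2) x :=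
        (e.contMDiffAt_section_iff (hU' hx).1.2).1 v.contMDiff.contMDiffAt
      have h3 := h1.clm_apply h2
      exact ((contMDiffAt_pi_space.1 h3) i).contMDiffWithinAt
    · intro x hx
      obtain ⟨E, hE⟩ := (hU' hx).2
      have hxe := (hU' hx).1.2
      apply (e.linearEquivAt ℝ x hxe).injective
      rw [e.linearEquivAt_apply, e.linearEquivAt_apply, hlin x hxe]
      change _ = Φ x ((Φ x).inverse (e ⟨x, v x⟩).2)
      rw [← hE]
      simp

variable [IsManifold (𝓡 n) ∞ M] [T2Space M]

theorem exists_sec_eq {x : M} (v : V x) : ∃ a : Sec n F V, a x = v := by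
  obtain ⟨S, hS, hSs⟩ := FiberBundle.exists_contMDiffOn_extend (𝓡 n) F (k := ∞) v
  obtain ⟨χ, -, hχ⟩ := (SmoothBumpFunction.nhds_basis_tsupport (I := 𝓡 n) x).mem_iff.1
    (isOpen_interior.mem_nhds (mem_interior_iff_mem_nhds.2 hS))
  refine ⟨⟨_, ContMDiffOn.smul_section_of_tsupport
    χ.contMDiff.contMDiffOn isOpen_interior hχ (hSs.mono interior_subset)⟩, ?_⟩
  change χ x • FiberBundle.extend F v x = v
  simp

theorem Subbundle.ev_surjective (x : M) : Function.Surjective (W.ev x) := by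
  intro u
  obtain ⟨v, rfl⟩ := Submodule.Quotient.mk_surjective _ u
  obtain ⟨a, rfl⟩ := exists_sec_eq (n := n) (F := F) v
  exact ⟨Submodule.Quotient.mk a, W.ev_mk x a⟩

variable [FiniteDimensional ℝ F]

/-- Near every point, `V/W` has a frame of global sections, with smooth coefficients. -/
theorem Subbundle.exists_adapted (x₀ : M) : ∃ (ψ : SmoothFun n M) (e : Fin c → Sec n F V),
    ∃ U ∈ 𝓝 x₀, (∀ x ∈ U, ψ x = 1) ∧
      (∀ x ∈ U, ∀ a : Fin c → ℝ, ∑ j, a j • e j x ∈ W.fiber x → a = 0) ∧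
      ∀ v : Sec n F V, ∃ f : Fin c → SmoothFun n M, ψ • v - ∑ j, f j • e j ∈ W.sec := by
  classical
  obtain ⟨U₁, hU₁o, hxU₁, s, hs, hsW⟩ := W.exists_frame x₀
  let τ := trivializationAt F V x₀
  have eqv : V x₀ ≃ₗ[ℝ] F := τ.linearEquivAt ℝ x₀ (FiberBundle.mem_baseSet_trivializationAt' x₀)
  have hfd : FiniteDimensional ℝ (V x₀) := Module.Finite.equiv eqv.symm
  obtain ⟨C, hC⟩ := Submodule.exists_isCompl (W.fiber x₀)
  obtain ⟨hli, hspan⟩ := hsW x₀ hxU₁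
  have hrk : Module.finrank ℝ (W.fiber x₀) = W.rank := by
    rw [← hspan, finrank_span_eq_card hli, Fintype.card_fin]
  have hCc : Module.finrank ℝ C = c := by
    have h1 := Submodule.finrank_add_eq_of_isCompl hC
    rw [eqv.finrank_eq, ← W.rank_add] at h1
    omega
  let bC := Module.finBasisOfFinrankEq ℝ C hCc
  let t : Fin W.rank ⊕ Fin c → ∀ x, V x :=
    Sum.elim s (fun j => FiberBundle.extend F (bC j : V x₀))
  have hext := fun j => FiberBundle.exists_contMDiffOn_extend (𝓡 n) F (k := ∞) (bC j : V x₀)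
  choose S hS hSs using hext
  have hU₂ : U₁ ∩ ⋂ j, S j ∈ 𝓝 x₀ :=
    inter_mem (hU₁o.mem_nhds hxU₁) (iInter_mem.2 hS)
  have htli : LinearIndependent ℝ (fun i => t i x₀) := by
    have h2 : LinearIndependent ℝ (fun j => (bC j : V x₀)) :=
      bC.linearIndependent.map' C.subtype C.ker_subtype
    have h3 := hli.sum_type h2 (by
      rw [hspan]
      refine hC.disjoint.mono_right (Submodule.span_le.2 ?_)
      rintro _ ⟨j, rfl⟩
      exact (bC j).2)
    have h4 : (fun i => t i x₀) = Sum.elim (fun i => s i x₀) (fun j => (bC j : V x₀)) := by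
      funext i
      rcases i with i | j <;> simp [t]
    rw [h4]
    exact h3
  obtain ⟨U', hU'o, hxU', hU'U, hU'li, hU'c⟩ := exists_local_coeff hU₂ t (by
      rintro (i | j)
      · exact (hs i).mono fun x hx => hx.1
      · exact (hSs j).mono fun x hx => Set.mem_iInter.1 hx.2 j)
    (basisOfLinearIndependentOfCardEqFinrank' _ htli (by
      rw [eqv.finrank_eq, ← W.rank_add]; simp)) (by intro i; simp)
  obtain ⟨χ, -, hχ⟩ := (SmoothBumpFunction.nhds_basis_tsupport (I := 𝓡 n) x₀).mem_iff.1
    (hU'o.mem_nhds hxU')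
  let χ' : SmoothFun n M := ⟨χ, χ.contMDiff⟩
  have hχ' : ∀ x, x ∉ U' → χ x = 0 := fun x hx =>
    image_eq_zero_of_notMem_tsupport fun h => hx (hχ h)
  have hglob : ∀ j, ContMDiff (𝓡 n) ((𝓡 n).prod 𝓘(ℝ, F)) ∞
      (fun x => TotalSpace.mk' F x (χ x • t (Sum.inr j) x)) := fun j =>
    ContMDiffOn.smul_section_of_tsupport χ.contMDiff.contMDiffOn hU'o hχ
      ((hSs j).mono fun x hx => Set.mem_iInter.1 (hU'U hx).2 j)
  let e : Fin c → Sec n F V := fun j => ⟨_, hglob j⟩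
  have he : ∀ j x, e j x = χ x • t (Sum.inr j) x := fun j x => rfl
  have hmemW : ∀ x ∈ U', ∀ a : Fin W.rank → ℝ, ∑ i, a i • s i x ∈ W.fiber x := by
    intro x hx a
    rw [← (hsW x (hU'U hx).1).2]
    exact Submodule.sum_mem _ fun i _ => Submodule.smul_mem _ _ (Submodule.subset_span ⟨i, rfl⟩)
  refine ⟨χ' * χ', e, U' ∩ {x | χ x = 1}, inter_mem (hU'o.mem_nhds hxU') χ.eventuallyEq_one,
    fun x hx => ?_, ?_, ?_⟩
  · have : χ x = 1 := hx.2
    change χ x * χ x = 1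
    simp [this]
  · intro x hx a ha
    have h1 : χ x = 1 := hx.2
    simp only [he, h1, one_smul] at ha
    rw [← (hsW x (hU'U hx.1).1).2, Submodule.mem_span_range_iff_exists_fun] at ha
    obtain ⟨d, hd⟩ := ha
    have h2 := Fintype.linearIndependent_iff.1 (hU'li x hx.1) (Sum.elim d (-a)) (by
      simp [t] at hd
      simp [t, hd])
    funext j
    simpa using h2 (Sum.inr j)
  · intro v
    obtain ⟨f, hf, hfv⟩ := hU'c v
    have hf' : ∀ j, ContMDiff (𝓡 n) 𝓘(ℝ, ℝ) ∞ (fun x => χ x • f (Sum.inr j) x) := by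
      intro j
      refine contMDiff_of_tsupport fun x hx => ?_
      have hx' : x ∈ U' := hχ (closure_mono (Function.support_smul_subset_left _ _) hx)
      exact χ.contMDiff.contMDiffAt.smul ((hf _).contMDiffAt (hU'o.mem_nhds hx'))
    let g : Fin c → SmoothFun n M := fun j => ⟨_, hf' j⟩
    refine ⟨g, fun x => ?_⟩
    have hval : (((χ' * χ') • v - ∑ j, g j • e j : Sec n F V)) x =
        (χ x * χ x) • v x - ∑ j, (χ x • f (Sum.inr j) x) • e j x := by
      rw [Sec.sub_apply, Sec.sum_apply]
      rfl
    rw [hval]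
    by_cases hx : x ∈ U'
    · have := hmemW x hx (fun i => χ x * χ x * f (Sum.inl i) x)
      have h2 : (χ x * χ x) • v x - ∑ j, (χ x • f (Sum.inr j) x) • e j x =
          ∑ i, (χ x * χ x * f (Sum.inl i) x) • s i x := by
        rw [hfv x hx, Fintype.sum_sum_type, smul_add, Finset.smul_sum, Finset.smul_sum]
        simp only [he, smul_smul, smul_eq_mul, t, Sum.elim_inl, Sum.elim_inr]
        rw [add_sub_assoc, sub_eq_zero.2, add_zero]
        refine Finset.sum_congr rfl fun j _ => ?_
        congr 1; ring
      rw [h2]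
      exact this
    · simp [hχ' x hx]


theorem Subbundle.exists_adapted_quot (x₀ : M) : ∃ (ψ : SmoothFun n M) (e : Fin c → W.QuotSec),
    ∃ U ∈ 𝓝 x₀, (∀ x ∈ U, ψ x = 1) ∧
      (∀ x ∈ U, LinearIndependent ℝ (fun j => W.ev x (e j))) ∧
      ∀ v : W.QuotSec, ∃ f : Fin c → SmoothFun n M, ψ • v = ∑ j, f j • e j := by
  obtain ⟨ψ, e, U, hU, hψ, hli, hdec⟩ := W.exists_adapted x₀
  refine ⟨ψ, fun j => Submodule.Quotient.mk (e j), U, hU, hψ, fun x hx => ?_, fun v => ?_⟩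
  · rw [Fintype.linearIndependent_iff]
    intro a ha
    have : a = 0 := hli x hx a (by
      rw [← Submodule.Quotient.mk_eq_zero, ← ha, ← Submodule.mkQ_apply, map_sum]
      rfl)
    simp [this]
  · obtain ⟨v, rfl⟩ := Submodule.Quotient.mk_surjective _ v
    obtain ⟨f, hf⟩ := hdec v
    refine ⟨f, ?_⟩
    rw [← Submodule.Quotient.mk_smul, ← sub_eq_zero]
    have h2 : ∑ j, f j • (Submodule.Quotient.mk (e j) : W.QuotSec) =
        Submodule.Quotient.mk (∑ j, f j • e j) := by
      rw [← Submodule.mkQ_apply, map_sum]; rfl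
    rw [h2, ← Submodule.Quotient.mk_sub, Submodule.Quotient.mk_eq_zero]
    exact hf

theorem Subbundle.ev_end_eq_zero (φ : Module.End (SmoothFun n M) W.QuotSec) (x : M)
    (v : W.QuotSec) (hv : W.ev x v = 0) : W.ev x (φ v) = 0 := by
  obtain ⟨ψ, e, U, hU, hψ, hli, hdec⟩ := W.exists_adapted_quot x
  have hx := mem_of_mem_nhds hU
  obtain ⟨f, hf⟩ := hdec v
  have h1 := congrArg (W.ev x) hf
  rw [W.ev_smul, hv, smul_zero, map_sum] at h1
  simp only [W.ev_smul] at h1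
  have h2 := Fintype.linearIndependent_iff.1 (hli x hx) (fun j => f j x) h1.symm
  have h3 := congrArg (fun w => W.ev x (φ w)) hf
  simp only [map_smul, map_sum, W.ev_smul, h2, hψ x hx, one_smul, zero_smul,
    Finset.sum_const_zero] at h3
  exact h3

/-- An element of `Γ(End(V/W))` is a `C^∞(M)`-linear endomorphism `φ` of `Γ(V/W)`; this is its
value at `x`, the endomorphism of `V_x/W_x` with `φ_x (e x) = (φ e) x` (`fiberEnd_ev`). -/
def Subbundle.fiberEnd (φ : Module.End (SmoothFun n M) W.QuotSec) (x : M) :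
    Module.End ℝ (V x ⧸ W.fiber x) where
  toFun u := W.ev x (φ (Function.surjInv (W.ev_surjective x) u))
  map_add' u v := by
    rw [← map_add, ← map_add, ← sub_eq_zero, ← map_sub, ← map_sub]
    apply W.ev_end_eq_zero
    simp [Function.surjInv_eq]
  map_smul' r u := by
    have h : ∀ v, r • W.ev x v = W.ev x ((ContMDiffMap.C r : SmoothFun n M) • v) :=
      fun v => (W.ev_smul x (ContMDiffMap.C r) v).symm
    rw [RingHom.id_apply, h, ← map_smul, ← sub_eq_zero, ← map_sub, ← map_sub]
    apply W.ev_end_eq_zero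
    rw [map_sub, ← h]
    simp [Function.surjInv_eq]

theorem Subbundle.fiberEnd_ev (φ : Module.End (SmoothFun n M) W.QuotSec) (x : M)
    (v : W.QuotSec) : W.fiberEnd φ x (W.ev x v) = W.ev x (φ v) := by
  change W.ev x (φ _) = _
  rw [← sub_eq_zero, ← map_sub, ← map_sub]
  apply W.ev_end_eq_zero
  simp [Function.surjInv_eq]

theorem Subbundle.contMDiff_trace (φ : Module.End (SmoothFun n M) W.QuotSec) :
    ContMDiff (𝓡 n) 𝓘(ℝ, ℝ) ∞ fun x => LinearMap.trace ℝ (V x ⧸ W.fiber x) (W.fiberEnd φ x) := by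
  intro x₀
  obtain ⟨ψ, e, U, hU, hψ, hli, hdec⟩ := W.exists_adapted_quot x₀
  choose f hf using fun i => hdec (φ (e i))
  have hsm : ContMDiff (𝓡 n) 𝓘(ℝ, ℝ) ∞ (∑ i, f i i : SmoothFun n M) := ContMDiffMap.contMDiff _
  refine hsm.contMDiffAt.congr_of_eventuallyEq ?_
  filter_upwards [hU] with x hx
  have hspan : ⊤ ≤ Submodule.span ℝ (Set.range fun j => W.ev x (e j)) := by
    intro u _
    obtain ⟨v, rfl⟩ := W.ev_surjective x u
    obtain ⟨g, hg⟩ := hdec v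
    have h1 := congrArg (W.ev x) hg
    rw [W.ev_smul, hψ x hx, one_smul, map_sum] at h1
    rw [h1]
    refine Submodule.sum_mem _ fun j _ => ?_
    rw [W.ev_smul]
    exact Submodule.smul_mem _ _ (Submodule.subset_span ⟨j, rfl⟩)
  let b := Module.Basis.mk (hli x hx) hspan
  rw [LinearMap.trace_eq_matrix_trace ℝ b, Matrix.trace]
  have hsum : (∑ i, f i i : SmoothFun n M) x = ∑ i, f i i x := by
    change (ContMDiffMap.evalRingHom x : SmoothFun n M →+* ℝ) _ = _
    rw [map_sum]; rfl
  rw [hsum]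
  refine Finset.sum_congr rfl fun i _ => ?_
  have h1 := congrArg (W.ev x) (hf i)
  rw [W.ev_smul, hψ x hx, one_smul, map_sum] at h1
  simp only [W.ev_smul] at h1
  rw [Matrix.diag_apply, LinearMap.toMatrix_apply]
  have hb : ∀ j, b j = W.ev x (e j) := fun j => by simp [b]
  rw [hb, W.fiberEnd_ev, h1]
  simp only [← hb, map_sum, map_smul, Module.Basis.repr_self]
  simp [Finsupp.single_apply]

/-- The trace `Γ(End(V/W)) → C^∞(M)`, `(tr φ)(x) = tr φ_x`. -/
def Subbundle.trace : Module.End (SmoothFun n M) W.QuotSec →ₗ[SmoothFun n M] SmoothFun n M where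
  toFun φ := ⟨_, W.contMDiff_trace φ⟩
  map_add' φ χ := by
    ext x
    change LinearMap.trace ℝ _ _ = LinearMap.trace ℝ _ _ + LinearMap.trace ℝ _ _
    rw [← map_add]
    congr 1
    refine LinearMap.ext fun u => ?_
    obtain ⟨v, rfl⟩ := W.ev_surjective x u
    simp [W.fiberEnd_ev]
  map_smul' f φ := by
    ext x
    change LinearMap.trace ℝ _ _ = f x * LinearMap.trace ℝ _ _
    rw [← smul_eq_mul, ← map_smul]
    congr 1
    refine LinearMap.ext fun u => ?_
    obtain ⟨v, rfl⟩ := W.ev_surjective x u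
    simp [W.fiberEnd_ev, W.ev_smul]

end Quot

section Algebroid
variable {n : ℕ} {M : Type*} [TopologicalSpace M] [ChartedSpace (EuclideanSpace ℝ (Fin n)) M]
  [IsManifold (𝓡 n) ∞ M]

theorem VF.act_add (X : VF n M) (f g : SmoothFun n M) : X.act (f + g) = X.act f + X.act g := by
  ext x
  change mvfderiv (𝓡 n) (⇑f + ⇑g) x (X x) = _
  rw [mvfderiv_add f.mdifferentiableAt g.mdifferentiableAt]
  rfl

theorem VF.act_mul (X : VF n M) (f g : SmoothFun n M) :
    X.act (f * g) = f * X.act g + g * X.act f := by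
  ext x
  change mvfderiv (𝓡 n) (⇑f * ⇑g) x (X x) = _
  rw [mvfderiv_mul f.mdifferentiableAt g.mdifferentiableAt]
  rfl

theorem VF.act_smul (X : VF n M) (r : ℝ) (f : SmoothFun n M) : X.act (r • f) = r • X.act f := by
  have h : ∀ g : SmoothFun n M, r • g = (ContMDiffMap.C r : SmoothFun n M) * g := fun g => rfl
  have h0 : X.act (ContMDiffMap.C r : SmoothFun n M) = 0 := by
    ext x
    change mvfderiv (𝓡 n) (fun _ : M => r) x (X x) = _
    rw [mvfderiv_const]; rfl
  rw [h, h, X.act_mul, h0, mul_zero, add_zero]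

theorem VF.add_act (X Y : VF n M) (f : SmoothFun n M) : (X + Y).act f = X.act f + Y.act f := by
  ext x
  exact map_add (mvfderiv (𝓡 n) f x) (X x) (Y x)

theorem VF.smul_act (g : SmoothFun n M) (X : VF n M) (f : SmoothFun n M) :
    (g • X).act f = g * X.act f := by
  ext x
  exact map_smul (mvfderiv (𝓡 n) f x) (g x) (X x)

variable {F : Type*} [NormedAddCommGroup F] [NormedSpace ℝ F]
  {A : M → Type*} [TopologicalSpace (TotalSpace F A)] [∀ x, AddCommGroup (A x)]
  [∀ x, Module ℝ (A x)] [∀ x, TopologicalSpace (A x)] [FiberBundle F A] [VectorBundle ℝ F A]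

namespace LieAlgebroid
variable (L : LieAlgebroid n F A)

theorem leibniz' (a b : Sec n F A) (f : SmoothFun n M) :
    L.bracket a (f • b) = f • L.bracket a b + (L.anchor a).act f • b := L.leibniz a b f

theorem add_bracket (a b c : Sec n F A) :
    L.bracket (a + b) c = L.bracket a c + L.bracket b c := by
  rw [L.bracket_swap, L.bracket_add, L.bracket_swap c a, L.bracket_swap c b]; abel

theorem smul_bracket (a b : Sec n F A) (f : SmoothFun n M) :
    L.bracket (f • a) b = f • L.bracket a b - (L.anchor b).act f • a := by
  rw [L.bracket_swap, L.leibniz', L.bracket_swap b a, smul_neg]; abel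

theorem bracket_self (a : Sec n F A) : L.bracket a a = 0 := by
  have h := L.bracket_swap a a
  have h2 : (2 : ℝ) • L.bracket a a = 0 := by
    rw [two_smul]; nth_rw 1 [h]; abel
  exact (smul_eq_zero.1 h2).resolve_left two_ne_zero

theorem act_bracket [T2Space M] [ContMDiffVectorBundle ∞ F A (𝓡 n)] (a b : Sec n F A)
    (f : SmoothFun n M) : (L.anchor (L.bracket a b)).act f =
      (L.anchor a).act ((L.anchor b).act f) - (L.anchor b).act ((L.anchor a).act f) := by
  ext x
  by_cases hA : ∀ v : A x, v = 0
  · have h : ∀ (c : Sec n F A) (g : SmoothFun n M), (L.anchor c).act g x = 0 := by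
      intro c g
      rw [VF.act_apply, L.anchor_apply, hA (c x), map_zero, map_zero]
    change _ = (L.anchor a).act ((L.anchor b).act f) x - (L.anchor b).act ((L.anchor a).act f) x
    rw [h, h, h, sub_zero]
  · push Not at hA
    obtain ⟨v, hv⟩ := hA
    obtain ⟨c, hc⟩ := exists_sec_eq (n := n) (F := F) v
    have h1 := L.jacobi a b (f • c)
    simp only [L.leibniz', L.bracket_add, L.jacobi a b c, smul_add] at h1
    have h2 : (L.anchor a).act ((L.anchor b).act f) • c =
        (L.anchor (L.bracket a b)).act f • c + (L.anchor b).act ((L.anchor a).act f) • c := by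
      have := sub_eq_zero.2 h1
      rw [← sub_eq_zero, ← this]
      abel
    have h3 := congrArg (fun s : Sec n F A => s x) h2
    change (L.anchor a).act ((L.anchor b).act f) x • c x =
      (L.anchor (L.bracket a b)).act f x • c x +
        (L.anchor b).act ((L.anchor a).act f) x • c x at h3
    rw [← add_smul, ← sub_eq_zero, ← sub_smul, smul_eq_zero, hc] at h3
    change _ = (L.anchor a).act ((L.anchor b).act f) x - (L.anchor b).act ((L.anchor a).act f) x
    have := h3.resolve_right hv
    linarith

end LieAlgebroid

/-- A linear connection `∇ : 𝔤 × P → P`, where `P = Γ(E)` is the module of sections of a vector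
bundle and `𝔤` is a module of sections with anchor `ρ : 𝔤 → 𝔛(M)`. For `ρ` the anchor of a Lie
algebroid `A` this is a linear `A`-connection on `E`; for `ρ` the inclusion `Γ(F_M) ⊆ 𝔛(M)` of
a subbundle it is a partial `F_M`-connection on `E`. -/
structure LinearConnection {𝔤 : Type*} [AddCommGroup 𝔤] [Module (SmoothFun n M) 𝔤]
    (ρ : 𝔤 →ₗ[SmoothFun n M] VF n M) (P : Type*) [AddCommGroup P] [Module (SmoothFun n M) P] where
  nabla : 𝔤 → P → P
  add_left : ∀ a b e, nabla (a + b) e = nabla a e + nabla b e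
  smul_left : ∀ (f : SmoothFun n M) a e, nabla (f • a) e = f • nabla a e
  add_right : ∀ a e e', nabla a (e + e') = nabla a e + nabla a e'
  leibniz : ∀ a (f : SmoothFun n M) e, nabla a (f • e) = f • nabla a e + (ρ a).act f • e

theorem LinearConnection.nabla_neg {𝔤 : Type*} [AddCommGroup 𝔤] [Module (SmoothFun n M) 𝔤]
    {ρ : 𝔤 →ₗ[SmoothFun n M] VF n M} {P : Type*} [AddCommGroup P] [Module (SmoothFun n M) P]
    (D : LinearConnection ρ P) (a : 𝔤) (e : P) : D.nabla (-a) e = - D.nabla a e := by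
  simpa using D.smul_left (-1) a e

variable [T2Space M] [ContMDiffVectorBundle ∞ F A (𝓡 n)] {L : LieAlgebroid n F A}
  {P : Type*} [AddCommGroup P] [Module (SmoothFun n M) P]

namespace LinearConnection
variable (D : LinearConnection L.anchor P)

/-- `R_∇(a, b) = ∇_a ∇_b - ∇_b ∇_a - ∇_[a,b]`, a section of `End(E)`. -/
def curvatureEnd (a b : Sec n F A) : Module.End (SmoothFun n M) P where
  toFun e := D.nabla a (D.nabla b e) - D.nabla b (D.nabla a e) - D.nabla (L.bracket a b) e
  map_add' e e' := by simp only [D.add_right]; abel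
  map_smul' f e := by
    simp only [D.leibniz, D.add_right, L.act_bracket, RingHom.id_apply, smul_sub, sub_smul]
    abel

theorem curvatureEnd_apply (a b : Sec n F A) (e : P) : D.curvatureEnd a b e =
    D.nabla a (D.nabla b e) - D.nabla b (D.nabla a e) - D.nabla (L.bracket a b) e := rfl

theorem curvatureEnd_swap (a b : Sec n F A) : D.curvatureEnd a b = - D.curvatureEnd b a := by
  ext e
  rw [LinearMap.neg_apply, curvatureEnd_apply, curvatureEnd_apply, L.bracket_swap a b, D.nabla_neg]
  abel

theorem curvatureEnd_self (a : Sec n F A) : D.curvatureEnd a a = 0 := by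
  ext e
  have h0 : D.nabla 0 e = 0 := by simpa using D.smul_left 0 0 e
  rw [curvatureEnd_apply, L.bracket_self, h0]
  simp

theorem curvatureEnd_add (a b c : Sec n F A) :
    D.curvatureEnd a (b + c) = D.curvatureEnd a b + D.curvatureEnd a c := by
  ext e
  simp only [LinearMap.add_apply, curvatureEnd_apply, D.add_left, D.add_right, L.bracket_add]
  abel

theorem curvatureEnd_smul (a b : Sec n F A) (f : SmoothFun n M) :
    D.curvatureEnd a (f • b) = f • D.curvatureEnd a b := by
  ext e
  simp only [LinearMap.smul_apply, curvatureEnd_apply, D.add_left, D.smul_left, D.leibniz,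
    L.leibniz', smul_sub]
  abel

/-- The curvature `R_∇ ∈ Ω²(A, End E)`. -/
def curvature : Sec n F A [⋀^Fin 2]→ₗ[SmoothFun n M] Module.End (SmoothFun n M) P where
  toFun a := D.curvatureEnd (a 0) (a 1)
  map_update_add' := fun {inst} a i b c => by
    obtain rfl : inst = instDecidableEqFin 2 := Subsingleton.elim _ _
    fin_cases i
    · simp [D.curvatureEnd_swap _ (a 1), D.curvatureEnd_add, add_comm]
    · simp [D.curvatureEnd_add]
  map_update_smul' := fun {inst} a i f b => by
    obtain rfl : inst = instDecidableEqFin 2 := Subsingleton.elim _ _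
    fin_cases i
    · simp [D.curvatureEnd_swap _ (a 1), D.curvatureEnd_smul]
    · simp [D.curvatureEnd_smul]
  map_eq_zero_of_eq' a i j h hij := by
    have h01 : a 0 = a 1 := by
      fin_cases i <;> fin_cases j <;> simp_all
    rw [h01, D.curvatureEnd_self]

end LinearConnection

end Algebroid

section Forms

/-- The product of forms with values in an algebra `S` (for `S = C^∞(M)` the wedge product of
scalar forms, for `S = Γ(End E)` the wedge product with composition of endomorphisms):
`(α ∧ β)(a_1, …, a_{p+q}) = ∑ sgn(σ) α(a_σ(1), …, a_σ(p)) β(a_σ(p+1), …, a_σ(p+q))`, the sum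
running over the `(p, q)`-shuffles. -/
def wedge {R G S : Type*} [CommRing R] [AddCommGroup G] [Module R G] [Ring S] [Algebra R S]
    {p q : ℕ} (α : G [⋀^Fin p]→ₗ[R] S) (β : G [⋀^Fin q]→ₗ[R] S) : G [⋀^Fin (p + q)]→ₗ[R] S :=
  (LinearMap.mul' R S).compAlternatingMap ((α.domCoprod β).domDomCongr finSumFinEquiv)

variable {n : ℕ} {M : Type*} [TopologicalSpace M] [ChartedSpace (EuclideanSpace ℝ (Fin n)) M]
variable {F : Type*} [NormedAddCommGroup F] [NormedSpace ℝ F]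
  {A : M → Type*} [TopologicalSpace (TotalSpace F A)] [∀ x, AddCommGroup (A x)]
  [∀ x, Module ℝ (A x)] [∀ x, TopologicalSpace (A x)] [FiberBundle F A] [VectorBundle ℝ F A]

variable (n F A) in
/-- `Ω^r(A)`: alternating `C^∞(M)`-multilinear maps `Γ(A)^r → C^∞(M)`. -/
abbrev AForm (r : ℕ) : Type _ := Sec n F A [⋀^Fin r]→ₗ[SmoothFun n M] SmoothFun n M

variable [IsManifold (𝓡 n) ∞ M]

namespace LieAlgebroid
variable (L : LieAlgebroid n F A)

/-- The differential `d_A` on `Ω^r(A)`, by the Koszul formula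
`(d_A θ)(a_0, …, a_r) = ∑_i (-1)^i ρ(a_i) (θ(…, â_i, …))
  + ∑_{i<j} (-1)^(i+j) θ([a_i, a_j], …, â_i, …, â_j, …)`.
In the second sum `[a_i, a_j]` is put in the place of `a_i`, which absorbs the sign `(-1)^i`.
It is recorded as a function of `r + 1` sections. -/
def d (r : ℕ) : AForm n F A r →ₗ[ℝ] ((Fin (r + 1) → Sec n F A) → SmoothFun n M) where
  toFun θ a := ∑ i : Fin (r + 1), (-1 : ℝ) ^ (i : ℕ) • (L.anchor (a i)).act (θ (i.removeNth a)) +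
    ∑ i : Fin (r + 1), ∑ j ∈ Finset.Ioi i, (-1 : ℝ) ^ (j : ℕ) •
      θ (j.removeNth (Function.update a i (L.bracket (a i) (a j))))
  map_add' θ η := by
    funext a
    simp only [AlternatingMap.add_apply, VF.act_add, smul_add, Finset.sum_add_distrib, Pi.add_apply]
    abel
  map_smul' r θ := by
    funext a
    simp only [AlternatingMap.smul_apply, VF.act_smul, Finset.smul_sum, Pi.smul_apply, smul_add,
      RingHom.id_apply]
    simp only [smul_comm r]

variable (n F A) in
/-- A form as a function of `r` sections. -/
def formToFun (r : ℕ) : AForm n F A r →ₗ[ℝ] ((Fin r → Sec n F A) → SmoothFun n M) where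
  toFun θ := θ
  map_add' _ _ := rfl
  map_smul' _ _ := rfl

/-- `{θ ∈ Ω^r(A) | d_A θ = 0}`. -/
def closedForms (r : ℕ) : Submodule ℝ (AForm n F A r) := LinearMap.ker (L.d r)

/-- `{θ ∈ Ω^r(A) | θ = d_A η for some η ∈ Ω^(r-1)(A)}`. -/
def exactForms : ∀ r : ℕ, Submodule ℝ (AForm n F A r)
  | 0 => ⊥
  | r + 1 => (LinearMap.range (L.d r)).comap (formToFun n F A (r + 1))

/-- The Lie algebroid cohomology `H^r(A)`: the closed forms modulo the exact ones, as a subspace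
of `Ω^r(A)` modulo the exact forms. -/
def Cohomology (r : ℕ) : Submodule ℝ (AForm n F A r ⧸ L.exactForms r) :=
  (L.closedForms r).map (L.exactForms r).mkQ

end LieAlgebroid

variable [T2Space M] [ContMDiffVectorBundle ∞ F A (𝓡 n)] {L : LieAlgebroid n F A}

/-- `R_∇^i ∈ Ω^{2i}(A, End E)`. -/
def LinearConnection.curvaturePow {P : Type*} [AddCommGroup P] [Module (SmoothFun n M) P]
    (D : LinearConnection L.anchor P) :
    ∀ i : ℕ, Sec n F A [⋀^Fin (2 * i)]→ₗ[SmoothFun n M] Module.End (SmoothFun n M) P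
  | 0 => AlternatingMap.constOfIsEmpty (SmoothFun n M) (Sec n F A) (Fin 0) 1
  | i + 1 => wedge (D.curvaturePow i) D.curvature

variable {FV : Type*} [NormedAddCommGroup FV] [NormedSpace ℝ FV] [FiniteDimensional ℝ FV]
  {V : M → Type*} [TopologicalSpace (TotalSpace FV V)] [∀ x, AddCommGroup (V x)]
  [∀ x, Module ℝ (V x)] [∀ x, TopologicalSpace (V x)] [FiberBundle FV V] [VectorBundle ℝ FV V]
  [ContMDiffVectorBundle ∞ FV V (𝓡 n)] {c : ℕ}

/-- The form `tr(R_∇^i) ∈ Ω^{2i}(A)` of an `A`-connection `∇` on `E = V/W`, which represents the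
`i`-th `A`-Pontryagin character of `E`. -/
def pontryaginCharacter (W : Subbundle n FV V c) (D : LinearConnection L.anchor W.QuotSec) (i : ℕ) :
    AForm n F A (2 * i) :=
  W.trace.compAlternatingMap (D.curvaturePow i)

variable (L) in
/-- The `r`-forms that are finite products of forms `tr(R_∇^i)`, `i ≥ 1`, for `A`-connections
`∇` on `E = V/W`; the empty product is the constant function `1`. -/
inductive IsPontryaginForm (W : Subbundle n FV V c) : ∀ r : ℕ, AForm n F A r → Prop
  | one : IsPontryaginForm W 0 (AlternatingMap.constOfIsEmpty _ _ _ 1)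
  | mul (D : LinearConnection L.anchor W.QuotSec) (i : ℕ) (hi : 1 ≤ i) (r : ℕ)
      (θ : AForm n F A r) (hθ : IsPontryaginForm W r θ) :
      IsPontryaginForm W (2 * i + r) (wedge (pontryaginCharacter W D i) θ)

variable (L) in
/-- `Pont^r_A(E)` for `E = V/W`: the degree-`r` part of the `ℝ`-subalgebra generated by the
`A`-Pontryagin characters of `E`, that is, the span of the classes of the products of degree `r` of
the forms `tr(R_∇^i)`. All connections are allowed, so no choice of one is made. -/
def pontryaginSpace (W : Subbundle n FV V c) (r : ℕ) : Submodule ℝ (AForm n F A r ⧸ L.exactForms r) :=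
  Submodule.span ℝ ((L.exactForms r).mkQ '' {θ | IsPontryaginForm L W r θ})

end Forms

section IIS
variable {n : ℕ} {M : Type*} [TopologicalSpace M] [ChartedSpace (EuclideanSpace ℝ (Fin n)) M]
  [IsManifold (𝓡 n) ∞ M]
variable {F : Type*} [NormedAddCommGroup F] [NormedSpace ℝ F]
  {A : M → Type*} [TopologicalSpace (TotalSpace F A)] [∀ x, AddCommGroup (A x)]
  [∀ x, Module ℝ (A x)] [∀ x, TopologicalSpace (A x)] [FiberBundle F A] [VectorBundle ℝ F A]

/-- Subbundles of `TM` of codimension `q`. -/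
abbrev TangentSubbundle (n : ℕ) (M : Type*) [TopologicalSpace M]
    [ChartedSpace (EuclideanSpace ℝ (Fin n)) M] [IsManifold (𝓡 n) ∞ M] (q : ℕ) : Type _ :=
  Subbundle n (EuclideanSpace ℝ (Fin n)) (fun x : M => TangentSpace (𝓡 n) x) q

/-- `[Γ(B), Γ(B)] ⊆ Γ(B)`. -/
def Involutive {q : ℕ} (B : TangentSubbundle n M q) : Prop :=
  ∀ X ∈ B.sec, ∀ Y ∈ B.sec, VF.bracket X Y ∈ B.sec

/-- `∇_X e = 0` for all `X`. -/
def LinearConnection.IsParallel {𝔤 : Type*} [AddCommGroup 𝔤] [Module (SmoothFun n M) 𝔤]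
    {ρ : 𝔤 →ₗ[SmoothFun n M] VF n M} {P : Type*} [AddCommGroup P] [Module (SmoothFun n M) P]
    (D : LinearConnection ρ P) (e : P) : Prop :=
  ∀ X, D.nabla X e = 0

/-- The Bott connection of an involutive subbundle `B ⊆ TM` on `TM/B`, induced by
`(X, Y) ↦ [X, Y]` for `X ∈ Γ(B)`, `Y ∈ 𝔛(M)`. -/
def bottConnection {q : ℕ} (B : TangentSubbundle n M q) (hB : Involutive B) :
    LinearConnection B.sec.subtype B.QuotSec where
  nabla X := QuotientAddGroup.map B.sec.toAddSubgroup B.sec.toAddSubgroup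
    (AddMonoidHom.mk' (fun Y => VF.bracket X.1 Y)
      ((tangentLieAlgebroid n M).bracket_add X.1)) fun Y hY => hB X.1 X.2 Y hY
  add_left X Y e := by
    obtain ⟨e, rfl⟩ := Submodule.Quotient.mk_surjective _ e
    exact congrArg Submodule.Quotient.mk ((tangentLieAlgebroid n M).add_bracket X.1 Y.1 e)
  smul_left f X e := by
    obtain ⟨e, rfl⟩ := Submodule.Quotient.mk_surjective _ e
    refine (congrArg Submodule.Quotient.mk
      ((tangentLieAlgebroid n M).smul_bracket X.1 e f)).trans ?_
    rw [Submodule.Quotient.mk_sub, (Submodule.Quotient.mk_eq_zero B.sec).2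
      (B.sec.smul_mem _ X.2), sub_zero]
    rfl
  add_right X e e' := map_add _ e e'
  leibniz X f e := by
    obtain ⟨e, rfl⟩ := Submodule.Quotient.mk_surjective _ e
    exact congrArg Submodule.Quotient.mk ((tangentLieAlgebroid n M).leibniz' X.1 e f)

/-- An infinitesimal ideal system `(F_M, J, ∇)` in a Lie algebroid `A`, with `F_M ⊆ TM` of
codimension `q` and `J ⊆ A` of codimension `s`: `F_M` is involutive, `ρ(J) ⊆ F_M`, `∇` is a flat
`F_M`-connection on `A/J`, and
* if `a ∈ Γ(A)` is `∇`-parallel (its class in `Γ(A/J)` is), then `[a, Γ(J)] ⊆ Γ(J)`;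
* if `a, b ∈ Γ(A)` are `∇`-parallel, then so is `[a, b]`;
* if `a ∈ Γ(A)` is `∇`-parallel, then `ρ(a)` is parallel for the Bott connection of `F_M`. -/
structure InfinitesimalIdealSystem (L : LieAlgebroid n F A) (q s : ℕ) where
  FM : TangentSubbundle n M q
  J : Subbundle n F A s
  involutive : Involutive FM
  rho_mem : ∀ x, ∀ v ∈ J.fiber x, L.rho x v ∈ FM.fiber x
  conn : LinearConnection FM.sec.subtype J.QuotSec
  flat : ∀ (X Y : FM.sec) (e : J.QuotSec), conn.nabla X (conn.nabla Y e) -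
    conn.nabla Y (conn.nabla X e) -
      conn.nabla ⟨VF.bracket X.1 Y.1, involutive X.1 X.2 Y.1 Y.2⟩ e = 0
  bracket_mem : ∀ a : Sec n F A, conn.IsParallel (Submodule.Quotient.mk a) →
    ∀ j ∈ J.sec, L.bracket a j ∈ J.sec
  bracket_parallel : ∀ a b : Sec n F A, conn.IsParallel (Submodule.Quotient.mk a) →
    conn.IsParallel (Submodule.Quotient.mk b) →
      conn.IsParallel (Submodule.Quotient.mk (L.bracket a b))
  anchor_parallel : ∀ a : Sec n F A, conn.IsParallel (Submodule.Quotient.mk a) →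
    (bottConnection FM involutive).IsParallel (Submodule.Quotient.mk (L.anchor a))

end IIS

end

/-! This is Bott's vanishing argument, carried out once over `TM` and once over `A`. A flat partial
`F_M`-connection on `E` (the given one on `A/J`, the Bott connection on `TM/F_M`) extends to a
`TM`-connection `D`: project `TM` onto `F_M` and onto a complement, use the partial connection on
the first component and an arbitrary connection on the second (`exists_extension`). Then `R_D`
vanishes on pairs of sections of `F_M`, so it lies in the ideal of forms that need at least one
argument outside `F_M`. A product of characters with `i` curvature factors in all needs `i` such
arguments. Modulo `F_M` only `q` directions exist locally, so for `i > q` two arguments can be taken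
equal and the form is zero (`eq_zero_of_vanishesBelow`, `characterProduct_eq_zero`).

Over `A` the pullback of `D` along the anchor is used. Its characters are pullbacks of forms that
already vanish for `i > q`. Moreover `ρ(J) ⊆ F_M` and `ρ` preserves brackets
(`LieAlgebroid.anchor_bracket`), so the pulled back curvature vanishes on pairs from `J`, and the
same count relative to `J` gives zero for `i > s`.

The Pontryagin spaces allow all connections, even different ones within one product, so the class
must be shown independent of the connection. For `D' = D + B` the family `P = R + X·DB + X²·B²` has
`(tr P^(m+1))' = (m+1)·d tr(B P^m)`, and integrating coefficientwise from `0` to `1` gives the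
transgression formula (`trace_pow_sub_trace_pow`). Since all characters are closed, this passes to
products (`IsPontryaginForm.exists_eq_characterProduct`).

The signs are kept under control by working in one graded algebra of cochains, functions on lists of
sections, where product, Lie derivative and differential are defined by recursion through insertion
of the first argument. Identities then follow by induction on the list, using only Cartan's rules.
The map `hat` embeds alternating forms and translates `wedge` and the Koszul differential
(`hat_wedge`, `diff_ofFn`). -/

noncomputable section

set_option linter.unusedSectionVars false

/-! ### The graded algebra of cochains on lists. -/

section CochainAlgebra

/-- Inhomogeneous cochains on `G` with values in `S`: functions on finite sequences in `G`. -/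
structure Cochain (G S : Type*) where
  of ::
  /-- The underlying function. -/
  toFun : List G → S

namespace Cochain
variable {G S S' : Type*}

instance : FunLike (Cochain G S) (List G) S := ⟨toFun, fun ⟨_⟩ ⟨_⟩ h => congrArg of h⟩

@[simp] theorem of_apply (f : List G → S) (l : List G) : (of f : Cochain G S) l = f l := rfl

@[ext] theorem ext {θ η : Cochain G S} (h : ∀ l, θ l = η l) : θ = η := DFunLike.ext _ _ h

/-- Cochains are functions. -/
def equivFun : Cochain G S ≃ (List G → S) := ⟨toFun, of, fun _ => rfl, fun _ => rfl⟩

instance [AddCommGroup S] : AddCommGroup (Cochain G S) := equivFun.addCommGroup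
instance {k : Type*} [Semiring k] [AddCommGroup S] [Module k S] : Module k (Cochain G S) :=
  equivFun.module k

section Add
variable [AddCommGroup S]

@[simp] theorem add_apply (θ η : Cochain G S) (l : List G) : (θ + η) l = θ l + η l := rfl
@[simp] theorem sub_apply (θ η : Cochain G S) (l : List G) : (θ - η) l = θ l - η l := rfl
@[simp] theorem neg_apply (θ : Cochain G S) (l : List G) : (-θ) l = -θ l := rfl
@[simp] theorem zero_apply (l : List G) : (0 : Cochain G S) l = 0 := rfl
theorem smul_apply {k : Type*} [Semiring k] [Module k S] (c : k) (θ : Cochain G S) (l : List G) :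
    (c • θ) l = c • θ l := rfl

/-- The interior product: insertion of `a` as first argument. -/
def iota (a : G) : Cochain G S →+ Cochain G S where
  toFun θ := of fun l => θ (a :: l)
  map_zero' := rfl
  map_add' _ _ := rfl

theorem apply_cons (θ : Cochain G S) (a : G) (l : List G) : θ (a :: l) = iota a θ l := rfl
theorem iota_apply (θ : Cochain G S) (a : G) (l : List G) : iota a θ l = θ (a :: l) := rfl

/-- The grading involution. -/
def bar : Cochain G S →+ Cochain G S where
  toFun θ := of fun l => (-1 : ℤ) ^ l.length • θ l
  map_zero' := by ext l; simp
  map_add' θ η := by ext l; simp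

theorem bar_apply (θ : Cochain G S) (l : List G) : bar θ l = (-1 : ℤ) ^ l.length • θ l := rfl

@[simp] theorem bar_nil (θ : Cochain G S) : bar θ [] = θ [] := by simp [bar_apply]

@[simp] theorem bar_bar (θ : Cochain G S) : bar (bar θ) = θ := by
  ext l
  rw [bar_apply, bar_apply, smul_smul, ← mul_pow]
  simp

@[simp] theorem iota_bar (a : G) (θ : Cochain G S) : iota a (bar θ) = - bar (iota a θ) := by
  ext l
  simp [iota_apply, bar_apply, pow_succ]

/-- Cochains concentrated in degree `p`. -/
def Homogeneous (p : ℕ) (θ : Cochain G S) : Prop := ∀ l, l.length ≠ p → θ l = 0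

theorem Homogeneous.add {p : ℕ} {θ η : Cochain G S} (h : Homogeneous p θ) (h' : Homogeneous p η) :
    Homogeneous p (θ + η) := fun l hl => by simp [h l hl, h' l hl]

theorem Homogeneous.bar {p : ℕ} {θ : Cochain G S} (h : Homogeneous p θ) :
    bar θ = (-1 : ℤ) ^ p • θ := by
  ext l
  by_cases hl : l.length = p
  · rw [bar_apply, hl]; rfl
  · change (-1 : ℤ) ^ l.length • θ l = (-1 : ℤ) ^ p • θ l
    rw [h l hl]; simp

theorem Homogeneous.iota {p : ℕ} {θ : Cochain G S} (h : Homogeneous (p + 1) θ) (a : G) :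
    Homogeneous p (iota a θ) := fun l hl => h _ (by simpa using hl)

theorem Homogeneous.iota_zero {θ : Cochain G S} (h : Homogeneous 0 θ) (a : G) :
    Cochain.iota a θ = 0 := by
  ext l
  exact h _ (by simp)

end Add

section Mul
variable [Ring S]

/-- The signed shuffle product, evaluated on a sequence. -/
def mulAux : List G → Cochain G S → Cochain G S → S
  | [], α, β => α [] * β []
  | a :: l, α, β => mulAux l (iota a α) β + mulAux l (bar α) (iota a β)

instance : Mul (Cochain G S) := ⟨fun α β => of fun l => mulAux l α β⟩

/-- The cochain of degree `0` with value `s`. -/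
def const (s : S) : Cochain G S := of fun l => if l = [] then s else 0

instance : One (Cochain G S) := ⟨const 1⟩

theorem mul_nil (α β : Cochain G S) : (α * β) [] = α [] * β [] := rfl

theorem iota_mul (a : G) (α β : Cochain G S) :
    iota a (α * β) = iota a α * β + bar α * iota a β := rfl

@[simp] theorem iota_const (a : G) (s : S) : iota a (const s : Cochain G S) = 0 := by
  ext l
  simp [iota_apply, const]

@[simp] theorem iota_one (a : G) : iota a (1 : Cochain G S) = 0 := iota_const a 1

@[simp] theorem bar_const (s : S) : bar (const s : Cochain G S) = const s := by
  ext l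
  cases l <;> simp [bar_apply, const]

@[simp] theorem bar_one : bar (1 : Cochain G S) = 1 := bar_const 1

theorem mul_cons (α β : Cochain G S) (a : G) (l : List G) :
    (α * β) (a :: l) = (iota a α * β) l + (bar α * iota a β) l := rfl

protected theorem add_mul_apply (l : List G) (α β γ : Cochain G S) :
    ((α + β) * γ) l = (α * γ) l + (β * γ) l := by
  induction l generalizing α β γ with
  | nil => simp [mul_nil, add_mul]
  | cons a l ih => simp only [mul_cons, map_add, ih]; abel

protected theorem mul_add_apply (l : List G) (α β γ : Cochain G S) :
    (α * (β + γ)) l = (α * β) l + (α * γ) l := by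
  induction l generalizing α β γ with
  | nil => simp [mul_nil, mul_add]
  | cons a l ih => simp only [mul_cons, map_add, ih]; abel

instance : NonUnitalNonAssocRing (Cochain G S) :=
  { (inferInstance : AddCommGroup (Cochain G S)), (inferInstance : Mul (Cochain G S)) with
    left_distrib := fun α β γ => ext fun l => Cochain.mul_add_apply l α β γ
    right_distrib := fun α β γ => ext fun l => Cochain.add_mul_apply l α β γ
    zero_mul := fun α => by
      have h : (0 : Cochain G S) * α = 0 * α + 0 * α := by
        conv_lhs => rw [← add_zero (0 : Cochain G S)]
        exact ext fun l => Cochain.add_mul_apply l 0 0 α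
      simpa using h
    mul_zero := fun α => by
      have h : α * (0 : Cochain G S) = α * 0 + α * 0 := by
        conv_lhs => rw [← add_zero (0 : Cochain G S)]
        exact ext fun l => Cochain.mul_add_apply l α 0 0
      simpa using h }

theorem bar_mul (α β : Cochain G S) : bar (α * β) = bar α * bar β := by
  ext l
  induction l generalizing α β with
  | nil => simp [mul_nil]
  | cons a l ih =>
    simp only [apply_cons, iota_bar, iota_mul, map_add, bar_bar, neg_add, add_apply, neg_apply, ih,
      neg_mul, mul_neg]

protected theorem mul_assoc_apply (l : List G) (α β γ : Cochain G S) :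
    (α * β * γ) l = (α * (β * γ)) l := by
  induction l generalizing α β γ with
  | nil => simp [mul_nil, mul_assoc]
  | cons a l ih =>
    simp only [apply_cons, iota_mul, add_mul, mul_add, bar_mul, add_apply, ih, add_assoc]

theorem const_mul (s : S) (α : Cochain G S) (l : List G) :
    ((const s : Cochain G S) * α) l = s * α l := by
  induction l generalizing α with
  | nil => rfl
  | cons a l ih => simp [apply_cons, iota_mul, ih]

theorem mul_const (s : S) (α : Cochain G S) (l : List G) :
    (α * (const s : Cochain G S)) l = α l * s := by
  induction l generalizing α with
  | nil => rfl
  | cons a l ih => simp [apply_cons, iota_mul, ih]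

instance : Ring (Cochain G S) :=
  { (inferInstance : NonUnitalNonAssocRing (Cochain G S)), (inferInstance : One (Cochain G S)) with
    mul_assoc := fun α β γ => ext fun l => Cochain.mul_assoc_apply l α β γ
    one_mul := fun α => ext fun l => (const_mul 1 α l).trans (one_mul _)
    mul_one := fun α => ext fun l => (mul_const 1 α l).trans (mul_one _) }

theorem Homogeneous.one : Homogeneous 0 (1 : Cochain G S) := fun l hl => by
  cases l with
  | nil => simp at hl
  | cons a l => rw [apply_cons, iota_one]; rfl

theorem Homogeneous.mul {p q : ℕ} {α β : Cochain G S} (hα : Homogeneous p α)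
    (hβ : Homogeneous q β) : Homogeneous (p + q) (α * β) := by
  intro l
  induction l generalizing p q α β with
  | nil =>
    intro h
    rw [mul_nil]
    by_cases hp : p = 0
    · have hq : q ≠ 0 := by simp at h; omega
      rw [hβ [] (by simpa using hq.symm), mul_zero]
    · rw [hα [] (by simpa using Ne.symm hp), zero_mul]
  | cons a l ih =>
    intro h
    simp only [List.length_cons] at h
    have h1 : (Cochain.iota a α * β) l = 0 := by
      cases p with
      | zero => rw [hα.iota_zero, zero_mul]; rfl
      | succ p => exact ih (hα.iota a) hβ (by omega)
    have h2 : (α * Cochain.iota a β) l = 0 := by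
      cases q with
      | zero => rw [hβ.iota_zero, mul_zero]; rfl
      | succ q => exact ih hα (hβ.iota a) (by omega)
    rw [mul_cons, h1, hα.bar, smul_mul_assoc, zero_add]
    change (-1 : ℤ) ^ p • (α * Cochain.iota a β) l = 0
    rw [h2, smul_zero]

end Mul

section Map
/-- Composition of a cochain with an additive map of the values. -/
def map [AddCommGroup S] [AddCommGroup S'] (t : S →+ S') : Cochain G S →+ Cochain G S' where
  toFun θ := of fun l => t (θ l)
  map_zero' := by ext; simp
  map_add' _ _ := by ext; simp

theorem map_apply [AddCommGroup S] [AddCommGroup S'] (t : S →+ S') (θ : Cochain G S) (l : List G) :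
    map t θ l = t (θ l) := rfl

theorem iota_map [AddCommGroup S] [AddCommGroup S'] (t : S →+ S') (a : G) (θ : Cochain G S) :
    iota a (map t θ) = map t (iota a θ) := rfl

/-- A trace is graded cyclic on cochains. -/
theorem map_mul_comm_apply [Ring S] [AddCommGroup S'] (t : S →+ S')
    (ht : ∀ x y, t (x * y) = t (y * x)) (l : List G) (α β : Cochain G S) :
    (bar α = α → map t (α * β) l = map t (β * α) l) ∧
      (bar α = -α → map t (α * β) l = map t (bar β * α) l) := by
  -- Inserting an argument changes the parity of `α`, so the even and the odd statement have to be
  -- proved together.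
  induction l generalizing α β with
  | nil => simp [map_apply, mul_nil, ht (α []) (β [])]
  | cons a l ih =>
    refine ⟨fun h => ?_, fun h => ?_⟩
    · have h1 : bar (iota a α) = - iota a α := by
        have := congrArg (iota a) h
        rw [iota_bar] at this
        exact neg_eq_iff_eq_neg.1 this
      simp only [apply_cons, iota_map, iota_mul, map_add, add_apply, h, (ih _ _).2 h1,
        (ih α _).1 h]
      abel
    · have h1 : bar (iota a α) = iota a α := by
        have := congrArg (iota a) h
        rw [iota_bar, map_neg] at this
        exact neg_injective this
      simp only [apply_cons, iota_map, iota_mul, map_add, add_apply, h, (ih (iota a α) _).1 h1,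
        iota_bar, neg_mul, map_neg, neg_apply, (ih α _).2 h, bar_bar]
      abel

theorem map_mul_comm_of_even [Ring S] [AddCommGroup S'] (t : S →+ S')
    (ht : ∀ x y, t (x * y) = t (y * x)) {α : Cochain G S} (h : bar α = α) (β : Cochain G S) :
    map t (α * β) = map t (β * α) := ext fun l => (map_mul_comm_apply t ht l α β).1 h

theorem map_mul_comm_of_odd [Ring S] [AddCommGroup S'] (t : S →+ S')
    (ht : ∀ x y, t (x * y) = t (y * x)) {α : Cochain G S} (h : bar α = -α) (β : Cochain G S) :
    map t (α * β) = map t (bar β * α) := ext fun l => (map_mul_comm_apply t ht l α β).2 h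

end Map

/-! ### Lie derivative and differential by Cartan's formulas. -/

section Differential
variable (br : G → G → G)

section
variable [AddCommGroup S] (δ : G → S →+ S)

/-- The Lie derivative, evaluated on a sequence. -/
def lieAux (a : G) : List G → Cochain G S → S
  | [], θ => δ a (θ [])
  | b :: l, θ => lieAux a l (iota b θ) - θ (br a b :: l)

theorem lieAux_add (a : G) (l : List G) (θ η : Cochain G S) :
    lieAux br δ a l (θ + η) = lieAux br δ a l θ + lieAux br δ a l η := by
  induction l generalizing θ η with
  | nil => simp [lieAux]
  | cons b l ih => simp only [lieAux, map_add, ih, add_apply]; abel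

/-- The Lie derivative along `a`, for the bracket `br` on `G` and the action `δ` on `S`. -/
def lie (a : G) : Cochain G S →+ Cochain G S :=
  AddMonoidHom.mk' (fun θ => of fun l => lieAux br δ a l θ) fun θ η => ext fun l => lieAux_add br δ a l θ η

theorem lie_nil (a : G) (θ : Cochain G S) : lie br δ a θ [] = δ a (θ []) := rfl

theorem iota_lie (a b : G) (θ : Cochain G S) :
    iota b (lie br δ a θ) = lie br δ a (iota b θ) - iota (br a b) θ := rfl

theorem lie_bar (a : G) (θ : Cochain G S) : lie br δ a (bar θ) = bar (lie br δ a θ) := by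
  ext l
  induction l generalizing θ with
  | nil => simp [lie_nil]
  | cons b l ih =>
    simp only [apply_cons, iota_lie, iota_bar, map_neg, map_sub, sub_apply, neg_apply, ih]
    abel

/-- The Cartan differential, evaluated on a sequence. -/
def diffAux : List G → Cochain G S → S
  | [], _ => 0
  | a :: l, θ => lie br δ a θ l - diffAux l (iota a θ)

theorem diffAux_add (l : List G) (θ η : Cochain G S) :
    diffAux br δ l (θ + η) = diffAux br δ l θ + diffAux br δ l η := by
  induction l generalizing θ η with
  | nil => simp [diffAux]
  | cons b l ih => simp only [diffAux, map_add, ih, add_apply]; abel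

/-- The Chevalley–Eilenberg differential, determined by `ι_a d = L_a - d ι_a`. -/
def diff : Cochain G S →+ Cochain G S :=
  AddMonoidHom.mk' (fun θ => of fun l => diffAux br δ l θ) fun θ η => ext fun l => diffAux_add br δ l θ η

theorem diff_nil (θ : Cochain G S) : diff br δ θ [] = 0 := rfl

theorem iota_diff (a : G) (θ : Cochain G S) :
    iota a (diff br δ θ) = lie br δ a θ - diff br δ (iota a θ) := rfl

theorem diff_bar (θ : Cochain G S) : diff br δ (bar θ) = - bar (diff br δ θ) := by
  ext l
  induction l generalizing θ with
  | nil => simp [diff_nil]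
  | cons b l ih =>
    simp only [apply_cons, iota_diff, iota_bar, map_neg, map_sub, sub_apply, neg_apply, ih,
      lie_bar]
    abel

theorem Homogeneous.lie {p : ℕ} {θ : Cochain G S} (h : Homogeneous p θ) (a : G) :
    Homogeneous p (lie br δ a θ) := by
  intro l
  induction l generalizing p θ with
  | nil => intro hl; rw [lie_nil, h [] hl, map_zero]
  | cons b l ih =>
    intro hl
    cases p with
    | zero => rw [apply_cons, iota_lie, h.iota_zero, h.iota_zero, map_zero]; simp
    | succ p =>
      simp only [List.length_cons, ne_eq, Nat.add_right_cancel_iff] at hl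
      rw [apply_cons, iota_lie, Cochain.sub_apply, ih (h.iota b) hl, (h.iota _) l hl, sub_zero]

theorem Homogeneous.diff {p : ℕ} {θ : Cochain G S} (h : Homogeneous p θ) :
    Homogeneous (p + 1) (diff br δ θ) := by
  intro l
  induction l generalizing p θ with
  | nil => intro _; rfl
  | cons b l ih =>
    intro hl
    simp only [List.length_cons, ne_eq, Nat.add_right_cancel_iff] at hl
    rw [apply_cons, iota_diff, Cochain.sub_apply, h.lie br δ b l hl]
    cases p with
    | zero => rw [h.iota_zero, map_zero]; simp
    | succ p => rw [ih (h.iota b) hl, sub_zero]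

theorem lie_smul {k : Type*} [Semiring k] [Module k S] (hδ : ∀ a (c : k) x, δ a (c • x) = c • δ a x)
    (a : G) (c : k) (θ : Cochain G S) : lie br δ a (c • θ) = c • lie br δ a θ := by
  ext l
  induction l generalizing θ with
  | nil => exact hδ a c _
  | cons b l ih =>
    have h : ∀ b, iota b (c • θ) = c • iota b θ := fun _ => rfl
    rw [apply_cons, iota_lie, h, h, sub_apply, ih, smul_apply, smul_apply, ← smul_sub]
    rfl

/-- Needed over `ℝ`: integrating the transgression polynomial puts fractional coefficients into the
primitive. -/
theorem diff_smul {k : Type*} [Semiring k] [Module k S] (hδ : ∀ a (c : k) x, δ a (c • x) = c • δ a x)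
    (c : k) (θ : Cochain G S) : diff br δ (c • θ) = c • diff br δ θ := by
  ext l
  induction l generalizing θ with
  | nil => exact (smul_zero c).symm
  | cons b l ih =>
    have h : iota b (c • θ) = c • iota b θ := rfl
    rw [apply_cons, iota_diff, h, sub_apply, ih, lie_smul br δ hδ, smul_apply, smul_apply, ← smul_sub]
    rfl

variable [AddCommGroup S'] (δ' : G → S' →+ S')

theorem map_lie (t : S →+ S') (ht : ∀ a x, t (δ a x) = δ' a (t x)) (a : G) (θ : Cochain G S) :
    map t (lie br δ a θ) = lie br δ' a (map t θ) := by
  ext l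
  induction l generalizing θ with
  | nil => exact ht a _
  | cons b l ih =>
    rw [apply_cons, apply_cons, iota_map, iota_lie, iota_lie, map_sub, sub_apply, ih]; rfl

theorem map_diff (t : S →+ S') (ht : ∀ a x, t (δ a x) = δ' a (t x)) (θ : Cochain G S) :
    map t (diff br δ θ) = diff br δ' (map t θ) := by
  ext l
  induction l generalizing θ with
  | nil => exact map_zero t
  | cons b l ih =>
    rw [apply_cons, apply_cons, iota_map, iota_diff, iota_diff, map_sub, sub_apply, ih,
      map_lie br δ δ' t ht]; rfl
end

section
variable [Ring S] (δ : G → S →+ S) (hδ : ∀ a x y, δ a (x * y) = δ a x * y + x * δ a y)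
include hδ

theorem lie_mul (a : G) (α β : Cochain G S) :
    lie br δ a (α * β) = lie br δ a α * β + α * lie br δ a β := by
  ext l
  induction l generalizing α β with
  | nil => exact hδ a _ _
  | cons b l ih =>
    simp only [apply_cons, iota_lie, iota_mul, map_add, add_apply, sub_apply, ih,
      sub_mul, mul_sub, lie_bar]
    abel

/-- Insertion of an argument turns the graded Leibniz rule into the ungraded one for `lie` together
with the graded rule for shorter lists. No alternation of the cochains is needed. -/
theorem diff_mul (α β : Cochain G S) :
    diff br δ (α * β) = diff br δ α * β + bar α * diff br δ β := by
  ext l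
  induction l generalizing α β with
  | nil => simp [mul_nil, diff_nil]
  | cons b l ih =>
    simp only [apply_cons, iota_diff, iota_mul, map_add, add_apply, sub_apply, neg_apply, ih,
      sub_mul, mul_sub, lie_mul br δ hδ, iota_bar, diff_bar, bar_bar, neg_mul]
    abel
end

section
variable [Ring S] (δ δ' : G → S →+ S)

/-- A cochain of degree `1`. -/
def ofFun (B : G → S) : Cochain G S := of fun
  | [a] => B a
  | _ => 0

theorem Homogeneous.ofFun (B : G → S) : Homogeneous 1 (ofFun B) := by
  rintro (_ | ⟨a, _ | ⟨b, l⟩⟩) h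
  · rfl
  · simp at h
  · rfl

theorem iota_ofFun (B : G → S) (a : G) : iota a (ofFun B) = const (B a) := by
  ext l
  cases l <;> simp [iota_apply, ofFun, const]

theorem bar_ofFun (B : G → S) : bar (ofFun B) = - ofFun B := by
  simpa using (Homogeneous.ofFun B).bar

variable (B : G → S) (hB : ∀ a x, δ' a x = δ a x + (B a * x - x * B a))
include hB

theorem lie_of_sub (a : G) (θ : Cochain G S) :
    lie br δ' a θ = lie br δ a θ + (const (B a) * θ - θ * const (B a)) := by
  ext l
  induction l generalizing θ with
  | nil => exact hB a _
  | cons b l ih =>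
    simp only [apply_cons, iota_lie, sub_apply, add_apply, map_add, map_sub, iota_mul, ih,
      iota_const, bar_const, zero_mul, mul_zero, zero_add, add_zero]
    abel

/-- Changing a connection by `B` changes the covariant differential by the graded commutator with
`B`, since it changes each `lie` by the ordinary commutator with the value of `B`. -/
theorem diff_of_sub (θ : Cochain G S) :
    diff br δ' θ = diff br δ θ + (ofFun B * θ - bar θ * ofFun B) := by
  ext l
  induction l generalizing θ with
  | nil => simp [diff_nil, mul_nil, ofFun]
  | cons b l ih =>
    simp only [apply_cons, iota_diff, iota_mul, map_add, map_sub, add_apply, sub_apply, neg_apply,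
      ih, lie_of_sub br δ δ' B hB, iota_ofFun, bar_ofFun, iota_bar, bar_bar, neg_mul]
    abel
end

end Differential

/-! ### The filtration by the number of arguments outside a subset. -/

section Filtration
variable [Ring S] (N : G → Prop)

open Classical in
/-- The number of terms of a sequence that do not satisfy `N`. -/
def excess : List G → ℕ
  | [] => 0
  | a :: l => if N a then excess l else excess l + 1

/-- Cochains vanishing on sequences with fewer than `k` terms outside `N`. -/
def VanishesBelow (k : ℕ) (θ : Cochain G S) : Prop :=
  ∀ l : List G, excess N l < k → θ l = 0

variable {N}

theorem VanishesBelow.zero (θ : Cochain G S) : VanishesBelow N 0 θ := fun _ h => by simp at h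

theorem VanishesBelow.bar {k : ℕ} {θ : Cochain G S} (h : VanishesBelow N k θ) :
    VanishesBelow N k (bar θ) := fun l hl => by rw [bar_apply, h l hl, smul_zero]

theorem VanishesBelow.iota_of_mem {k : ℕ} {θ : Cochain G S} (h : VanishesBelow N k θ) {a : G}
    (ha : N a) : VanishesBelow N k (iota a θ) := fun l hl => h _ (by simpa [excess, ha] using hl)

theorem VanishesBelow.iota {k : ℕ} {θ : Cochain G S} (h : VanishesBelow N (k + 1) θ) (a : G) :
    VanishesBelow N k (iota a θ) := fun l hl => h _ (by
  rw [excess]; split_ifs <;> omega)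

/-- A shuffle distributes the arguments over the two factors, so fewer than `k + m` outside
arguments leave one factor with too few. In the recursion an outside argument lowers the filtration
degree of the factor receiving it by one, unless that degree is already `0`. -/
theorem VanishesBelow.mul {k m : ℕ} {α β : Cochain G S} (hα : VanishesBelow N k α)
    (hβ : VanishesBelow N m β) : VanishesBelow N (k + m) (α * β) := by
  intro l
  induction l generalizing k m α β with
  | nil =>
    intro h
    rw [mul_nil]
    rcases k with _ | k
    · rw [hβ [] (by simpa using h), mul_zero]
    · rw [hα [] (by simp [excess]), zero_mul]
  | cons a l ih =>
    intro h
    rw [excess] at h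
    rw [mul_cons]
    split_ifs at h with ha
    · rw [ih (hα.iota_of_mem ha) hβ h, ih hα.bar (hβ.iota_of_mem ha) h, add_zero]
    · have h1 : (Cochain.iota a α * β) l = 0 := by
        rcases k with _ | k
        · exact ih (VanishesBelow.zero _) hβ (by omega)
        · exact ih (hα.iota a) hβ (by omega)
      have h2 : (Cochain.bar α * Cochain.iota a β) l = 0 := by
        rcases m with _ | m
        · exact ih hα.bar (VanishesBelow.zero _) (by omega)
        · exact ih hα.bar (hβ.iota a) (by omega)
      rw [h1, h2, add_zero]

theorem VanishesBelow.pow {k : ℕ} {α : Cochain G S} (hα : VanishesBelow N k α) (i : ℕ) :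
    VanishesBelow N (k * i) (α ^ i) := by
  induction i with
  | zero => exact VanishesBelow.zero _
  | succ i ih => rw [pow_succ]; exact ih.mul hα

theorem VanishesBelow.map {S' : Type*} [Ring S'] (t : S →+ S') {k : ℕ} {α : Cochain G S}
    (hα : VanishesBelow N k α) : VanishesBelow N k (map t α) := fun l hl => by
  rw [map_apply, hα l hl, map_zero]
end Filtration

/-! ### Pullback of cochains along a map of arguments. -/

section Pullback
variable {G' : Type*} [Ring S] (ρ : G → G')

/-- Pullback of cochains along `ρ : G → G'`. -/
def pullback (θ : Cochain G' S) : Cochain G S := of fun l => θ (l.map ρ)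

theorem pullback_mul (α β : Cochain G' S) :
    pullback ρ (α * β) = pullback ρ α * pullback ρ β := by
  ext l
  induction l generalizing α β with
  | nil => rfl
  | cons a l ih =>
    have hb : pullback ρ (bar α) = bar (pullback ρ α) := by
      ext l; simp [pullback, bar_apply]
    have hi : ∀ θ : Cochain G' S, iota a (pullback ρ θ) = pullback ρ (iota (ρ a) θ) := fun _ => rfl
    rw [apply_cons, hi, iota_mul]
    change pullback ρ (iota (ρ a) α * β) l + pullback ρ (bar α * iota (ρ a) β) l = _
    rw [ih, ih, mul_cons, hi, hi, hb]

theorem pullback_one : pullback ρ (1 : Cochain G' S) = 1 := by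
  ext l; cases l <;> rfl

theorem pullback_pow (α : Cochain G' S) (i : ℕ) : pullback ρ (α ^ i) = pullback ρ α ^ i := by
  induction i with
  | zero => exact pullback_one ρ
  | succ i ih => rw [pow_succ, pow_succ, pullback_mul, ih]
end Pullback

end Cochain
end CochainAlgebra

/-! ### Alternating forms as cochains; the wedge product as a shuffle product. -/

section Hat

namespace Cochain
variable {R G S : Type*}

theorem ofFn_insertNth {n : ℕ} (i : Fin (n + 1)) (a : G) (w : Fin n → G) :
    List.ofFn (i.insertNth a w : Fin (n + 1) → G) = (List.ofFn w).insertIdx i a := by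
  induction n with
  | zero =>
    obtain rfl : i = 0 := Fin.fin_one_eq_zero i
    simp
  | succ n ih =>
    refine Fin.cases ?_ (fun j => ?_) i
    · simp [Fin.insertNth_zero']
    · have h : (j.succ.insertNth a w : Fin (n + 2) → G) =
          Fin.cons (w 0) (j.insertNth a (Fin.tail w) : Fin (n + 1) → G) := by
        symm
        rw [Fin.eq_insertNth_iff]
        refine ⟨by simp, funext fun k => ?_⟩
        refine Fin.cases ?_ (fun k => ?_) k <;> simp [Fin.removeNth, Fin.tail]
      rw [h, List.ofFn_cons, ih, List.ofFn_succ (f := w), Fin.val_succ, List.insertIdx_succ_cons]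
      rfl

theorem take_insertIdx_of_lt {l : List G} {p i : ℕ} (a : G) (hi : i < p) (hp : p ≤ l.length + 1) :
    (l.insertIdx i a).take p = (l.take (p - 1)).insertIdx i a := by
  induction l generalizing p i with
  | nil =>
    obtain rfl : i = 0 := by simp at hp; omega
    obtain rfl : p = 1 := by simp at hp; omega
    simp
  | cons b l ih =>
    rcases p with _ | _ | p
    · omega
    · obtain rfl : i = 0 := by omega
      simp
    · rcases i with _ | i
      · simp
      · simpa using ih (p := p + 1) (by omega) (by simpa using hp)

theorem drop_insertIdx_of_lt {l : List G} {p i : ℕ} (a : G) (hi : i < p) (hp : p ≤ l.length + 1) :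
    (l.insertIdx i a).drop p = l.drop (p - 1) := by
  induction l generalizing p i with
  | nil =>
    obtain rfl : i = 0 := by simp at hp; omega
    obtain rfl : p = 1 := by simp at hp; omega
    simp
  | cons b l ih =>
    rcases p with _ | _ | p
    · omega
    · obtain rfl : i = 0 := by omega
      simp
    · rcases i with _ | i
      · simp
      · simpa using ih (p := p + 1) (by omega) (by simpa using hp)

theorem take_insertIdx_add {l : List G} {p : ℕ} (i : ℕ) (a : G) (hp : p + i ≤ l.length) :
    (l.insertIdx (p + i) a).take p = l.take p := by
  induction l generalizing p with
  | nil =>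
    obtain rfl : p = 0 := by simp at hp; omega
    simp
  | cons b l ih =>
    rcases p with _ | p
    · simp
    · rw [show p + 1 + i = p + i + 1 by omega]
      simpa using ih (p := p) (by simp at hp; omega)

theorem drop_insertIdx_add {l : List G} {p : ℕ} (i : ℕ) (a : G) (hp : p + i ≤ l.length) :
    (l.insertIdx (p + i) a).drop p = (l.drop p).insertIdx i a := by
  induction l generalizing p with
  | nil =>
    obtain rfl : p = 0 := by simp at hp; omega
    simp
  | cons b l ih =>
    rcases p with _ | p
    · simp
    · rw [show p + 1 + i = p + i + 1 by omega]
      simpa using ih (p := p) (by simp at hp; omega)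

section AltSum
variable [AddCommGroup S]

/-- The alternating sum of a function of sequences over the permutations of its arguments. -/
def altSum (n : ℕ) (f : List G → S) (v : Fin n → G) : S :=
  ∑ σ : Equiv.Perm (Fin n), (Equiv.Perm.sign σ : ℤ) • f (List.ofFn (v ∘ σ))

theorem altSum_congr {n : ℕ} {f g : List G → S} (h : ∀ l, l.length = n → f l = g l)
    (v : Fin n → G) : altSum n f v = altSum n g v :=
  Finset.sum_congr rfl fun σ _ => by rw [h _ (by simp)]

theorem altSum_smul {n : ℕ} (c : ℤ) (f : List G → S) (v : Fin n → G) :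
    altSum n (fun l => c • f l) v = c • altSum n f v := by
  simp only [altSum, Finset.smul_sum, smul_comm c]

/-- A permutation is determined by the preimage of `0` and a permutation of the rest. -/
theorem bijective_lift_mul_cycleRange (n : ℕ) : Function.Bijective
    fun x : Fin (n + 1) × Equiv.Perm (Fin n) =>
      Equiv.Perm.decomposeFin.symm (0, x.2) * x.1.cycleRange := by
  rw [Fintype.bijective_iff_injective_and_card]
  refine ⟨?_, by simp [Fintype.card_perm, Nat.factorial_succ]⟩
  rintro ⟨p, e⟩ ⟨p', e'⟩ h
  -- The first component is recovered as the preimage of `0`, since `cycleRange` moves `p` to `0`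
  -- and the lifted permutation fixes `0`.
  have h0 : ∀ (p : Fin (n + 1)) (e : Equiv.Perm (Fin n)),
      (Equiv.Perm.decomposeFin.symm (0, e) * p.cycleRange) p = 0 := by
    intro p e
    simp
  have hp : p = p' := by
    apply (Equiv.Perm.decomposeFin.symm (0, e) * p.cycleRange).injective
    rw [h0]
    exact (h0 p' e').symm.trans (congrArg (fun σ => σ p') h).symm
  subst hp
  have := Equiv.Perm.decomposeFin.symm.injective (mul_right_cancel h)
  simp_all

/-- Sort the permutations by the position `i` at which the first argument `a` lands. The rest is a
permutation of the other arguments, and bringing `a` to position `i` costs the sign `(-1) ^ i` of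
`cycleRange`. -/
theorem altSum_cons {n : ℕ} (f : List G → S) (a : G) (w : Fin n → G) :
    altSum (n + 1) f (Fin.cons a w) =
      ∑ i ∈ Finset.range (n + 1), (-1 : ℤ) ^ i • altSum n (fun l => f (l.insertIdx i a)) w := by
  rw [Finset.sum_range (f := fun i => (-1 : ℤ) ^ i • altSum n (fun l => f (l.insertIdx i a)) w),
    altSum, ← (bijective_lift_mul_cycleRange n).sum_comp, Fintype.sum_prod_type]
  refine Finset.sum_congr rfl fun i _ => ?_
  rw [altSum, Finset.smul_sum]
  refine Finset.sum_congr rfl fun e _ => ?_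
  have h1 : (Fin.cons a w : Fin (n + 1) → G) ∘
      (Equiv.Perm.decomposeFin.symm (0, e) * i.cycleRange : Equiv.Perm (Fin (n + 1))) =
      i.insertNth a (w ∘ e) := by
    rw [← Fin.cons_comp_cycleRange, Equiv.Perm.coe_mul, ← Function.comp_assoc]
    congr 1
    funext j
    refine Fin.cases ?_ (fun j => ?_) j <;> simp
  dsimp only
  rw [h1, ofFn_insertNth, smul_smul]
  congr 1
  simp [Fin.sign_cycleRange, mul_comm]

/-- Cochains that change sign when an argument is moved past another. -/
def IsAlternating (θ : Cochain G S) : Prop :=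
  ∀ (a : G) (l : List G) (i : ℕ), i ≤ l.length → θ (l.insertIdx i a) = (-1 : ℤ) ^ i • θ (a :: l)

theorem IsAlternating.iota {θ : Cochain G S} (h : IsAlternating θ) (b : G) :
    IsAlternating (iota b θ) := by
  intro a l i hi
  have h1 := h a (b :: l) (i + 1) (by simpa using hi)
  have h2 := h a (b :: l) 1 (by simp)
  simp only [List.insertIdx_succ_cons, List.insertIdx_zero] at h1 h2
  rw [iota_apply, iota_apply, h1, h2, smul_smul, pow_succ, pow_one]
end AltSum

/-- The alternating sum over all permutations counts each shuffle `p! q!` times. By induction: of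
the positions for the first argument, the first `p` put it into `α` and all contribute equally, the
last `q` put it into `β` and all contribute equally. These are the two terms of `iota_mul`. -/
theorem altSum_mul [Ring S] (n p q : ℕ) (hn : p + q = n) (α β : Cochain G S)
    (hα : Homogeneous p α) (hβ : Homogeneous q β) (hα' : IsAlternating α) (hβ' : IsAlternating β)
    (v : Fin n → G) : altSum n (fun l => α (l.take p) * β (l.drop p)) v =
      (p.factorial * q.factorial) • (α * β) (List.ofFn v) := by
  induction n generalizing p q α β with
  | zero =>
    obtain rfl : p = 0 := by omega
    obtain rfl : q = 0 := by omega
    simp [altSum, mul_nil]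
  | succ n ih =>
    -- The `p` equal terms supply the factor that turns `(p - 1)!` into `p!`; the sign from the
    -- position cancels the one from alternation.
    have h1 : ∑ i ∈ Finset.range p, (-1 : ℤ) ^ i •
        altSum n (fun l => α ((l.insertIdx i (v 0)).take p) * β ((l.insertIdx i (v 0)).drop p))
          (Fin.tail v) =
        (p.factorial * q.factorial) • (Cochain.iota (v 0) α * β) (List.ofFn (Fin.tail v)) := by
      rcases p with _ | p
      · simp [hα.iota_zero]
      · rw [Finset.sum_congr rfl (g := fun _ => (p.factorial * q.factorial) •
          (Cochain.iota (v 0) α * β) (List.ofFn (Fin.tail v))), Finset.sum_const, smul_smul,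
          Finset.card_range, ← mul_assoc, Nat.factorial_succ]
        intro i hi
        rw [Finset.mem_range] at hi
        rw [← ih p q (by omega) _ β (hα.iota _) hβ (hα'.iota _) hβ', ← altSum_smul]
        refine altSum_congr (fun l hl => ?_) _
        rw [take_insertIdx_of_lt _ hi (by omega), drop_insertIdx_of_lt _ hi (by omega),
          hα' _ _ _ (by simp; omega), smul_mul_assoc, smul_smul, ← mul_pow]
        simp [iota_apply]
    -- Here the sign `(-1) ^ p` survives, for passing the argument across `α`; it is the one carried
    -- by `bar α`.
    have h2 : ∑ i ∈ Finset.range q, (-1 : ℤ) ^ (p + i) •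
        altSum n (fun l => α ((l.insertIdx (p + i) (v 0)).take p) *
          β ((l.insertIdx (p + i) (v 0)).drop p)) (Fin.tail v) =
        (p.factorial * q.factorial) • (bar α * Cochain.iota (v 0) β) (List.ofFn (Fin.tail v)) := by
      rcases q with _ | q
      · simp [hβ.iota_zero]
      · rw [Finset.sum_congr rfl (g := fun _ => (p.factorial * q.factorial) •
          (bar α * Cochain.iota (v 0) β) (List.ofFn (Fin.tail v))), Finset.sum_const, smul_smul,
          Finset.card_range, Nat.factorial_succ, mul_left_comm]
        intro i hi
        rw [Finset.mem_range] at hi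
        have h3 : (bar α * Cochain.iota (v 0) β) (List.ofFn (Fin.tail v)) =
            (-1 : ℤ) ^ p • (α * Cochain.iota (v 0) β) (List.ofFn (Fin.tail v)) := by
          rw [hα.bar, smul_mul_assoc]; rfl
        rw [h3, smul_comm, ← ih p q (by omega) α _ hα (hβ.iota _) hα' (hβ'.iota _),
          ← altSum_smul, ← altSum_smul]
        refine altSum_congr (fun l hl => ?_) _
        rw [take_insertIdx_add _ _ (by omega), drop_insertIdx_add _ _ (by omega),
          hβ' _ _ _ (by simp; omega), mul_smul_comm, smul_smul, pow_add, mul_assoc, ← mul_pow]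
        simp [iota_apply]
    have h3 : Finset.range (n + 1) = Finset.range (p + q) := by rw [hn]
    rw [← Fin.cons_self_tail v, altSum_cons, h3, Finset.sum_range_add, h1, h2, List.ofFn_cons, mul_cons, smul_add]

variable [CommRing R] [AddCommGroup G] [Module R G]

section
variable [AddCommGroup S] [Module R S]

/-- An alternating map as a cochain. -/
def hat {p : ℕ} (θ : G [⋀^Fin p]→ₗ[R] S) : Cochain G S :=
  of fun l => if h : l.length = p then θ fun i => l.get (i.cast h.symm) else 0

theorem hat_ofFn {p : ℕ} (θ : G [⋀^Fin p]→ₗ[R] S) (v : Fin p → G) :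
    hat θ (List.ofFn v) = θ v := by
  rw [hat, of_apply, dif_pos (by simp)]
  congr 1
  funext i
  simp

theorem homogeneous_hat {p : ℕ} (θ : G [⋀^Fin p]→ₗ[R] S) : Homogeneous p (hat θ) := by
  intro l hl
  rw [hat, of_apply, dif_neg hl]

omit [AddCommGroup G] in
theorem Homogeneous.ext {p : ℕ} {θ η : Cochain G S} (h : Homogeneous p θ) (h' : Homogeneous p η)
    (hv : ∀ v : Fin p → G, θ (List.ofFn v) = η (List.ofFn v)) : θ = η := by
  ext l
  by_cases hl : l.length = p
  · subst hl
    simpa using hv l.get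
  · rw [h l hl, h' l hl]

theorem hat_add {p : ℕ} (θ η : G [⋀^Fin p]→ₗ[R] S) : hat (θ + η) = hat θ + hat η :=
  (homogeneous_hat _).ext ((homogeneous_hat _).add (homogeneous_hat _)) fun v => by
    simp only [hat_ofFn, add_apply]; rfl

theorem isAlternating_hat {p : ℕ} (θ : G [⋀^Fin p]→ₗ[R] S) : IsAlternating (hat θ) := by
  intro a l i hi
  by_cases hl : l.length + 1 = p
  · subst hl
    obtain ⟨w, hw⟩ : ∃ w : Fin l.length → G, List.ofFn w = l := ⟨l.get, by simp⟩
    have h1 := ofFn_insertNth ⟨i, by omega⟩ a w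
    have h2 : a :: l = List.ofFn (Fin.cons a w : Fin (l.length + 1) → G) := by
      rw [List.ofFn_cons, hw]
    rw [hw] at h1
    rw [← h1, hat_ofFn, h2, hat_ofFn, AlternatingMap.map_insertNth]
    simp
    rfl
  · rw [homogeneous_hat θ _ (by rwa [List.length_insertIdx_of_le_length hi]),
      homogeneous_hat θ _ (by simpa using hl), smul_zero]

end

/-- Both sides become the same sum over all permutations once multiplied by `p! q!`: the left one by
the alternatization formula for `domCoprod`, the right one by `altSum_mul`. Torsion-freeness cancels
the factorials. -/
theorem hat_wedge [Ring S] [Algebra R S] [IsAddTorsionFree S] {p q : ℕ} (α : G [⋀^Fin p]→ₗ[R] S)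
    (β : G [⋀^Fin q]→ₗ[R] S) : hat (wedge α β) = hat α * hat β := by
  refine (homogeneous_hat _).ext ((homogeneous_hat α).mul (homogeneous_hat β)) fun v => ?_
  have h0 : p.factorial * q.factorial ≠ 0 := by positivity
  apply nsmul_right_injective h0
  dsimp only
  rw [← altSum_mul (p + q) p q rfl _ _ (homogeneous_hat α) (homogeneous_hat β)
    (isAlternating_hat α) (isAlternating_hat β), hat_ofFn]
  have h1 : ∀ w : Fin p ⊕ Fin q → G, (p.factorial * q.factorial) •
      LinearMap.mul' R S ((α.domCoprod β) w) = ∑ σ : Equiv.Perm (Fin p ⊕ Fin q),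
        (Equiv.Perm.sign σ : ℤ) •
          (α (fun i => w (σ (Sum.inl i))) * β (fun j => w (σ (Sum.inr j)))) := by
    intro w
    have h2 := congrArg (fun f => LinearMap.mul' R S (f w))
      (MultilinearMap.domCoprod_alternization_eq α β)
    simp only [Fintype.card_fin, AlternatingMap.smul_apply, map_nsmul] at h2
    rw [← h2, MultilinearMap.alternatization_apply, map_sum]
    refine Finset.sum_congr rfl fun σ _ => ?_
    rw [Units.smul_def, map_zsmul]
    congr 1
  change (p.factorial * q.factorial) • LinearMap.mul' R S ((α.domCoprod β) _) = _
  rw [h1, altSum, ← (Equiv.permCongr finSumFinEquiv).sum_comp]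
  refine Finset.sum_congr rfl fun σ _ => ?_
  rw [Equiv.Perm.sign_permCongr]
  have h3 : ∀ f : Fin (p + q) → G, (List.ofFn f).take p = List.ofFn fun i => f (Fin.castAdd q i) := by
    intro f
    rw [List.ofFn_add, List.take_left' (by simp)]
    rfl
  have h4 : ∀ f : Fin (p + q) → G, (List.ofFn f).drop p = List.ofFn fun i => f (Fin.natAdd p i) := by
    intro f
    rw [List.ofFn_add, List.drop_left' (by simp)]
  rw [h3, h4, hat_ofFn, hat_ofFn]
  simp

end Cochain
end Hat

/-! ### Comparison of the Cartan differential with the Koszul formula. -/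

section Koszul
namespace Cochain
variable {G S : Type*} [AddCommGroup S] (br : G → G → G) (δ : G → S →+ S)

theorem lie_ofFn {n : ℕ} (a : G) (θ : Cochain G S) (w : Fin n → G) :
    lie br δ a θ (List.ofFn w) = δ a (θ (List.ofFn w)) -
      ∑ j, θ (List.ofFn (Function.update w j (br a (w j)))) := by
  induction n generalizing θ with
  | zero => simp [lie_nil]
  | succ n ih =>
    have h0 : Function.update w 0 (br a (w 0)) = Fin.cons (br a (w 0)) (Fin.tail w) := by
      have h := Fin.update_cons_zero (w 0) (Fin.tail w) (br a (w 0))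
      rwa [Fin.cons_self_tail] at h
    have hs : ∀ j : Fin n, Function.update w j.succ (br a (w j.succ)) =
        Fin.cons (w 0) (Function.update (Fin.tail w) j (br a (Fin.tail w j))) := by
      intro j
      rw [Fin.cons_update, Fin.cons_self_tail]
      rfl
    have hw : List.ofFn w = w 0 :: List.ofFn (Fin.tail w) := List.ofFn_succ
    rw [Fin.sum_univ_succ]
    simp only [h0, hs, List.ofFn_cons]
    rw [hw]
    simp only [apply_cons, iota_lie, sub_apply, ih]
    abel

/-- The Koszul formula for the differential of an alternating cochain. -/
theorem diff_ofFn {r : ℕ} {θ : Cochain G S} (hθ : IsAlternating θ) (a : Fin (r + 1) → G) :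
    diff br δ θ (List.ofFn a) =
      ∑ i : Fin (r + 1), (-1 : ℤ) ^ (i : ℕ) • δ (a i) (θ (List.ofFn (i.removeNth a))) +
      ∑ i : Fin (r + 1), ∑ j ∈ Finset.Ioi i, (-1 : ℤ) ^ (j : ℕ) •
        θ (List.ofFn (j.removeNth (Function.update a i (br (a i) (a j))))) := by
  induction r generalizing θ with
  | zero =>
    rw [List.ofFn_succ]
    simp [apply_cons, iota_diff, lie_nil, diff_nil]
  | succ r ih =>
    obtain ⟨x, w, rfl⟩ : ∃ x w, a = Fin.cons x w := ⟨a 0, Fin.tail a, (Fin.cons_self_tail a).symm⟩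
    have hrem : ∀ (j : Fin (r + 1)) (y : G) (u : Fin (r + 1) → G),
        j.succ.removeNth (Fin.cons y u : Fin (r + 2) → G) = Fin.cons y (j.removeNth u) := by
      intro j y u
      funext k
      refine Fin.cases ?_ (fun k => ?_) k <;> simp [Fin.removeNth]
    have hrem0 : (0 : Fin (r + 2)).removeNth (Fin.cons x w : Fin (r + 2) → G) = w := by
      funext k; simp [Fin.removeNth]
    -- Alternation moves the bracket from the front into the `j`-th place and absorbs the sign.
    -- These terms are the `i = 0` part of the double sum and come from the Lie derivative along
    -- `x`.
    have hupd : ∀ j : Fin (r + 1), (-1 : ℤ) ^ (j : ℕ) •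
        θ (br x (w j) :: List.ofFn (j.removeNth w)) =
          θ (List.ofFn (Function.update w j (br x (w j)))) := by
      intro j
      have h1 := hθ (br x (w j)) (List.ofFn (j.removeNth w)) j (by simp; omega)
      rw [← ofFn_insertNth, Fin.insertNth_removeNth] at h1
      rw [h1]
    rw [Fin.sum_univ_succ, Fin.sum_univ_succ (n := r + 1)
      (f := fun i => ∑ j ∈ Finset.Ioi i, _), Fin.sum_Ioi_zero, List.ofFn_cons, apply_cons, iota_diff,
      sub_apply, ih (hθ.iota x), lie_ofFn]
    simp only [Fin.sum_Ioi_succ, Fin.cons_zero, Fin.cons_succ, Fin.update_cons_zero, hrem, hrem0,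
      ← Fin.cons_update, List.ofFn_cons, hupd, iota_apply, Fin.val_succ, pow_succ, mul_neg_one,
      neg_smul, Finset.sum_neg_distrib, Fin.val_zero, pow_zero, one_smul]
    abel
end Cochain
end Koszul

/-! ### Connections, curvature and the difference of two connections. -/

section
variable {n : ℕ} {M : Type*} [TopologicalSpace M] [ChartedSpace (EuclideanSpace ℝ (Fin n)) M]

/-- A `C^∞(M)`-module is a real vector space, so positive integers act invertibly. This is what
`hat_wedge` requires of the values. -/
theorem isAddTorsionFree_of_smoothFun (P : Type*) [AddCommGroup P] [Module (SmoothFun n M) P] :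
    IsAddTorsionFree P := by
  refine ⟨fun k hk x y h => ?_⟩
  have h1 : ∀ z : P, (algebraMap ℝ (SmoothFun n M) (k : ℝ)⁻¹) • (k • z) = z := by
    intro z
    rw [← Nat.cast_smul_eq_nsmul (SmoothFun n M), smul_smul, ← map_natCast (algebraMap ℝ (SmoothFun n M)),
      ← map_mul, inv_mul_cancel₀ (by exact_mod_cast hk), map_one, one_smul]
  rw [← h1 x, ← h1 y]
  exact congrArg _ h

variable [IsManifold (𝓡 n) ∞ M]
variable {F : Type*} [NormedAddCommGroup F] [NormedSpace ℝ F]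
  {A : M → Type*} [TopologicalSpace (TotalSpace F A)] [∀ x, AddCommGroup (A x)]
  [∀ x, Module ℝ (A x)] [∀ x, TopologicalSpace (A x)] [FiberBundle F A] [VectorBundle ℝ F A]

open Cochain

section
variable (L : LieAlgebroid n F A)

/-- The derivation `f ↦ ρ(a) f`. -/
def LieAlgebroid.actHom (a : Sec n F A) : SmoothFun n M →+ SmoothFun n M :=
  AddMonoidHom.mk' (L.anchor a).act (L.anchor a).act_add

/-- The differential on scalar cochains. -/
abbrev LieAlgebroid.cdiff : Cochain (Sec n F A) (SmoothFun n M) →+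
    Cochain (Sec n F A) (SmoothFun n M) := diff L.bracket L.actHom

theorem LieAlgebroid.actHom_mul (a : Sec n F A) (f g : SmoothFun n M) :
    L.actHom a (f * g) = L.actHom a f * g + f * L.actHom a g := by
  refine ((L.anchor a).act_mul f g).trans ?_
  rw [add_comm, mul_comm g]; rfl

theorem LieAlgebroid.cdiff_mul (α β : Cochain (Sec n F A) (SmoothFun n M)) :
    L.cdiff (α * β) = L.cdiff α * β + bar α * L.cdiff β := diff_mul _ _ L.actHom_mul α β

theorem LieAlgebroid.cdiff_smul (c : ℝ) (α : Cochain (Sec n F A) (SmoothFun n M)) :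
    L.cdiff (c • α) = c • L.cdiff α :=
  diff_smul _ _ (fun a c f => (L.anchor a).act_smul c f) c α

/-- The link between the cochain calculus and `d`: closedness and exactness in the sense of the
theorem can be checked on cochains. -/
theorem LieAlgebroid.cdiff_hat {r : ℕ} (θ : AForm n F A r) (a : Fin (r + 1) → Sec n F A) :
    L.cdiff (hat θ) (List.ofFn a) = L.d r θ a := by
  have h : ∀ (i : ℕ) (f : SmoothFun n M), (-1 : ℤ) ^ i • f = (-1 : ℝ) ^ i • f := by
    intro i f
    rcases neg_one_pow_eq_or ℤ i with h | h <;> rcases neg_one_pow_eq_or ℝ i with h' | h' <;>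
      rcases Nat.even_or_odd i with hi | hi <;> simp [hi.neg_one_pow]
  rw [LieAlgebroid.cdiff, diff_ofFn _ _ (isAlternating_hat θ)]
  simp only [hat_ofFn, h]
  rfl

theorem LieAlgebroid.mem_closedForms {r : ℕ} {θ : AForm n F A r} (h : L.cdiff (hat θ) = 0) :
    θ ∈ L.closedForms r := by
  refine LinearMap.mem_ker.2 (funext fun a => ?_)
  rw [← L.cdiff_hat, h]
  rfl

theorem LieAlgebroid.mem_exactForms_succ {r : ℕ} {θ : AForm n F A (r + 1)} (η : AForm n F A r)
    (h : hat θ = L.cdiff (hat η)) : θ ∈ L.exactForms (r + 1) := by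
  refine ⟨η, funext fun a => ?_⟩
  rw [← L.cdiff_hat, ← h, hat_ofFn]
  rfl

end

variable [T2Space M] [ContMDiffVectorBundle ∞ F A (𝓡 n)] {L : LieAlgebroid n F A}
  {P : Type*} [AddCommGroup P] [Module (SmoothFun n M) P]

namespace LinearConnection

theorem nabla_sub_right {𝔤 : Type*} [AddCommGroup 𝔤] [Module (SmoothFun n M) 𝔤]
    {ρ : 𝔤 →ₗ[SmoothFun n M] VF n M} (D : LinearConnection ρ P) (a : 𝔤) (e e' : P) :
    D.nabla a (e - e') = D.nabla a e - D.nabla a e' :=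
  map_sub (AddMonoidHom.mk' (D.nabla a) (D.add_right a)) e e'

theorem nabla_sum_right {𝔤 : Type*} [AddCommGroup 𝔤] [Module (SmoothFun n M) 𝔤]
    {ρ : 𝔤 →ₗ[SmoothFun n M] VF n M} (D : LinearConnection ρ P) (a : 𝔤) {ι : Type*} (s : Finset ι)
    (e : ι → P) : D.nabla a (∑ i ∈ s, e i) = ∑ i ∈ s, D.nabla a (e i) :=
  map_sum (AddMonoidHom.mk' (D.nabla a) (D.add_right a)) e s

variable (D D' : LinearConnection L.anchor P)

/-- The commutator `φ ↦ [∇_a, φ]`, the induced connection on `End(E)`. -/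
def adHom (a : Sec n F A) : Module.End (SmoothFun n M) P →+ Module.End (SmoothFun n M) P where
  toFun φ :=
    { toFun := fun e => D.nabla a (φ e) - φ (D.nabla a e)
      map_add' := fun e e' => by simp only [map_add, D.add_right]; abel
      map_smul' := fun f e => by
        simp only [map_smul, D.leibniz, map_add, RingHom.id_apply, smul_sub]; abel }
  map_zero' := by
    ext e
    simpa using D.nabla_sub_right a 0 0
  map_add' φ ψ := by
    ext e
    simp only [LinearMap.add_apply, LinearMap.coe_mk, AddHom.coe_mk, D.add_right]
    abel

theorem adHom_apply (a : Sec n F A) (φ : Module.End (SmoothFun n M) P) (e : P) :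
    D.adHom a φ e = D.nabla a (φ e) - φ (D.nabla a e) := rfl

theorem adHom_mul (a : Sec n F A) (φ ψ : Module.End (SmoothFun n M) P) :
    D.adHom a (φ * ψ) = D.adHom a φ * ψ + φ * D.adHom a ψ := by
  ext e
  simp only [LinearMap.add_apply, Module.End.mul_apply, adHom_apply, map_sub]
  abel

/-- The covariant differential on cochains with values in `Γ(End E)`. -/
abbrev cdiff : Cochain (Sec n F A) (Module.End (SmoothFun n M) P) →+
    Cochain (Sec n F A) (Module.End (SmoothFun n M) P) := diff L.bracket D.adHom

theorem cdiff_mul (α β : Cochain (Sec n F A) (Module.End (SmoothFun n M) P)) :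
    D.cdiff (α * β) = D.cdiff α * β + bar α * D.cdiff β := diff_mul _ _ D.adHom_mul α β

theorem hat_curvature_pair (a b : Sec n F A) : hat D.curvature [a, b] = D.curvatureEnd a b := by
  have : [a, b] = List.ofFn ![a, b] := by simp
  rw [this, hat_ofFn]
  rfl

/-- The Bianchi identity. -/
theorem cdiff_curvature : D.cdiff (hat D.curvature) = 0 := by
  refine ((homogeneous_hat D.curvature).diff _ _).ext (p := 3) (fun _ _ => rfl) fun v => ?_
  have hv : List.ofFn v = [v 0, v 1, v 2] := by simp [List.ofFn_succ]
  rw [hv]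
  generalize v 0 = a
  generalize v 1 = b
  generalize v 2 = c
  have h : ∀ a b, iota b (iota a (hat D.curvature)) [] = D.curvatureEnd a b := D.hat_curvature_pair
  simp only [apply_cons, iota_diff, iota_lie, map_sub, Cochain.sub_apply, lie_nil, diff_nil, h,
    map_zero, Cochain.zero_apply]
  ext e
  -- All iterated covariant derivatives cancel formally; the remaining derivatives along double
  -- brackets cancel by the Jacobi identity.
  have hj : ∀ e, D.nabla (L.bracket a (L.bracket b c)) e =
      D.nabla (L.bracket (L.bracket a b) c) e + D.nabla (L.bracket b (L.bracket a c)) e :=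
    fun e => by rw [L.jacobi, D.add_left]
  simp only [LinearMap.sub_apply, adHom_apply, curvatureEnd_apply, nabla_sub_right, hj,
    LinearMap.zero_apply]
  abel

theorem hat_curvaturePow (i : ℕ) : hat (D.curvaturePow i) = hat D.curvature ^ i := by
  have := isAddTorsionFree_of_smoothFun (n := n) (M := M) (Module.End (SmoothFun n M) P)
  induction i with
  | zero =>
    refine (homogeneous_hat _).ext Homogeneous.one fun v => ?_
    rw [hat_ofFn, List.ofFn_zero]
    rfl
  | succ i ih =>
    rw [pow_succ, ← ih]
    exact hat_wedge _ _

/-- The difference of two connections, a form of degree `1` with values in `Γ(End E)`. -/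
def diffForm : Sec n F A [⋀^Fin 1]→ₗ[SmoothFun n M] Module.End (SmoothFun n M) P :=
  AlternatingMap.ofSubsingleton (SmoothFun n M) _ _ (0 : Fin 1)
    { toFun := fun a =>
        { toFun := fun e => D'.nabla a e - D.nabla a e
          map_add' := fun e e' => by simp only [add_right]; abel
          map_smul' := fun f e => by simp only [leibniz, RingHom.id_apply, smul_sub]; abel }
      map_add' := fun a b => by
        ext e
        simp only [LinearMap.add_apply, LinearMap.coe_mk, AddHom.coe_mk, add_left]
        abel
      map_smul' := fun f a => by
        ext e
        simp [smul_left, smul_sub] }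

theorem hat_diffForm_single (a : Sec n F A) (e : P) :
    hat (diffForm D D') [a] e = D'.nabla a e - D.nabla a e := by
  have : [a] = List.ofFn ![a] := by simp
  rw [this, hat_ofFn]
  rfl

theorem cdiff_eq (θ : Cochain (Sec n F A) (Module.End (SmoothFun n M) P)) :
    D'.cdiff θ = D.cdiff θ + (hat (diffForm D D') * θ - bar θ * hat (diffForm D D')) := by
  have h : hat (diffForm D D') = ofFun fun a => hat (diffForm D D') [a] := by
    refine (homogeneous_hat _).ext (Homogeneous.ofFun _) fun v => ?_
    simp [ofFun]
  rw [h]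
  refine diff_of_sub L.bracket D.adHom D'.adHom _ (fun a φ => ?_) θ
  ext e
  simp only [LinearMap.add_apply, LinearMap.sub_apply, Module.End.mul_apply, adHom_apply,
    hat_diffForm_single, map_sub]
  abel

/-- The structure equation `R' = R + DB + B²` for `D' = D + B`. All terms have degree `2`, so
evaluation on pairs suffices. -/
theorem hat_curvature_eq : hat D'.curvature = hat D.curvature + D.cdiff (hat (diffForm D D')) +
    hat (diffForm D D') * hat (diffForm D D') := by
  have hB := homogeneous_hat (diffForm D D')
  refine (homogeneous_hat _).ext (((homogeneous_hat _).add (hB.diff _ _)).add (hB.mul hB))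
    fun v => ?_
  have hv : List.ofFn v = [v 0, v 1] := by simp
  rw [hv]
  generalize v 0 = a
  generalize v 1 = b
  have h2 : iota b (iota a (hat (diffForm D D'))) = 0 := (hB.iota (p := 0) a).iota_zero b
  have h0 : hat (diffForm D D') [] = 0 := hB [] (by simp)
  have h : ∀ a e, (iota a (hat (diffForm D D')) []) e = D'.nabla a e - D.nabla a e :=
    D.hat_diffForm_single D'
  rw [Cochain.add_apply, Cochain.add_apply, hat_curvature_pair, hat_curvature_pair]
  ext e
  have hb : ∀ a, iota a (bar (hat (diffForm D D'))) = - bar (iota a (hat (diffForm D D'))) :=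
    fun a => iota_bar a _
  simp only [apply_cons, iota_diff, iota_lie, iota_mul, map_add, map_sub, Cochain.sub_apply,
    Cochain.add_apply, lie_nil, diff_nil, mul_nil, h2, h0, LinearMap.add_apply, LinearMap.sub_apply, adHom_apply,
    curvatureEnd_apply, nabla_sub_right, Cochain.zero_apply, hb, bar_nil,
    Cochain.neg_apply, h,
    Module.End.mul_apply, LinearMap.neg_apply, LinearMap.zero_apply]
  abel

end LinearConnection
end

/-! ### Transgression in an abstract graded algebra with a trace. -/

section Transgression
open Polynomial

variable {𝒜 : Type*} [Ring 𝒜] (σ D : 𝒜 →+ 𝒜) (hσ : ∀ x y, σ (x * y) = σ x * σ y) (hσ1 : σ 1 = 1)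
  (hD : ∀ x y, D (x * y) = D x * y + σ x * D y) {R₀ B : 𝒜} (hR : σ R₀ = R₀) (hB : σ B = -B)
  (hσD : ∀ x, σ (D x) = - D (σ x)) (hR₀ : D R₀ = 0) (hDD : D (D B) = R₀ * B - B * R₀)
  {V : Type*} [AddCommGroup V] [Module ℝ V] (t : 𝒜 →+ V) (d : V →ₗ[ℝ] V)
  (htd : ∀ x, t (D x) = d (t x))
  (ht : ∀ x y, σ x = x → t (x * y) = t (y * x)) (ht' : ∀ x y, σ x = -x → t (x * y) = t (σ y * x))

/-- The curvature `R₀ + X D B + X² B²` of the affine family of connections through `R₀`. -/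
def curvatureFamily (R₀ E B : 𝒜) : 𝒜[X] := monomial 0 R₀ + monomial 1 E + monomial 2 (B * B)

include hσ in
theorem even_coeff_mul {P Q : 𝒜[X]} (hP : ∀ k, σ (P.coeff k) = P.coeff k)
    (hQ : ∀ k, σ (Q.coeff k) = Q.coeff k) (k : ℕ) : σ ((P * Q).coeff k) = (P * Q).coeff k := by
  rw [coeff_mul, map_sum]
  exact Finset.sum_congr rfl fun x _ => by rw [hσ, hP, hQ]

include hσ hσ1 in
theorem even_coeff_pow {P : 𝒜[X]} (hP : ∀ k, σ (P.coeff k) = P.coeff k) (m k : ℕ) :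
    σ ((P ^ m).coeff k) = (P ^ m).coeff k := by
  induction m generalizing k with
  | zero =>
    rw [pow_zero, coeff_one]
    split_ifs
    · exact hσ1
    · exact map_zero σ
  | succ m ih => rw [pow_succ]; exact even_coeff_mul σ hσ ih hP k

-- Here `P'` and `Q'` are the coefficientwise images under `D`, not derivatives in `X`. The variable
-- `X` is central, and the sign in the Leibniz rule disappears because `P` is even.
include hD in
theorem der_coeff_mul {P P' Q Q' : 𝒜[X]} (hPe : ∀ k, σ (P.coeff k) = P.coeff k)
    (hP : ∀ k, D (P.coeff k) = P'.coeff k) (hQ : ∀ k, D (Q.coeff k) = Q'.coeff k) (k : ℕ) :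
    D ((P * Q).coeff k) = (P' * Q + P * Q').coeff k := by
  rw [coeff_add, coeff_mul, coeff_mul, coeff_mul, map_sum, ← Finset.sum_add_distrib]
  exact Finset.sum_congr rfl fun x _ => by rw [hD, hP, hQ, hPe]

include hσ hR hB hσD in
theorem even_curvatureFamily (k : ℕ) :
    σ ((curvatureFamily R₀ (D B) B).coeff k) = (curvatureFamily R₀ (D B) B).coeff k := by
  have h1 : σ (D B) = D B := by rw [hσD, hB, map_neg, neg_neg]
  have h2 : σ (B * B) = B * B := by rw [hσ, hB, neg_mul_neg]
  simp only [curvatureFamily, coeff_add, coeff_monomial, map_add]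
  split_ifs <;> simp [hR, h1, h2]

-- The Bianchi identity for the connection `D + X B`. The constant term is Bianchi for `R₀`, the
-- linear one is `hDD`, the quadratic one is the Leibniz rule for `B²`, and the cubic terms cancel.
include hD hB hR₀ hDD in
theorem der_curvatureFamily (k : ℕ) : D ((curvatureFamily R₀ (D B) B).coeff k) =
    (X * (curvatureFamily R₀ (D B) B * C B - C B * curvatureFamily R₀ (D B) B)).coeff k := by
  have h : X * (curvatureFamily R₀ (D B) B * C B - C B * curvatureFamily R₀ (D B) B) =
      monomial 1 (D (D B)) + monomial 2 (D (B * B)) := by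
    rw [hDD, hD, hB, ← monomial_zero_left, ← monomial_one_one_eq_X, curvatureFamily]
    simp only [mul_add, add_mul, mul_sub, monomial_mul_monomial, one_mul, map_sub, map_add, mul_assoc,
      neg_mul, map_neg]
    simp only [zero_add, add_zero, Nat.reduceAdd]
    abel
  rw [h, curvatureFamily]
  simp only [coeff_add, coeff_monomial, map_add]
  split_ifs <;> simp [hR₀]

include hσ hσ1 hD hR hB hσD hR₀ hDD in
theorem der_curvatureFamily_pow (m k : ℕ) : D ((curvatureFamily R₀ (D B) B ^ m).coeff k) =
    (X * (curvatureFamily R₀ (D B) B ^ m * C B - C B * curvatureFamily R₀ (D B) B ^ m)).coeff k := by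
  set P := curvatureFamily R₀ (D B) B with hP
  have he := even_curvatureFamily σ D hσ hR hB hσD
  induction m generalizing k with
  | zero =>
    have h1 : D 1 = 0 := by simpa [hσ1] using hD 1 1
    rw [pow_zero, coeff_one]
    split_ifs <;> simp [h1]
  | succ m ih =>
    rw [pow_succ, der_coeff_mul σ D hD (even_coeff_pow σ hσ hσ1 he m) ih
      (der_curvatureFamily σ D hD hB hR₀ hDD) k, ← hP]
    congr 1
    have hX : P ^ m * (X * (P * C B - C B * P)) = X * (P ^ m * (P * C B - C B * P)) := by
      rw [← mul_assoc, ← X_mul, mul_assoc]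
    rw [hX]
    noncomm_ring

theorem trace_coeff_mul_comm {σ : 𝒜 →+ 𝒜} {t : 𝒜 →+ V}
    (ht : ∀ x y, σ x = x → t (x * y) = t (y * x)) {P : 𝒜[X]}
    (hP : ∀ k, σ (P.coeff k) = P.coeff k) (Q : 𝒜[X]) (k : ℕ) :
    t ((P * Q).coeff k) = t ((Q * P).coeff k) := by
  rw [coeff_mul, coeff_mul, map_sum, map_sum, ← Finset.Nat.sum_antidiagonal_swap]
  exact Finset.sum_congr rfl fun x _ => ht _ _ (hP _)

/-- The usual formula for the derivative of the trace of a power, with noncommuting coefficients: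
cyclicity brings the factor `P'` to the front. The extra power `P ^ j` on the right makes the
induction close; it is used with `j = 0`. -/
theorem trace_derivative_pow {σ : 𝒜 →+ 𝒜} {t : 𝒜 →+ V} (hσ : ∀ x y, σ (x * y) = σ x * σ y)
    (hσ1 : σ 1 = 1) (ht : ∀ x y, σ x = x → t (x * y) = t (y * x)) {P : 𝒜[X]}
    (hP : ∀ k, σ (P.coeff k) = P.coeff k) (m j k : ℕ) :
    t ((derivative (P ^ (m + 1)) * P ^ j).coeff k) =
      (m + 1) • t ((derivative P * P ^ (m + j)).coeff k) := by
  induction m generalizing j with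
  | zero => simp
  | succ m ih =>
    rw [pow_succ, derivative_mul, add_mul, coeff_add, map_add, mul_assoc, ← pow_succ', ih,
      mul_assoc, trace_coeff_mul_comm ht (even_coeff_pow σ hσ hσ1 hP (m + 1)), mul_assoc, ← pow_add,
      show m + (j + 1) = m + 1 + j by omega, show j + (m + 1) = m + 1 + j by omega,
      succ_nsmul _ (m + 1)]

-- With `Q = P^m`, Bianchi gives `D(BQ) = DB·Q - X·BQB + X·B²Q`. Under the trace the odd factor `B`
-- moves around `QB` with a sign, so `-BQB` contributes a second `B²Q`, and the result is `(DB + 2X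
-- B²) Q = P' Q`.
include hσ hσ1 hD hR hB hσD hR₀ hDD ht ht' in
theorem trace_der_transgression (m k : ℕ) :
    t (D ((C B * curvatureFamily R₀ (D B) B ^ m).coeff k)) =
      t ((derivative (curvatureFamily R₀ (D B) B) * curvatureFamily R₀ (D B) B ^ m).coeff k) := by
  have hpow := der_curvatureFamily_pow σ D hσ hσ1 hD hR hB hσD hR₀ hDD m
  have heven := even_coeff_pow σ hσ hσ1 (even_curvatureFamily σ D hσ hR hB hσD) m
  have hder : derivative (curvatureFamily R₀ (D B) B) =
      C (D B) + X * C (B * B) + X * C (B * B) := by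
    rw [curvatureFamily]
    simp only [derivative_add, derivative_monomial, ← monomial_zero_left, ← monomial_one_one_eq_X,
      monomial_mul_monomial]
    simp [add_assoc, ← map_add, mul_two]
  rw [hder]
  generalize curvatureFamily R₀ (D B) B ^ m = Q at *
  have h1 : D ((C B * Q).coeff k) = (C (D B) * Q - C B * (X * (Q * C B - C B * Q))).coeff k := by
    rw [coeff_C_mul, hD, hpow, hB, coeff_sub, coeff_C_mul, coeff_C_mul, neg_mul,
      ← sub_eq_add_neg]
  have h2 : C B * (X * (Q * C B - C B * Q)) = X * (C B * (Q * C B)) - X * (C (B * B) * Q) := by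
    rw [← mul_assoc, ← X_mul, mul_assoc, C_mul]
    noncomm_ring
  have h3 : t ((X * (C B * (Q * C B))).coeff k) = - t ((X * (C (B * B) * Q)).coeff k) := by
    cases k with
    | zero => simp
    | succ k =>
      rw [coeff_X_mul, coeff_X_mul, coeff_C_mul, coeff_mul_C, coeff_C_mul, ht' _ _ hB, hσ, heven, hB,
        mul_neg, neg_mul, map_neg, mul_assoc, ht _ _ (heven k)]
  rw [h1, h2, coeff_sub, map_sub, coeff_sub, map_sub, h3, add_mul, add_mul, coeff_add, coeff_add,
    map_add, map_add, mul_assoc]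
  abel

include hσ hσ1 hD hR hB hσD hR₀ hDD ht ht' htd in
/-- The transgression formula. -/
theorem trace_pow_sub_trace_pow (m : ℕ) : ∃ K : ℕ,
    t ((R₀ + D B + B * B) ^ (m + 1)) - t (R₀ ^ (m + 1)) =
      d (∑ k ∈ Finset.range K, ((m + 1 : ℝ) / (k + 1)) •
        t ((C B * curvatureFamily R₀ (D B) B ^ m).coeff k)) := by
  set P := curvatureFamily R₀ (D B) B with hP
  refine ⟨(P ^ (m + 1)).natDegree, ?_⟩
  -- The end point of the family: evaluation at `X = 1` sums the coefficients of `P ^ (m + 1)`. The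
  -- start, at `X = 0`, is the constant coefficient.
  have h1 : (R₀ + D B + B * B) ^ (m + 1) =
      ∑ k ∈ Finset.range ((P ^ (m + 1)).natDegree + 1), (P ^ (m + 1)).coeff k := by
    have h2 := map_pow (eval₂RingHom' (RingHom.id 𝒜) 1 fun _ => Commute.one_right _) P (m + 1)
    have h3 : eval₂RingHom' (RingHom.id 𝒜) 1 (fun _ => Commute.one_right _) P =
        R₀ + D B + B * B := by
      simp [hP, curvatureFamily, eval₂RingHom', eval₂_monomial]
    rw [h3] at h2
    rw [← h2]
    change eval₂ _ _ _ = _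
    rw [eval₂_eq_sum_range]
    simp
  have h0 : (P ^ (m + 1)).coeff 0 = R₀ ^ (m + 1) := by
    have h4 : ∀ j, (P ^ j).coeff 0 = R₀ ^ j := by
      intro j
      induction j with
      | zero => simp
      | succ j ih =>
        rw [pow_succ, mul_coeff_zero, ih, pow_succ]
        congr 1
        simp [hP, curvatureFamily, coeff_monomial]
    exact h4 _
  rw [h1, Finset.sum_range_succ', h0, map_add, add_sub_cancel_right, map_sum, map_sum]
  refine Finset.sum_congr rfl fun k _ => ?_
  -- The coefficient `k + 1` of `tr P^(m+1)` is the coefficient `k` of its derivative divided by `k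
  -- + 1`. This is integration over `[0, 1]` term by term and produces the factor `(m + 1) / (k +
  -- 1)`.
  have h5 := trace_derivative_pow hσ hσ1 ht (even_curvatureFamily σ D hσ hR hB hσD) m 0 k
  rw [pow_zero, mul_one, add_zero, ← trace_der_transgression σ D hσ hσ1 hD hR hB hσD hR₀ hDD t ht ht',
    ← hP, coeff_derivative, htd] at h5
  have h6 : t ((P ^ (m + 1)).coeff (k + 1) * ((k : 𝒜) + 1)) =
      ((k + 1 : ℕ) : ℝ) • t ((P ^ (m + 1)).coeff (k + 1)) := by
    rw [Nat.cast_smul_eq_nsmul, ← map_nsmul, nsmul_eq_mul', Nat.cast_succ]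
  have h7 : ((k + 1 : ℕ) : ℝ) ≠ 0 := by positivity
  rw [h6, ← Nat.cast_smul_eq_nsmul ℝ] at h5
  rw [map_smul, ← inv_smul_smul₀ h7 (t ((P ^ (m + 1)).coeff (k + 1))), h5, smul_smul]
  congr 1
  push_cast
  field_simp
end Transgression

/-! ### The trace on `Γ(End(V/W))`: cyclicity and compatibility with connections. -/

section Trace
variable {n : ℕ} {M : Type*} [TopologicalSpace M] [ChartedSpace (EuclideanSpace ℝ (Fin n)) M]
  [IsManifold (𝓡 n) ∞ M] [T2Space M]
variable {FV : Type*} [NormedAddCommGroup FV] [NormedSpace ℝ FV] [FiniteDimensional ℝ FV]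
  {V : M → Type*} [TopologicalSpace (TotalSpace FV V)] [∀ x, AddCommGroup (V x)]
  [∀ x, Module ℝ (V x)] [∀ x, TopologicalSpace (V x)] [FiberBundle FV V] [VectorBundle ℝ FV V]
  [ContMDiffVectorBundle ∞ FV V (𝓡 n)] {c : ℕ} (W : Subbundle n FV V c)

theorem SmoothFun.sum_apply {ι : Type*} (s : Finset ι) (f : ι → SmoothFun n M) (x : M) :
    (∑ i ∈ s, f i) x = ∑ i ∈ s, f i x :=
  map_sum (ContMDiffMap.evalRingHom x : SmoothFun n M →+* ℝ) f s

theorem Subbundle.trace_mul_comm (φ χ : Module.End (SmoothFun n M) W.QuotSec) :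
    W.trace (φ * χ) = W.trace (χ * φ) := by
  ext x
  change LinearMap.trace ℝ _ _ = LinearMap.trace ℝ _ _
  have h : ∀ φ χ, W.fiberEnd (φ * χ) x = W.fiberEnd φ x * W.fiberEnd χ x := by
    intro φ χ
    refine LinearMap.ext fun u => ?_
    obtain ⟨v, rfl⟩ := W.ev_surjective x u
    simp [W.fiberEnd_ev]
  rw [h, h, LinearMap.trace_mul_comm]

/-- The trace at `x` in terms of sections whose values form a basis at `x`. -/
theorem Subbundle.trace_apply_of_frame {x : M} {e : Fin c → W.QuotSec}
    (hli : LinearIndependent ℝ fun j => W.ev x (e j))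
    (hspan : ∀ v : W.QuotSec, ∃ f : Fin c → ℝ, W.ev x v = ∑ j, f j • W.ev x (e j))
    (φ : Module.End (SmoothFun n M) W.QuotSec) (f : Fin c → Fin c → ℝ)
    (hf : ∀ i, W.ev x (φ (e i)) = ∑ j, f i j • W.ev x (e j)) : W.trace φ x = ∑ i, f i i := by
  have hs : ⊤ ≤ Submodule.span ℝ (Set.range fun j => W.ev x (e j)) := by
    intro u _
    obtain ⟨v, rfl⟩ := W.ev_surjective x u
    obtain ⟨g, hg⟩ := hspan v
    rw [hg]
    exact Submodule.sum_mem _ fun j _ =>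
      Submodule.smul_mem _ _ (Submodule.subset_span ⟨j, rfl⟩)
  let b := Module.Basis.mk hli hs
  change LinearMap.trace ℝ _ _ = _
  rw [LinearMap.trace_eq_matrix_trace ℝ b, Matrix.trace]
  refine Finset.sum_congr rfl fun i _ => ?_
  have hb : ∀ j, b j = W.ev x (e j) := fun j => by simp [b]
  rw [Matrix.diag_apply, LinearMap.toMatrix_apply, hb, W.fiberEnd_ev, hf]
  simp only [← hb, map_sum, map_smul, Module.Basis.repr_self]
  simp [Finsupp.single_apply]

theorem VF.act_eq_of_eventuallyEq (X : VF n M) {f g : SmoothFun n M} {x : M}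
    (h : ∀ᶠ y in 𝓝 x, f y = g y) : X.act f x = X.act g x := by
  rw [VF.act_apply, VF.act_apply, mvfderiv, mvfderiv, Filter.EventuallyEq.mfderiv_eq h]
  rfl

theorem VF.act_const (X : VF n M) (r : ℝ) : X.act (ContMDiffMap.C r : SmoothFun n M) = 0 := by
  ext x
  change mvfderiv (𝓡 n) (fun _ : M => r) x (X x) = _
  rw [mvfderiv_const]; rfl

variable {F : Type*} [NormedAddCommGroup F] [NormedSpace ℝ F]
  {A : M → Type*} [TopologicalSpace (TotalSpace F A)] [∀ x, AddCommGroup (A x)]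
  [∀ x, Module ℝ (A x)] [∀ x, TopologicalSpace (A x)] [FiberBundle F A] [VectorBundle ℝ F A]
  [ContMDiffVectorBundle ∞ F A (𝓡 n)] {L : LieAlgebroid n F A}

/-- The trace is parallel: `tr [∇_a, φ] = ρ(a) (tr φ)`. -/
theorem Subbundle.trace_adHom (D : LinearConnection L.anchor W.QuotSec) (a : Sec n F A)
    (φ : Module.End (SmoothFun n M) W.QuotSec) :
    W.trace (D.adHom a φ) = L.actHom a (W.trace φ) := by
  ext x
  obtain ⟨ψ, e, U, hU, hψ, hli, hdec⟩ := W.exists_adapted_quot x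
  have hx := mem_of_mem_nhds hU
  have hsp : ∀ y ∈ U, ∀ v : W.QuotSec, ∃ f : Fin c → ℝ, W.ev y v = ∑ j, f j • W.ev y (e j) := by
    intro y hy v
    obtain ⟨f, hf⟩ := hdec v
    refine ⟨fun j => f j y, ?_⟩
    simpa only [W.ev_smul, map_sum, hψ y hy, one_smul] using congrArg (W.ev y) hf
  choose f hf using fun i => hdec (φ (e i))
  choose g hg using fun i => hdec (D.nabla a (e i))
  -- The trace equals the sum of diagonal coefficients on a neighbourhood of `x`, not only at `x`,
  -- so it may be differentiated there.
  have htr : (L.anchor a).act (W.trace φ) x = (L.anchor a).act (∑ i, f i i) x := by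
    refine VF.act_eq_of_eventuallyEq _ ?_
    filter_upwards [hU] with y hy
    rw [SmoothFun.sum_apply]
    refine W.trace_apply_of_frame (hli y hy) (hsp y hy) φ (fun i j => f i j y) fun i => ?_
    simpa only [W.ev_smul, map_sum, hψ y hy, one_smul] using congrArg (W.ev y) (hf i)
  -- The cutoff is constant near `x`, so it does not contribute when the frame expansions are
  -- differentiated.
  have hψ0 : (L.anchor a).act ψ x = 0 := by
    have h : (L.anchor a).act ψ x = (L.anchor a).act (ContMDiffMap.C 1 : SmoothFun n M) x := by
      refine VF.act_eq_of_eventuallyEq _ ?_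
      filter_upwards [hU] with y hy
      rw [hψ y hy]; rfl
    rw [h, VF.act_const]; rfl
  have hfx : ∀ i, W.ev x (φ (e i)) = ∑ j, f i j x • W.ev x (e j) := fun i => by
    simpa only [W.ev_smul, map_sum, hψ x hx, one_smul] using congrArg (W.ev x) (hf i)
  have hgx : ∀ i, W.ev x (D.nabla a (e i)) = ∑ j, g i j x • W.ev x (e j) := fun i => by
    simpa only [W.ev_smul, map_sum, hψ x hx, one_smul] using congrArg (W.ev x) (hg i)
  have h1 : ∀ i, W.ev x (D.nabla a (φ (e i))) = ∑ j, (f i j x • W.ev x (D.nabla a (e j)) +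
      (L.anchor a).act (f i j) x • W.ev x (e j)) := fun i => by
    have h := congrArg (fun v => W.ev x (D.nabla a v)) (hf i)
    simpa only [D.leibniz, D.nabla_sum_right, map_add, map_sum, W.ev_smul, hψ x hx, hψ0, one_smul,
      zero_smul, add_zero] using h
  have h2 : ∀ i, W.ev x (φ (D.nabla a (e i))) = ∑ j, g i j x • W.ev x (φ (e j)) := fun i => by
    have h := congrArg (fun v => W.ev x (φ v)) (hg i)
    simpa only [map_smul, map_sum, W.ev_smul, hψ x hx, one_smul] using h
  -- In the frame, `[∇_a, φ]` is the derivative of the coefficient matrix `f` of `φ` plus the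
  -- commutator of `f` with the connection matrix `g`. The commutator is traceless.
  have h3 : ∀ i, W.ev x (D.adHom a φ (e i)) = ∑ k, ((L.anchor a).act (f i k) x +
      ∑ j, (f i j x * g j k x - g i j x * f j k x)) • W.ev x (e k) := by
    intro i
    rw [LinearConnection.adHom_apply, map_sub, h1, h2]
    simp only [hfx, hgx, Finset.sum_add_distrib, add_smul, Finset.sum_smul, sub_smul,
      Finset.smul_sum, smul_smul, Finset.sum_sub_distrib]
    rw [Finset.sum_comm (f := fun i_1 i_2 => (f i i_1 x * g i_1 i_2 x) • W.ev x (e i_2)),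
      Finset.sum_comm (f := fun i_1 i_2 => (g i i_1 x * f i_1 i_2 x) • W.ev x (e i_2))]
    abel
  rw [W.trace_apply_of_frame (hli x hx) (hsp x hx) _ _ h3]
  change _ = (L.anchor a).act (W.trace φ) x
  have h4 : (L.anchor a).act (∑ i, f i i) x = ∑ i, (L.anchor a).act (f i i) x := by
    have := map_sum (L.actHom a) (fun i => f i i) Finset.univ
    change L.actHom a _ x = _
    rw [this, SmoothFun.sum_apply]
    rfl
  rw [htr, h4, Finset.sum_add_distrib, add_eq_left]
  simp only [Finset.sum_sub_distrib]
  rw [sub_eq_zero, Finset.sum_comm]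
  exact Finset.sum_congr rfl fun i _ => Finset.sum_congr rfl fun j _ => mul_comm _ _
end Trace

open Cochain

/-! ### Cochains that come from multilinear alternating forms. -/

section Forms
namespace Cochain
variable {R G S : Type*} [CommRing R] [AddCommGroup G] [Module R G]

section
variable [AddCommGroup S] [Module R S]
variable (R) in
/-- The cochains of degree `p` given by alternating `R`-multilinear maps. -/
def forms (p : ℕ) : AddSubgroup (Cochain G S) :=
  (AddMonoidHom.mk' (hat : (G [⋀^Fin p]→ₗ[R] S) → Cochain G S) hat_add).range

theorem hat_mem_forms {p : ℕ} (θ : G [⋀^Fin p]→ₗ[R] S) : hat θ ∈ forms R p := ⟨θ, rfl⟩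

theorem exists_of_mem_forms {p : ℕ} {θ : Cochain G S} (h : θ ∈ forms R p) :
    ∃ η : G [⋀^Fin p]→ₗ[R] S, hat η = θ := h

theorem hat_compAlternatingMap {S' : Type*} [AddCommGroup S'] [Module R S'] {p : ℕ} (t : S →ₗ[R] S')
    (θ : G [⋀^Fin p]→ₗ[R] S) : hat (t.compAlternatingMap θ) = map t.toAddMonoidHom (hat θ) := by
  ext l
  rw [map_apply, hat, hat, of_apply, of_apply]
  split_ifs
  · rfl
  · simp

theorem map_mem_forms {S' : Type*} [AddCommGroup S'] [Module R S'] {p : ℕ} (t : S →ₗ[R] S')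
    {θ : Cochain G S} (h : θ ∈ forms R p) : map t.toAddMonoidHom θ ∈ forms R p := by
  obtain ⟨η, rfl⟩ := exists_of_mem_forms h
  rw [← hat_compAlternatingMap]
  exact hat_mem_forms _

theorem smul_mem_forms {k : Type*} [Semiring k] [Module k S] [SMulCommClass R k S] {p : ℕ} (c : k)
    {θ : Cochain G S} (h : θ ∈ forms R p) : c • θ ∈ forms R p := by
  obtain ⟨η, rfl⟩ := exists_of_mem_forms h
  refine ⟨c • η, ?_⟩
  ext l
  change hat (c • η) l = _
  rw [Cochain.smul_apply, hat, hat, of_apply, of_apply]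
  split_ifs
  · rfl
  · simp
end

section
variable [Ring S] [Algebra R S]

variable (R) in
theorem hat_one : hat (AlternatingMap.constOfIsEmpty R G (Fin 0) (1 : S)) = 1 :=
  (homogeneous_hat _).ext Homogeneous.one fun v => by rw [hat_ofFn, List.ofFn_zero]; rfl

theorem one_mem_forms : (1 : Cochain G S) ∈ forms R 0 := by
  rw [← hat_one R]
  exact hat_mem_forms _

theorem mul_mem_forms [IsAddTorsionFree S] {p q r : ℕ} (hr : p + q = r) {α β : Cochain G S}
    (hα : α ∈ forms R p) (hβ : β ∈ forms R q) : α * β ∈ forms R r := by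
  subst hr
  obtain ⟨α, rfl⟩ := exists_of_mem_forms hα
  obtain ⟨β, rfl⟩ := exists_of_mem_forms hβ
  rw [← hat_wedge]
  exact hat_mem_forms _

open Polynomial in
-- Exactness asks for a primitive that is a genuine form, so the ingredients of the transgression
-- cochain must be tracked inside `forms`. Here `E` stands for `DB` and is only assumed to be a
-- form.
theorem coeff_curvatureFamily_pow_mem_forms [IsAddTorsionFree S] {R₀ E B : Cochain G S}
    (hR : R₀ ∈ forms R 2) (hE : E ∈ forms R 2) (hB : B ∈ forms R 1) (m k : ℕ) :
    (curvatureFamily R₀ E B ^ m).coeff k ∈ forms R (2 * m) := by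
  induction m generalizing k with
  | zero =>
    rw [pow_zero, coeff_one]
    split_ifs
    · exact one_mem_forms
    · exact zero_mem _
  | succ m ih =>
    have h : ∀ k, (curvatureFamily R₀ E B).coeff k ∈ forms R 2 := by
      intro k
      have hBB : B * B ∈ forms R 2 := mul_mem_forms rfl hB hB
      simp only [curvatureFamily, coeff_add, coeff_monomial]
      refine add_mem (add_mem ?_ ?_) ?_ <;> split_ifs <;> first | assumption | exact zero_mem _
    rw [pow_succ, coeff_mul]
    exact sum_mem fun x _ => mul_mem_forms (by ring) (ih _) (h _)
end
end Cochain
end Forms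

/-! ### Chern–Weil theory: independence of the connection. -/

section Pontryagin
variable {n : ℕ} {M : Type*} [TopologicalSpace M] [ChartedSpace (EuclideanSpace ℝ (Fin n)) M]
  [IsManifold (𝓡 n) ∞ M] [T2Space M]
variable {FV : Type*} [NormedAddCommGroup FV] [NormedSpace ℝ FV] [FiniteDimensional ℝ FV]
  {V : M → Type*} [TopologicalSpace (TotalSpace FV V)] [∀ x, AddCommGroup (V x)]
  [∀ x, Module ℝ (V x)] [∀ x, TopologicalSpace (V x)] [FiberBundle FV V] [VectorBundle ℝ FV V]
  [ContMDiffVectorBundle ∞ FV V (𝓡 n)] {c : ℕ}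
variable {F : Type*} [NormedAddCommGroup F] [NormedSpace ℝ F]
  {A : M → Type*} [TopologicalSpace (TotalSpace F A)] [∀ x, AddCommGroup (A x)]
  [∀ x, Module ℝ (A x)] [∀ x, TopologicalSpace (A x)] [FiberBundle F A] [VectorBundle ℝ F A]
  [ContMDiffVectorBundle ∞ F A (𝓡 n)] {L : LieAlgebroid n F A}

namespace LinearConnection
variable {P : Type*} [AddCommGroup P] [Module (SmoothFun n M) P] (D D' : LinearConnection L.anchor P)

theorem bar_hat_curvature : bar (hat D.curvature) = hat D.curvature := by
  simpa using (homogeneous_hat D.curvature).bar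

theorem bar_hat_diffForm : bar (hat (diffForm D D')) = - hat (diffForm D D') := by
  simpa using (homogeneous_hat (diffForm D D')).bar

theorem cdiff_one : D.cdiff 1 = 0 := by simpa using D.cdiff_mul 1 1

theorem cdiff_curvature_pow (i : ℕ) : D.cdiff (hat D.curvature ^ i) = 0 := by
  induction i with
  | zero => exact D.cdiff_one
  | succ i ih => rw [pow_succ, cdiff_mul, ih, cdiff_curvature, zero_mul, mul_zero, add_zero]

/-- Obtained from Bianchi for `D'`: substitute `R' = R + DB + B²` and `D' = D + [B, ·]` into `D'R' =
0`; everything except `DDB - RB + BR` cancels. No general formula for the square of the covariant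
differential is involved. -/
theorem cdiff_cdiff_diffForm : D.cdiff (D.cdiff (hat (diffForm D D'))) =
    hat D.curvature * hat (diffForm D D') - hat (diffForm D D') * hat D.curvature := by
  have h := D'.cdiff_curvature
  rw [cdiff_eq D D', bar_hat_curvature, hat_curvature_eq D D', map_add, map_add, cdiff_curvature,
    cdiff_mul, bar_hat_diffForm] at h
  rw [← sub_eq_zero, ← h]
  noncomm_ring
end LinearConnection

/-- The trace as an additive map. -/
abbrev Subbundle.traceHom (W : Subbundle n FV V c) :
    Module.End (SmoothFun n M) W.QuotSec →+ SmoothFun n M := W.trace.toAddMonoidHom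

theorem LieAlgebroid.cdiff_one (L : LieAlgebroid n F A) : L.cdiff 1 = 0 := by
  simpa using L.cdiff_mul 1 1

variable (W : Subbundle n FV V c)

theorem cdiff_map_trace (D : LinearConnection L.anchor W.QuotSec)
    (θ : Cochain (Sec n F A) (Module.End (SmoothFun n M) W.QuotSec)) :
    map W.traceHom (D.cdiff θ) = L.cdiff (map W.traceHom θ) :=
  map_diff _ _ _ _ (fun a φ => W.trace_adHom D a φ) θ

/-- The cochain `tr(R_D^i)`. -/
def characterCochain (D : LinearConnection L.anchor W.QuotSec) (i : ℕ) :
    Cochain (Sec n F A) (SmoothFun n M) := map W.traceHom (hat D.curvature ^ i)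

theorem hat_pontryaginCharacter (D : LinearConnection L.anchor W.QuotSec) (i : ℕ) :
    hat (pontryaginCharacter W D i) = characterCochain W D i := by
  rw [pontryaginCharacter, hat_compAlternatingMap, D.hat_curvaturePow]
  rfl

theorem characterCochain_mem_forms (D : LinearConnection L.anchor W.QuotSec) (i : ℕ) :
    characterCochain W D i ∈ forms (SmoothFun n M) (2 * i) :=
  hat_pontryaginCharacter W D i ▸ hat_mem_forms _

theorem cdiff_characterCochain (D : LinearConnection L.anchor W.QuotSec) (i : ℕ) :
    L.cdiff (characterCochain W D i) = 0 := by
  rw [characterCochain, ← cdiff_map_trace, D.cdiff_curvature_pow, map_zero]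

theorem bar_characterCochain (D : LinearConnection L.anchor W.QuotSec) (i : ℕ) :
    bar (characterCochain W D i) = characterCochain W D i := by
  rw [← hat_pontryaginCharacter]
  simpa using (homogeneous_hat (pontryaginCharacter W D i)).bar

/-- The scalar differential as a linear map. -/
def LieAlgebroid.cdiffLinear (L : LieAlgebroid n F A) :
    Cochain (Sec n F A) (SmoothFun n M) →ₗ[ℝ] Cochain (Sec n F A) (SmoothFun n M) where
  toFun := L.cdiff
  map_add' := map_add _
  map_smul' := L.cdiff_smul

theorem LinearConnection.exists_trace_pow_sub (D D' : LinearConnection L.anchor W.QuotSec) (m : ℕ) :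
    ∃ K : ℕ, map W.traceHom ((hat D.curvature + D.cdiff (hat (D.diffForm D')) +
        hat (D.diffForm D') * hat (D.diffForm D')) ^ (m + 1)) -
        map W.traceHom (hat D.curvature ^ (m + 1)) =
      L.cdiffLinear (∑ k ∈ Finset.range K, ((m + 1 : ℝ) / (k + 1)) •
        map W.traceHom ((Polynomial.C (hat (D.diffForm D')) *
          curvatureFamily (hat D.curvature) (D.cdiff (hat (D.diffForm D'))) (hat (D.diffForm D')) ^
            m).coeff k)) := by
  refine trace_pow_sub_trace_pow (σ := bar) (D := D.cdiff) ?_ ?_ ?_ ?_ ?_ ?_ ?_ ?_ _ _ ?_ ?_ ?_ m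
  · exact bar_mul
  · exact bar_one
  · exact D.cdiff_mul
  · exact D.bar_hat_curvature
  · exact D.bar_hat_diffForm D'
  · intro x
    rw [LinearConnection.cdiff, diff_bar, neg_neg]
  · exact D.cdiff_curvature
  · exact D.cdiff_cdiff_diffForm D'
  · exact fun x => cdiff_map_trace W D x
  · exact fun x y hx => map_mul_comm_of_even _ W.trace_mul_comm hx y
  · exact fun x y hx => map_mul_comm_of_odd _ W.trace_mul_comm hx y

/-- The characters of two connections differ by an exact form. -/
theorem exists_characterCochain_sub (D D' : LinearConnection L.anchor W.QuotSec) (m : ℕ) :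
    ∃ η ∈ forms (SmoothFun n M) (2 * m + 1),
      characterCochain W D' (m + 1) = characterCochain W D (m + 1) + L.cdiff η := by
  have := isAddTorsionFree_of_smoothFun (n := n) (M := M) (Module.End (SmoothFun n M) W.QuotSec)
  -- The differential is not shown to preserve `forms`; instead `DB = R' - R - B²` exhibits `DB` as
  -- a combination of forms.
  have hE : D.cdiff (hat (D.diffForm D')) ∈ forms (SmoothFun n M) 2 := by
    have h := D.hat_curvature_eq D'
    have h2 : D.cdiff (hat (D.diffForm D')) = hat D'.curvature - hat D.curvature -
        hat (D.diffForm D') * hat (D.diffForm D') := by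
      rw [h]; abel
    rw [h2]
    exact AddSubgroup.sub_mem _ (AddSubgroup.sub_mem _ (hat_mem_forms _) (hat_mem_forms _))
      (mul_mem_forms (p := 1) (q := 1) rfl (hat_mem_forms _) (hat_mem_forms _))
  obtain ⟨K, hK⟩ := D.exists_trace_pow_sub W D' m
  rw [← D.hat_curvature_eq, sub_eq_iff_eq_add'] at hK
  refine ⟨_, sum_mem fun k _ => ?_, hK⟩
  refine smul_mem_forms _ (map_mem_forms _ ?_)
  rw [Polynomial.coeff_C_mul]
  exact mul_mem_forms (by ring) (hat_mem_forms _)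
    (coeff_curvatureFamily_pow_mem_forms (hat_mem_forms _) hE (hat_mem_forms _) m k)

/-- The product of the cochains `tr(R_D^i)`, `i` in a list of exponents. -/
def characterProduct (D : LinearConnection L.anchor W.QuotSec) (is : List ℕ) :
    Cochain (Sec n F A) (SmoothFun n M) := (is.map (characterCochain W D)).prod

theorem characterProduct_mem_forms (D : LinearConnection L.anchor W.QuotSec) (is : List ℕ) :
    characterProduct W D is ∈ forms (SmoothFun n M) (2 * is.sum) := by
  have := isAddTorsionFree_of_smoothFun (n := n) (M := M) (SmoothFun n M)
  induction is with
  | nil => exact one_mem_forms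
  | cons i is ih =>
    rw [characterProduct, List.map_cons, List.prod_cons, List.sum_cons]
    exact mul_mem_forms (by ring) (characterCochain_mem_forms W D i) ih

theorem hat_wedge_pontryaginCharacter (D : LinearConnection L.anchor W.QuotSec) (i : ℕ) {r : ℕ}
    (θ : AForm n F A r) :
    hat (wedge (pontryaginCharacter W D i) θ) = characterCochain W D i * hat θ := by
  have := isAddTorsionFree_of_smoothFun (n := n) (M := M) (SmoothFun n M)
  rw [hat_wedge, hat_pontryaginCharacter]

/-- Bianchi and the compatibility of the trace with connections make each character closed; the
Leibniz rule passes this to products. -/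
theorem IsPontryaginForm.cdiff_eq_zero {W : Subbundle n FV V c} {r : ℕ} {θ : AForm n F A r}
    (h : IsPontryaginForm L W r θ) : L.cdiff (hat θ) = 0 := by
  induction h with
  | one => rw [hat_one, L.cdiff_one]
  | mul D i hi r θ hθ ih =>
    rw [hat_wedge_pontryaginCharacter, L.cdiff_mul, ih, cdiff_characterCochain, zero_mul, mul_zero,
      add_zero]

theorem pontryaginSpace_le_cohomology (r : ℕ) : pontryaginSpace L W r ≤ L.Cohomology r := by
  refine Submodule.span_le.2 ?_
  rintro _ ⟨θ, hθ, rfl⟩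
  exact ⟨θ, L.mem_closedForms hθ.cdiff_eq_zero, rfl⟩

/-- Up to exact forms, the connections in a Pontryagin form may be replaced by a fixed one. -/
theorem IsPontryaginForm.exists_eq_characterProduct {W : Subbundle n FV V c}
    (D : LinearConnection L.anchor W.QuotSec) {r : ℕ} {θ : AForm n F A r}
    (h : IsPontryaginForm L W r θ) : ∃ is : List ℕ, 2 * is.sum = r ∧ ∃ ζ,
      (r = 0 → ζ = 0) ∧ (∀ k, r = k + 1 → ζ ∈ forms (SmoothFun n M) k) ∧
      hat θ = characterProduct W D is + L.cdiff ζ := by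
  have := isAddTorsionFree_of_smoothFun (n := n) (M := M) (SmoothFun n M)
  induction h with
  | one =>
    refine ⟨[], rfl, 0, fun _ => rfl, fun k hk => by omega, ?_⟩
    rw [hat_one, map_zero, add_zero]
    rfl
  | mul D' i hi r θ hθ ih =>
    obtain ⟨m, rfl⟩ : ∃ m, i = m + 1 := ⟨i - 1, by omega⟩
    obtain ⟨is, his, ζ, hζ0, hζ, hθζ⟩ := ih
    obtain ⟨η, hη, hη'⟩ := exists_characterCochain_sub W D D' m
    -- With `χ' = χ + dη` and `θ = Π + dζ`, where `χ` and `θ` are closed and `χ` is even, `χ'θ = χΠ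
    -- + d(χζ + ηθ)`. The separate clause `ζ = 0` in degree `0` covers the absence of forms of
    -- degree `-1`.
    refine ⟨(m + 1) :: is, by simp [mul_add, his], characterCochain W D (m + 1) * ζ + η * hat θ,
      fun h => by omega, fun k hk => ?_, ?_⟩
    · refine add_mem ?_ (mul_mem_forms (by omega) hη (hat_mem_forms θ))
      rcases r with _ | r
      · rw [hζ0 rfl, mul_zero]
        exact zero_mem _
      · exact mul_mem_forms (by omega) (characterCochain_mem_forms W D (m + 1)) (hζ r rfl)
    · rw [hat_wedge_pontryaginCharacter, hη', map_add, L.cdiff_mul, L.cdiff_mul,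
        cdiff_characterCochain, hθ.cdiff_eq_zero, bar_characterCochain, characterProduct,
        List.map_cons, List.prod_cons, add_mul]
      nth_rw 1 [hθζ]
      rw [characterProduct]
      noncomm_ring

theorem pontryaginSpace_eq_bot (D : LinearConnection L.anchor W.QuotSec) {r : ℕ} (hr : 0 < r)
    (h : ∀ is : List ℕ, 2 * is.sum = r → characterProduct W D is = 0) :
    pontryaginSpace L W r = ⊥ := by
  obtain ⟨r, rfl⟩ : ∃ k, r = k + 1 := ⟨r - 1, by omega⟩
  rw [eq_bot_iff, pontryaginSpace, Submodule.span_le]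
  rintro _ ⟨θ, hθ, rfl⟩
  obtain ⟨is, his, ζ, -, hζ, hθζ⟩ := IsPontryaginForm.exists_eq_characterProduct D hθ
  obtain ⟨η, rfl⟩ := exists_of_mem_forms (hζ r rfl)
  rw [h is his, zero_add] at hθζ
  simpa using L.mem_exactForms_succ η hθζ
end Pontryagin

/-! ### The dimension count behind Bott vanishing. -/

section Vanishing
namespace Cochain

open Classical in
theorem excess_ofFn {G : Type*} (N : G → Prop) {r : ℕ} (w : Fin r → G) :
    excess N (List.ofFn w) = ∑ i, if N (w i) then 0 else 1 := by
  induction r with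
  | zero => simp [excess]
  | succ r ih =>
    rw [List.ofFn_succ, excess, Fin.sum_univ_succ, ih]
    split_ifs <;> ring
end Cochain

variable {n : ℕ} {M : Type*} [TopologicalSpace M] [ChartedSpace (EuclideanSpace ℝ (Fin n)) M]
  [IsManifold (𝓡 n) ∞ M] [T2Space M]
variable {F : Type*} [NormedAddCommGroup F] [NormedSpace ℝ F] [FiniteDimensional ℝ F]
  {A : M → Type*} [TopologicalSpace (TotalSpace F A)] [∀ x, AddCommGroup (A x)]
  [∀ x, Module ℝ (A x)] [∀ x, TopologicalSpace (A x)] [FiberBundle F A] [VectorBundle ℝ F A]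
  [ContMDiffVectorBundle ∞ F A (𝓡 n)] {c : ℕ}

/-- A form that vanishes as soon as fewer than `k` arguments lie outside a subbundle of codimension
less than `k` is zero. -/
theorem eq_zero_of_vanishesBelow (J : Subbundle n F A c) {r k : ℕ} (hk : c < k) (θ : AForm n F A r)
    (h : VanishesBelow (fun a => a ∈ J.sec) k (hat θ)) : θ = 0 := by
  classical
  ext a x
  obtain ⟨ψ, e, U, hU, hψ, -, hdec⟩ := J.exists_adapted x
  choose f hf using hdec
  -- Near `x` each argument is a section of `J` (index `none`, coefficient `1`) plus a combination
  -- of `c` transverse sections (indices `some j`). The cutoff `ψ` makes this decomposition global.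
  let coef : Fin r → Option (Fin c) → SmoothFun n M := fun i o => o.elim 1 (f (a i))
  let vec : Fin r → Option (Fin c) → Sec n F A :=
    fun i o => o.elim (ψ • a i - ∑ j, f (a i) j • e j) e
  have h1 : ∀ i, ψ • a i = ∑ o, coef i o • vec i o := by
    intro i
    rw [Fintype.sum_option]
    simp [coef, vec]
  have h2 : θ (fun i => ψ • a i) = 0 := by
    simp only [h1]
    have h3 := θ.toMultilinearMap.map_sum (fun i o => coef i o • vec i o)
    refine h3.trans (Finset.sum_eq_zero fun ch _ => ?_)
    refine (θ.toMultilinearMap.map_smul_univ (fun i => coef i (ch i)) fun i => vec i (ch i)).trans ?_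
    suffices h4 : θ (fun i => vec i (ch i)) = 0 by
      rw [AlternatingMap.coe_multilinearMap, h4, smul_zero]
    -- After multilinear expansion, a term with fewer than `k` transverse arguments vanishes by `h`.
    -- A term with at least `k > c` of them repeats one of the `c` transverse sections and vanishes
    -- by alternation.
    by_cases hch : ((Finset.univ.filter fun i => ch i ≠ none).card < k)
    · rw [← hat_ofFn θ]
      refine h _ (lt_of_le_of_lt ?_ hch)
      rw [excess_ofFn, Finset.card_filter]
      refine Finset.sum_le_sum fun i _ => ?_
      by_cases hi : ch i = none
      · have : vec i (ch i) ∈ J.sec := by rw [hi]; exact hf (a i)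
        simp [this]
      · simp only [ne_eq, hi, not_false_eq_true, if_true]
        split_ifs <;> simp
    · obtain ⟨i, hi, j, hj, hij, heq⟩ := Finset.exists_ne_map_eq_of_card_lt_of_maps_to
        (s := Finset.univ.filter fun i => ch i ≠ none)
        (t := (Finset.univ : Finset (Fin c)).map Function.Embedding.some) (f := ch)
        (by rw [Finset.card_map, Finset.card_univ, Fintype.card_fin]; omega)
        (by
          intro i hi
          have hi' : ch i ≠ none := by simpa using hi
          obtain ⟨m, hm⟩ := Option.ne_none_iff_exists'.1 hi'
          simp [hm])
      obtain ⟨m, hm⟩ := Option.ne_none_iff_exists'.1 (Finset.mem_filter.1 hi).2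
      refine θ.map_eq_zero_of_eq _ (i := i) (j := j) ?_ hij
      simp only [← heq, hm]
      rfl
  -- The cutoff comes out as `ψ ^ r`, which is `1` at `x`.
  have h5 := θ.toMultilinearMap.map_smul_univ (fun _ => ψ) a
  rw [AlternatingMap.coe_multilinearMap, h2, Finset.prod_const] at h5
  have h6 : (ψ x) ^ r * θ a x = 0 := by
    have := congrArg (fun g : SmoothFun n M => g x) h5
    have h7 : ∀ m : ℕ, (ψ ^ m : SmoothFun n M) x = ψ x ^ m := fun m =>
      map_pow (ContMDiffMap.evalRingHom x : SmoothFun n M →+* ℝ) ψ m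
    simpa [h7] using this.symm
  rw [hψ x (mem_of_mem_nhds hU), one_pow, one_mul] at h6
  exact h6

variable {FV : Type*} [NormedAddCommGroup FV] [NormedSpace ℝ FV] [FiniteDimensional ℝ FV]
  {V : M → Type*} [TopologicalSpace (TotalSpace FV V)] [∀ x, AddCommGroup (V x)]
  [∀ x, Module ℝ (V x)] [∀ x, TopologicalSpace (V x)] [FiberBundle FV V] [VectorBundle ℝ FV V]
  [ContMDiffVectorBundle ∞ FV V (𝓡 n)] {c' : ℕ} {L : LieAlgebroid n F A}

/-- Bott vanishing: products of characters of a connection that is flat along a subbundle. -/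
theorem characterProduct_eq_zero (J : Subbundle n F A c) (W : Subbundle n FV V c')
    (D : LinearConnection L.anchor W.QuotSec)
    (hD : ∀ a ∈ J.sec, ∀ b ∈ J.sec, D.curvatureEnd a b = 0) {is : List ℕ} (his : c < is.sum) :
    characterProduct W D is = 0 := by
  obtain ⟨θ, hθ⟩ := exists_of_mem_forms (characterProduct_mem_forms W D is)
  have h1 : VanishesBelow (fun a => a ∈ J.sec) 1 (hat D.curvature) := by
    intro l hl
    by_cases h2 : l.length = 2
    · obtain ⟨a, b, rfl⟩ := List.length_eq_two.1 h2
      simp only [excess] at hl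
      rw [D.hat_curvature_pair]
      refine hD a ?_ b ?_
      · by_contra ha
        simp [ha] at hl
      · by_contra hb
        simp only [hb, if_false] at hl
        split_ifs at hl <;> omega
    · exact homogeneous_hat _ l h2
  have h2 : VanishesBelow (fun a => a ∈ J.sec) is.sum (characterProduct W D is) := by
    clear his hθ θ
    induction is with
    | nil => exact VanishesBelow.zero _
    | cons i is ih =>
      rw [characterProduct, List.map_cons, List.prod_cons, List.sum_cons]
      have h3 := (h1.pow i).map W.traceHom
      rw [one_mul] at h3
      exact h3.mul ih
  rw [← hθ] at h2 ⊢
  rw [eq_zero_of_vanishesBelow J his θ h2]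
  ext1 l
  rw [hat, of_apply]
  split_ifs <;> rfl
end Vanishing

/-! ### Existence of connections and splittings from a partition of unity. -/

section DualBasis
variable {n : ℕ} {M : Type*} [TopologicalSpace M] [ChartedSpace (EuclideanSpace ℝ (Fin n)) M]
  [IsManifold (𝓡 n) ∞ M]
variable {F : Type*} [NormedAddCommGroup F] [NormedSpace ℝ F]
  {V : M → Type*} [TopologicalSpace (TotalSpace F V)] [∀ x, AddCommGroup (V x)]
  [∀ x, Module ℝ (V x)] [∀ x, TopologicalSpace (V x)] [FiberBundle F V] [VectorBundle ℝ F V]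
  {c : ℕ} {W : Subbundle n F V c}

theorem Subbundle.quotSec_ext {u v : W.QuotSec} (h : ∀ x, W.ev x u = W.ev x v) : u = v := by
  obtain ⟨a, rfl⟩ := Submodule.Quotient.mk_surjective _ u
  obtain ⟨b, rfl⟩ := Submodule.Quotient.mk_surjective _ v
  refine (Submodule.Quotient.eq _).2 fun x => ?_
  exact (Submodule.Quotient.eq _).1 (h x)

/-- A locally finite dual basis of `Γ(V/W)`. -/
structure Subbundle.DualBasis (W : Subbundle n F V c) where
  /-- The generating sections. -/
  e : M × Fin c → Sec n F V
  /-- The coefficient functionals. -/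
  ξ : M × Fin c → W.QuotSec →ₗ[SmoothFun n M] SmoothFun n M
  /-- The indices that matter near a point. -/
  s : M → Finset (M × Fin c)
  eventually_eq_zero : ∀ x, ∀ᶠ y in 𝓝 x, ∀ i ∉ s x, ∀ v, ξ i v y = 0
  ev_eq_sum : ∀ x v, W.ev x v = ∑ i ∈ s x, ξ i v x • W.ev x (Submodule.Quotient.mk (e i))

theorem Subbundle.nonempty_dualBasis [T2Space M] [SecondCountableTopology M]
    [ContMDiffVectorBundle ∞ F V (𝓡 n)] [FiniteDimensional ℝ F] (W : Subbundle n F V c) :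
    Nonempty W.DualBasis := by
  classical
  have : LocallyCompactSpace M := ChartedSpace.locallyCompactSpace (EuclideanSpace ℝ (Fin n)) M
  choose ψ e U hU hψ hli hdec using W.exists_adapted_quot
  choose f hf using hdec
  choose e' he' using fun x₀ j => Submodule.Quotient.mk_surjective _ (e x₀ j)
  obtain ⟨φ, hφ⟩ := SmoothPartitionOfUnity.exists_isSubordinate (𝓡 n) (isClosed_univ (X := M))
    (fun x => interior (U x)) (fun x => isOpen_interior)
    (fun x _ => Set.mem_iUnion.2 ⟨x, mem_interior_iff_mem_nhds.2 (hU x)⟩)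
  have hφU : ∀ x₀ x, φ x₀ x ≠ 0 → x ∈ U x₀ := fun x₀ x h =>
    interior_subset (hφ x₀ (subset_tsupport _ h))
  have hev : ∀ x₀, ∀ x ∈ U x₀, ∀ v, W.ev x v = ∑ j, f x₀ v j x • W.ev x (e x₀ j) := by
    intro x₀ x hx v
    have h := congrArg (W.ev x) (hf x₀ v)
    simpa only [W.ev_smul, map_sum, hψ x₀ x hx, one_smul] using h
  -- The coefficients `f x₀ v` were picked separately for each `v` and need not be linear in `v`. On
  -- `U x₀` they are unique, hence linear there, and elsewhere `φ x₀` kills them.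
  have huniq : ∀ x₀, ∀ x ∈ U x₀, ∀ v, ∀ g : Fin c → ℝ, W.ev x v = ∑ j, g j • W.ev x (e x₀ j) →
      ∀ j, f x₀ v j x = g j := by
    intro x₀ x hx v g hg j
    have h := Fintype.linearIndependent_iff.1 (hli x₀ x hx) (fun j => f x₀ v j x - g j) (by
      simp only [sub_smul, Finset.sum_sub_distrib]
      rw [← hev x₀ x hx, ← hg, sub_self]) j
    exact sub_eq_zero.1 h
  refine ⟨⟨fun i => e' i.1 i.2, fun i =>
    { toFun := fun v => φ i.1 * f i.1 v i.2
      map_add' := fun u v => ?_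
      map_smul' := fun g v => ?_ }, fun x => φ.fintsupport x ×ˢ Finset.univ, fun x => ?_,
      fun x v => ?_⟩⟩
  · ext x
    change φ i.1 x * f i.1 (u + v) i.2 x = φ i.1 x * f i.1 u i.2 x + φ i.1 x * f i.1 v i.2 x
    by_cases h : φ i.1 x = 0
    · simp [h]
    · rw [huniq i.1 x (hφU _ _ h) (u + v) (fun j => f i.1 u j x + f i.1 v j x) (by
        simp only [add_smul, Finset.sum_add_distrib]
        rw [← hev _ _ (hφU _ _ h), ← hev _ _ (hφU _ _ h), map_add]), mul_add]
  · ext x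
    change φ i.1 x * f i.1 (g • v) i.2 x = g x * (φ i.1 x * f i.1 v i.2 x)
    by_cases h : φ i.1 x = 0
    · simp [h]
    · rw [huniq i.1 x (hφU _ _ h) (g • v) (fun j => g x * f i.1 v j x) (by
        simp only [mul_smul, ← Finset.smul_sum]
        rw [← hev _ _ (hφU _ _ h), W.ev_smul])]
      ring
  · filter_upwards [φ.eventually_finsupport_subset x] with y hy i hi v
    have h : φ i.1 y = 0 := by
      by_contra h
      exact hi (Finset.mk_mem_product (hy ((φ.mem_finsupport y).2 h)) (Finset.mem_univ i.2))
    change φ i.1 y * f i.1 v i.2 y = 0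
    rw [h, zero_mul]
  · rw [Finset.sum_product]
    change _ = ∑ x₀ ∈ φ.fintsupport x, ∑ j, (φ x₀ x * f x₀ v j x) •
      W.ev x (Submodule.Quotient.mk (e' x₀ j))
    have h1 : ∀ x₀, ∑ j, (φ x₀ x * f x₀ v j x) • W.ev x (Submodule.Quotient.mk (e' x₀ j)) =
        φ x₀ x • W.ev x v := by
      intro x₀
      by_cases h : φ x₀ x = 0
      · simp [h]
      · rw [hev x₀ x (hφU _ _ h) v, Finset.smul_sum]
        exact Finset.sum_congr rfl fun j _ => by rw [he', mul_smul]
    simp only [h1]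
    rw [← Finset.sum_smul, φ.sum_finsupport' x (Set.mem_univ x) (φ.finsupport_subset_fintsupport x),
      one_smul]

namespace Subbundle.DualBasis
variable (B : W.DualBasis)

/-- The locally finite sum `∑ g_i e_i`. -/
def glue (g : M × Fin c → SmoothFun n M) (hg : ∀ x, ∀ᶠ y in 𝓝 x, ∀ i ∉ B.s x, g i y = 0) : Sec n F V :=
  ⟨fun x => ∑ᶠ i, g i x • B.e i x, by
    refine ContMDiff.finsum_section_of_locallyFinite (fun x => ⟨_, hg x, ?_⟩)
      fun i => (g i).contMDiff.smul_section (B.e i).contMDiff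
    refine (B.s x).finite_toSet.subset ?_
    rintro i ⟨y, hy, hy'⟩
    by_contra hi
    exact hy (by rw [hy' i hi, zero_smul])⟩

theorem glue_apply (g : M × Fin c → SmoothFun n M) (hg : ∀ x, ∀ᶠ y in 𝓝 x, ∀ i ∉ B.s x, g i y = 0)
    (x : M) : B.glue g hg x = ∑ i ∈ B.s x, g i x • B.e i x := by
  refine finsum_eq_sum_of_support_subset _ fun i hi => ?_
  by_contra h
  exact hi (by
    change g i x • B.e i x = 0
    rw [(hg x).self_of_nhds i h, zero_smul])

theorem ev_glue (g : M × Fin c → SmoothFun n M) (hg : ∀ x, ∀ᶠ y in 𝓝 x, ∀ i ∉ B.s x, g i y = 0) (x : M) :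
    W.ev x (Submodule.Quotient.mk (B.glue g hg)) =
      ∑ i ∈ B.s x, g i x • W.ev x (Submodule.Quotient.mk (B.e i)) := by
  rw [W.ev_mk, B.glue_apply, ← Submodule.mkQ_apply, map_sum]
  rfl

theorem eventually_coeff_eq_zero (v : W.QuotSec) (x : M) :
    ∀ᶠ y in 𝓝 x, ∀ i ∉ B.s x, B.ξ i v y = 0 := by
  filter_upwards [B.eventually_eq_zero x] with y hy i hi using hy i hi v

/-- The linear section of `Γ(V) → Γ(V/W)` given by a dual basis. -/
def splitting : W.QuotSec →ₗ[SmoothFun n M] Sec n F V where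
  toFun v := B.glue (fun i => B.ξ i v) (B.eventually_coeff_eq_zero v)
  map_add' u v := by
    ext x
    refine (B.glue_apply _ (B.eventually_coeff_eq_zero (u + v)) x).trans ?_
    refine Eq.trans ?_ (congrArg₂ (· + ·) (B.glue_apply _ (B.eventually_coeff_eq_zero u) x)
      (B.glue_apply _ (B.eventually_coeff_eq_zero v) x)).symm
    simp only [← Finset.sum_add_distrib, ← add_smul, map_add]
    rfl
  map_smul' f v := by
    ext x
    refine (B.glue_apply _ (B.eventually_coeff_eq_zero (f • v)) x).trans ?_
    refine Eq.trans ?_ (congrArg (f x • ·) (B.glue_apply _ (B.eventually_coeff_eq_zero v) x)).symm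
    simp only [Finset.smul_sum, smul_smul, map_smul]
    rfl

theorem mk_splitting (v : W.QuotSec) : Submodule.Quotient.mk (B.splitting v) = v :=
  W.quotSec_ext fun x =>
    (B.ev_glue _ (B.eventually_coeff_eq_zero v) x).trans (B.ev_eq_sum x v).symm

variable [T2Space M]

theorem eventually_act_eq_zero (X : VF n M) (v : W.QuotSec) (x : M) :
    ∀ᶠ y in 𝓝 x, ∀ i ∉ B.s x, X.act (B.ξ i v) y = 0 := by
  -- The derivative vanishes at `y` only if the function vanishes near `y`, hence the passage to
  -- neighbourhoods of `y`.
  filter_upwards [(B.eventually_eq_zero x).eventually_nhds] with y hy i hi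
  have h : X.act (B.ξ i v) y = X.act (ContMDiffMap.C 0 : SmoothFun n M) y := by
    refine VF.act_eq_of_eventuallyEq _ ?_
    filter_upwards [hy] with z hz using hz i hi v
  rw [h, VF.act_const]
  rfl

/-- The connection `∇_X v = ∑ X(ξ_i v) e_i` given by a dual basis. -/
def connection : LinearConnection (LinearMap.id : VF n M →ₗ[SmoothFun n M] VF n M) W.QuotSec where
  nabla X v := Submodule.Quotient.mk
    (B.glue (fun i => X.act (B.ξ i v)) (B.eventually_act_eq_zero X v))
  add_left X Y v := W.quotSec_ext fun x => by
    simp only [map_add, ev_glue, VF.add_act, ← Finset.sum_add_distrib, ← add_smul]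
    rfl
  smul_left f X v := W.quotSec_ext fun x => by
    simp only [W.ev_smul, ev_glue, VF.smul_act, Finset.smul_sum, smul_smul]
    rfl
  add_right X u v := W.quotSec_ext fun x => by
    simp only [map_add, ev_glue, VF.act_add, ← Finset.sum_add_distrib, ← add_smul]
    rfl
  leibniz X f v := W.quotSec_ext fun x => by
    -- The product rule for `f · ξ_i v`; the terms containing `X f` add up to `(X f) v` by the dual
    -- basis property.
    have h : ∀ i, X.act (B.ξ i (f • v)) x = f x * X.act (B.ξ i v) x + X.act f x * B.ξ i v x := by
      intro i
      rw [map_smul, smul_eq_mul, X.act_mul, mul_comm (X.act f x)]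
      rfl
    simp only [map_add, W.ev_smul, ev_glue, h, add_smul, Finset.sum_add_distrib, mul_smul,
      ← Finset.smul_sum]
    rw [← B.ev_eq_sum]
    rfl

end Subbundle.DualBasis

/-! ### Extension of a flat partial connection. -/

section Extension
variable [T2Space M] [SecondCountableTopology M] [ContMDiffVectorBundle ∞ F V (𝓡 n)]
  [FiniteDimensional ℝ F] {q : ℕ}

/-- A flat partial connection along an involutive subbundle extends to a connection that is flat
along the subbundle. -/
theorem exists_extension (B : TangentSubbundle n M q) (hB : Involutive B) (W : Subbundle n F V c)
    (nab : LinearConnection B.sec.subtype W.QuotSec)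
    (hflat : ∀ (X Y : B.sec) (e : W.QuotSec), nab.nabla X (nab.nabla Y e) -
      nab.nabla Y (nab.nabla X e) - nab.nabla ⟨VF.bracket X.1 Y.1, hB X.1 X.2 Y.1 Y.2⟩ e = 0) :
    ∃ D : LinearConnection (tangentLieAlgebroid n M).anchor W.QuotSec,
      ∀ X ∈ B.sec, ∀ Y ∈ B.sec, D.curvatureEnd X Y = 0 := by
  obtain ⟨b⟩ := B.nonempty_dualBasis
  obtain ⟨b'⟩ := W.nonempty_dualBasis
  -- `σ` is the projection of `TM` onto a complement of `B`, and `τ = id - σ` is the projection onto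
  -- `B`. The connection uses `nab` along `τ X` and an arbitrary connection along `σ X`.
  let σ : VF n M →ₗ[SmoothFun n M] VF n M := b.splitting.comp B.sec.mkQ
  have hσ : ∀ X, X - σ X ∈ B.sec := fun X => by
    rw [← Submodule.Quotient.mk_eq_zero, Submodule.Quotient.mk_sub, sub_eq_zero]
    exact (b.mk_splitting _).symm
  let τ : VF n M →ₗ[SmoothFun n M] B.sec :=
    (LinearMap.id - σ).codRestrict B.sec hσ
  have hτ : ∀ X, (τ X : VF n M) = X - σ X := fun X => rfl
  have hanchor : ∀ X : VF n M, (tangentLieAlgebroid n M).anchor X = X := fun X => rfl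
  let D : LinearConnection (tangentLieAlgebroid n M).anchor W.QuotSec :=
    { nabla := fun X v => b'.connection.nabla (σ X) v + nab.nabla (τ X) v
      add_left := fun X Y v => by
        simp only [map_add, LinearConnection.add_left]; abel
      smul_left := fun f X v => by
        simp only [map_smul, LinearConnection.smul_left, smul_add]
      add_right := fun X u v => by
        simp only [LinearConnection.add_right]; abel
      leibniz := fun X f v => by
        have h : VF.act X f = VF.act (σ X) f + VF.act (τ X : VF n M) f := by
          rw [← VF.add_act, hτ, add_sub_cancel]
        rw [LinearConnection.leibniz, LinearConnection.leibniz, hanchor, h, add_smul, smul_add]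
        change _ + VF.act (σ X) f • v + (_ + VF.act (τ X : VF n M) f • v) = _
        abel }
  have hD : ∀ (X : B.sec) v, D.nabla X.1 v = nab.nabla X v := by
    intro X v
    have h1 : σ X.1 = 0 := by
      change b.splitting (B.sec.mkQ X.1) = 0
      rw [(Submodule.Quotient.mk_eq_zero B.sec).2 X.2 |> fun h => (h : B.sec.mkQ X.1 = 0), map_zero]
    have h2 : τ X.1 = X := Subtype.ext (by rw [hτ, h1, sub_zero])
    have h3 : b'.connection.nabla 0 v = 0 := by simpa using b'.connection.smul_left 0 0 v
    change b'.connection.nabla (σ X.1) v + nab.nabla (τ X.1) v = _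
    rw [h1, h2, h3, zero_add]
  -- By involutivity the bracket is again a section of `B`, so on `B` the curvature of `D` involves
  -- only `nab` and is zero.
  refine ⟨D, fun X hX Y hY => LinearMap.ext fun e => ?_⟩
  rw [D.curvatureEnd_apply, hD ⟨Y, hY⟩, hD ⟨X, hX⟩, hD ⟨X, hX⟩, hD ⟨Y, hY⟩]
  exact (congrArg (_ - ·) (hD ⟨VF.bracket X Y, hB X hX Y hY⟩ e)).trans (hflat ⟨X, hX⟩ ⟨Y, hY⟩ e)

/-- The Jacobi identity for vector fields, read modulo sections of `B`. -/
theorem bottConnection_flat (B : TangentSubbundle n M q) (hB : Involutive B) (X Y : B.sec)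
    (e : B.QuotSec) : (bottConnection B hB).nabla X ((bottConnection B hB).nabla Y e) -
      (bottConnection B hB).nabla Y ((bottConnection B hB).nabla X e) -
      (bottConnection B hB).nabla ⟨VF.bracket X.1 Y.1, hB X.1 X.2 Y.1 Y.2⟩ e = 0 := by
  obtain ⟨Z, rfl⟩ := Submodule.Quotient.mk_surjective _ e
  have h : VF.bracket X.1 (VF.bracket Y.1 Z) =
      VF.bracket (VF.bracket X.1 Y.1) Z + VF.bracket Y.1 (VF.bracket X.1 Z) :=
    (tangentLieAlgebroid n M).jacobi X.1 Y.1 Z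
  change (Submodule.Quotient.mk (VF.bracket X.1 (VF.bracket Y.1 Z)) : B.QuotSec) -
    Submodule.Quotient.mk (VF.bracket Y.1 (VF.bracket X.1 Z)) -
    Submodule.Quotient.mk (VF.bracket (VF.bracket X.1 Y.1) Z) = 0
  rw [h, Submodule.Quotient.mk_add]
  abel
end Extension
end DualBasis

/-! ### Pullback of connections along the anchor. -/

section Anchor
variable {n : ℕ} {M : Type*} [TopologicalSpace M] [ChartedSpace (EuclideanSpace ℝ (Fin n)) M]
  [IsManifold (𝓡 n) ∞ M] [T2Space M]

/-- A vector field is determined by its action on functions. -/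
theorem VF.eq_zero_of_act_eq_zero (X : VF n M) (h : ∀ f : SmoothFun n M, X.act f = 0) : X = 0 := by
  ext x
  obtain ⟨χ⟩ : Nonempty (SmoothBumpFunction (𝓡 n) x) := inferInstance
  -- `w` is the coordinate vector of `X x`. The test function, near `x` the inner product of the
  -- chart with `w`, has derivative `⟪w, w⟫` along `X x`; so `w = 0`, and the chart differential is
  -- injective.
  set w : EuclideanSpace ℝ (Fin n) := mfderiv (𝓡 n) 𝓘(ℝ, EuclideanSpace ℝ (Fin n))
    (extChartAt (𝓡 n) x) x (X x) with hw
  let g : M → ℝ := fun y => innerSL ℝ w (extChartAt (𝓡 n) x y)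
  have hg : ContMDiffOn (𝓡 n) 𝓘(ℝ, ℝ) ∞ g (chartAt (EuclideanSpace ℝ (Fin n)) x).source :=
    (innerSL ℝ w).contMDiff.comp_contMDiffOn contMDiffOn_extChartAt
  let f : SmoothFun n M := ⟨fun y => χ y • g y, χ.contMDiff_smul hg⟩
  have h1 : X.act f x = mvfderiv (𝓡 n) g x (X x) := by
    have h2 : (f : M → ℝ) =ᶠ[𝓝 x] g := by
      filter_upwards [χ.eventuallyEq_one] with y hy
      change χ y • g y = g y
      rw [hy]; simp
    rw [VF.act_apply, mvfderiv, mvfderiv, h2.mfderiv_eq]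
    rfl
  have hch : MDifferentiableAt (𝓡 n) 𝓘(ℝ, EuclideanSpace ℝ (Fin n)) (extChartAt (𝓡 n) x) x :=
    (contMDiffAt_extChartAt (n := ∞)).mdifferentiableAt (by simp)
  have h3 : mvfderiv (𝓡 n) g x (X x) = innerSL ℝ w w := by
    have h4 := mfderiv_comp x ((innerSL ℝ w).mdifferentiableAt (x := extChartAt (𝓡 n) x x)) hch
    rw [(innerSL ℝ w).mfderiv_eq] at h4
    exact congrArg (fun T => T (X x)) h4
  rw [h f, h3] at h1
  have hw0 : w = 0 := inner_self_eq_zero.1 h1.symm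
  obtain ⟨E, hE⟩ := isInvertible_mfderiv_extChartAt (I := 𝓡 n) (mem_extChartAt_source (I := 𝓡 n) x)
  have h5 : E (X x) = 0 := (congrArg (fun T => T (X x)) hE).trans hw0
  exact E.injective (h5.trans (map_zero E).symm)

variable {F : Type*} [NormedAddCommGroup F] [NormedSpace ℝ F]
  {A : M → Type*} [TopologicalSpace (TotalSpace F A)] [∀ x, AddCommGroup (A x)]
  [∀ x, Module ℝ (A x)] [∀ x, TopologicalSpace (A x)] [FiberBundle F A] [VectorBundle ℝ F A]
  [ContMDiffVectorBundle ∞ F A (𝓡 n)] (L : LieAlgebroid n F A)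

/-- Both sides act on functions as the commutator of the actions of `L.anchor a` and `L.anchor b`:
`act_bracket` for `L` and for the tangent algebroid. -/
theorem LieAlgebroid.anchor_bracket (a b : Sec n F A) :
    L.anchor (L.bracket a b) = VF.bracket (L.anchor a) (L.anchor b) := by
  rw [← sub_eq_zero]
  refine VF.eq_zero_of_act_eq_zero _ fun f => ?_
  have h := (tangentLieAlgebroid n M).act_bracket (L.anchor a) (L.anchor b) f
  have h2 : (VF.bracket (L.anchor a) (L.anchor b)).act f =
    (L.anchor a).act ((L.anchor b).act f) - (L.anchor b).act ((L.anchor a).act f) := h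
  have h3 := VF.smul_act (-1) (VF.bracket (L.anchor a) (L.anchor b)) f
  rw [sub_eq_add_neg, ← neg_one_smul (SmoothFun n M), VF.add_act, h3, h2, L.act_bracket]
  ring

variable {P : Type*} [AddCommGroup P] [Module (SmoothFun n M) P]

/-- The pullback of a `TM`-connection along the anchor. -/
def LinearConnection.pullbackAnchor
    (D : LinearConnection (tangentLieAlgebroid n M).anchor P) : LinearConnection L.anchor P where
  nabla a e := D.nabla (L.anchor a) e
  add_left a b e := by rw [map_add, D.add_left]
  smul_left f a e := by rw [map_smul, D.smul_left]
  add_right a e e' := D.add_right _ e e'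
  leibniz a f e := D.leibniz _ f e

variable (D : LinearConnection (tangentLieAlgebroid n M).anchor P)

theorem LinearConnection.curvatureEnd_pullbackAnchor (a b : Sec n F A) :
    (D.pullbackAnchor L).curvatureEnd a b = D.curvatureEnd (L.anchor a) (L.anchor b) := by
  refine LinearMap.ext fun e => ?_
  rw [curvatureEnd_apply, curvatureEnd_apply]
  change _ - D.nabla (L.anchor (L.bracket a b)) e = _
  rw [L.anchor_bracket]
  rfl

theorem LinearConnection.hat_curvature_pullbackAnchor :
    hat (D.pullbackAnchor L).curvature = pullback L.anchor (hat D.curvature) := by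
  ext1 l
  by_cases h : l.length = 2
  · obtain ⟨a, b, rfl⟩ := List.length_eq_two.1 h
    rw [hat_curvature_pair, curvatureEnd_pullbackAnchor, ← hat_curvature_pair]
    rfl
  · rw [homogeneous_hat _ l h, pullback, of_apply, homogeneous_hat _ _ (by simpa using h)]

variable {FV : Type*} [NormedAddCommGroup FV] [NormedSpace ℝ FV] [FiniteDimensional ℝ FV]
  {V : M → Type*} [TopologicalSpace (TotalSpace FV V)] [∀ x, AddCommGroup (V x)]
  [∀ x, Module ℝ (V x)] [∀ x, TopologicalSpace (V x)] [FiberBundle FV V] [VectorBundle ℝ FV V]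
  [ContMDiffVectorBundle ∞ FV V (𝓡 n)] {c : ℕ} (W : Subbundle n FV V c)

/-- Pullback is multiplicative and commutes with the trace of values, so the compatibility for the
curvature is enough. It carries vanishing over `TM` to vanishing over `A`. -/
theorem characterProduct_pullbackAnchor
    (D : LinearConnection (tangentLieAlgebroid n M).anchor W.QuotSec) (is : List ℕ) :
    characterProduct W (D.pullbackAnchor L) is = pullback L.anchor (characterProduct W D is) := by
  induction is with
  | nil => exact (pullback_one _).symm
  | cons i is ih =>
    have h : characterCochain W (D.pullbackAnchor L) i =
        pullback L.anchor (characterCochain W D i) := by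
      rw [characterCochain, D.hat_curvature_pullbackAnchor, ← pullback_pow]
      rfl
    simp only [characterProduct, List.map_cons, List.prod_cons, pullback_mul] at ih ⊢
    rw [ih, h]

end Anchor

end

/-! ### The vanishing theorem. -/

theorem mainTheorem11 {n : ℕ} {M : Type*} [TopologicalSpace M]
    [ChartedSpace (EuclideanSpace ℝ (Fin n)) M] [IsManifold (𝓡 n) ∞ M] [T2Space M]
    [SecondCountableTopology M]
    {F : Type*} [NormedAddCommGroup F] [NormedSpace ℝ F] [FiniteDimensional ℝ F]
    {A : M → Type*} [TopologicalSpace (TotalSpace F A)] [∀ x, AddCommGroup (A x)]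
    [∀ x, Module ℝ (A x)] [∀ x, TopologicalSpace (A x)] [FiberBundle F A] [VectorBundle ℝ F A]
    [ContMDiffVectorBundle ∞ F A (𝓡 n)]
    (L : LieAlgebroid n F A) {q s : ℕ} (S : InfinitesimalIdealSystem L q s) :
    -- the Pontryagin spaces consist of cohomology classes
    (∀ r, pontryaginSpace (tangentLieAlgebroid n M) S.J r ≤ (tangentLieAlgebroid n M).Cohomology r ∧
      pontryaginSpace (tangentLieAlgebroid n M) S.FM r ≤ (tangentLieAlgebroid n M).Cohomology r ∧
      pontryaginSpace L S.J r ≤ L.Cohomology r ∧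
      pontryaginSpace L S.FM r ≤ L.Cohomology r) ∧
    -- the spaces `Pont^r(A/J)` and `Pont^r(TM/F_M)` in `H^r(M)`
    (∀ r, 2 * q < r →
      pontryaginSpace (tangentLieAlgebroid n M) S.J r = ⊥ ∧
      pontryaginSpace (tangentLieAlgebroid n M) S.FM r = ⊥) ∧
    -- the spaces `Pont^r_A(A/J)` and `Pont^r_A(TM/F_M)` in `H^r(A)`
    (∀ r, 2 * min s q < r →
      pontryaginSpace L S.J r = ⊥ ∧
      pontryaginSpace L S.FM r = ⊥) := by
  obtain ⟨D, hD⟩ := exists_extension S.FM S.involutive S.J S.conn S.flat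
  obtain ⟨D', hD'⟩ := exists_extension S.FM S.involutive S.FM (bottConnection S.FM S.involutive)
    (bottConnection_flat S.FM S.involutive)
  have hJ : ∀ a ∈ S.J.sec, L.anchor a ∈ S.FM.sec := fun a ha x => S.rho_mem x _ (ha x)
  refine ⟨fun r => ⟨pontryaginSpace_le_cohomology _ r, pontryaginSpace_le_cohomology _ r,
    pontryaginSpace_le_cohomology _ r, pontryaginSpace_le_cohomology _ r⟩, fun r hr => ?_,
    fun r hr => ?_⟩
  · exact ⟨pontryaginSpace_eq_bot _ D (by omega) fun is his =>
        characterProduct_eq_zero S.FM S.J D hD (by omega),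
      pontryaginSpace_eq_bot _ D' (by omega) fun is his =>
        characterProduct_eq_zero S.FM S.FM D' hD' (by omega)⟩
  -- If `s ≤ q`, the count runs over `A` relative to `J`, along which the pulled back connections
  -- are flat. If `q ≤ s`, the forms over `TM` already vanish, and so do their pullbacks.
  · rcases le_total s q with hsq | hsq
    · rw [min_eq_left hsq] at hr
      exact ⟨pontryaginSpace_eq_bot _ (D.pullbackAnchor L) (by omega) fun is his =>
          characterProduct_eq_zero S.J S.J _ (fun a ha b hb => by
            rw [D.curvatureEnd_pullbackAnchor, hD _ (hJ a ha) _ (hJ b hb)]) (by omega),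
        pontryaginSpace_eq_bot _ (D'.pullbackAnchor L) (by omega) fun is his =>
          characterProduct_eq_zero S.J S.FM _ (fun a ha b hb => by
            rw [D'.curvatureEnd_pullbackAnchor, hD' _ (hJ a ha) _ (hJ b hb)]) (by omega)⟩
    · rw [min_eq_right hsq] at hr
      exact ⟨pontryaginSpace_eq_bot _ (D.pullbackAnchor L) (by omega) fun is his => by
          rw [characterProduct_pullbackAnchor, characterProduct_eq_zero S.FM S.J D hD (by omega)]
          rfl,
        pontryaginSpace_eq_bot _ (D'.pullbackAnchor L) (by omega) fun is his => by
          rw [characterProduct_pullbackAnchor, characterProduct_eq_zero S.FM S.FM D' hD' (by omega)]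
          rfl⟩
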